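/- **Setting.** A contract design instance with $m\ge 1$ outcomes $\Omega=\{0,\dots,m-1\}$ consists of principal's values $0\le v_0\le\dots\le v_{m-1}\le 1$; an arbitrary (possibly infinite) set $A$ of actions; for each $a\in A$ a cost $c_a\in[0,1]$ and a distribution $D_a$ on $\Omega$ with mass function $f(\cdot\mid a)$; and a null action of cost $0$ whose outcome is always $0$. A contract is a vector $p\in[0,\infty)^\Omega$; it is $H$-bounded if $p_\omega\le H$ for all $\omega$. For every contract $p$ the agent plays a best response $a^*(p)$, assumed to exist: an action maximizing $\sum_\omega f(\omega\mid a)p_\omega-c_a$ over $A$, with ties broken in favor of the principal. The principal's utility is $u_{\mathrm p}(p)=\sum_\omega f(\omega\mid a^*(p))(v_\omega-p_\omega)$, and $\mathrm{OPT}_H$ is the supremum of $u_{\mathrm p}(p)$ over $H$-bounded $p$. Write $D\succeq D'$ (first-order stochastic dominance) if $\Pr_{D}[\omega'\ge\omega]\ge\Pr_{D'}[\omega'\ge\omega]$ for all $\omega\in\Omega$. * FOSD: $c_a\ge c_{a'}$ implies $D_a\succeq D_{a'}$. * CDFP: if $c_{a''}=\lambda c_a+(1-\lambda)c_{a'}$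 with $0\le\lambda\le1$, then $D_{a''}\succeq\lambda D_a+(1-\lambda)D_{a'}$. **Contract query model.** A learning algorithm is given $m,v,H,\varepsilon,\delta$, but neither $A$ nor the costs and outcome distributions. It adaptively posts contracts (not necessarily $H$-bounded); each posted contract $p$ is answered by a fresh sample $\omega\sim D_{a^*(p)}$, and $a^*(p)$ itself is not observed. Finally it outputs a contract. An algorithm is a program for a real RAM (exact real arithmetic and comparisons at unit cost, natural-number registers with addition and truncated subtraction, registers and indexed tables, rational constants only, no rounding) with the contract oracle as an additional unit-cost instruction. Time is the number of steps. **Theorem 3.8.** There are a single such program, the same for all inputs and instances, and universal constants $C,K\in\mathbb R$, $k,d\in\mathbb N$ such that the following holds for every $m\ge1$, every instance with $m$ outcomes that satisfies FOSD and CDFP, and all reals $H\ge1$, $0<\varepsilon<\frac12$, $0<\delta<1$. The program always halts within $$K\left(m+H+\tfrac1\varepsilon+\ln\tfrac1\delta\right)^{d}$$ steps, always makes at most $$C\cdot\frac{m^{11}H^{10}}{\varepsilon^{20}}\cdot\left(\ln\frac{mH}{\varepsilon\delta}\right)^{k}=\tilde O\!\left(\frac{m^{11}H^{10}}{\varepsilon^{20}}\right)$$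 contract queries, and always outputs an $H$-bounded contract; and with probability at least $1-\delta$ the output $p$ satisfies $u_{\mathrm p}(p)\ge\mathrm{OPT}_H-\varepsilon$. -/

import Mathlib

open scoped NNReal ENNReal

universe u

noncomputable section

namespace ContractLearning

/-! ## The principal-agent model -/

/-- A contract: a payment for each of the `m` outcomes `0, …, m - 1`. Payments are nonnegative
(limited liability). -/
abbrev Contract (m : ℕ) : Type := Fin m → ℝ≥0

/-- `p` is an `H`-bounded contract. -/
def Contract.IsBounded {m : ℕ} (p : Contract m) (H : ℝ) : Prop := ∀ ω, (p ω : ℝ) ≤ H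

/-- First-order stochastic dominance `D ⪰ D'` between distributions on the ordered outcomes,
given by their probability mass functions `f` and `g`: every upper tail of `f` is at least as
likely as that of `g`. -/
def Dominates {m : ℕ} (f g : Fin m → ℝ) : Prop :=
  ∀ ω, ∑ ω' ∈ Finset.Ici ω, g ω' ≤ ∑ ω' ∈ Finset.Ici ω, f ω'

/-- A hidden-action contract design problem with `m` outcomes: the principal's normalized and
sorted values, an arbitrary (possibly infinite) set of actions, their costs (normalized to be at
most `1`) and outcome distributions, and a null action of cost `0` that always leads to the
outcome `0`. -/
structure Problem (m : ℕ) [NeZero m] : Type (u + 1) where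
  value : Fin m → ℝ
  value_nonneg : ∀ ω, 0 ≤ value ω
  value_le_one : ∀ ω, value ω ≤ 1
  value_mono : Monotone value
  Action : Type u
  cost : Action → ℝ
  cost_nonneg : ∀ a, 0 ≤ cost a
  cost_le_one : ∀ a, cost a ≤ 1
  dist : Action → PMF (Fin m)
  null : Action
  cost_null : cost null = 0
  dist_null : dist null = PMF.pure 0

namespace Problem

variable {m : ℕ} [NeZero m] (I : Problem.{u} m)

/-- The probability `f(ω | a)` of outcome `ω` under action `a`. -/
def prob (a : I.Action) (ω : Fin m) : ℝ := (I.dist a ω).toReal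

/-- First-order stochastic dominance assumption: a costlier action has a better outcome
distribution. -/
def FOSD : Prop := ∀ a a' : I.Action, I.cost a' ≤ I.cost a → Dominates (I.prob a) (I.prob a')

/-- Concavity of distribution function property: an action whose cost is the average of the costs
of two actions is at least as good as the corresponding mixture of those actions. -/
def CDFP : Prop :=
  ∀ (a a' a'' : I.Action) (t : ℝ), 0 ≤ t → t ≤ 1 →
    I.cost a'' = t * I.cost a + (1 - t) * I.cost a' →
    Dominates (I.prob a'') (fun ω => t * I.prob a ω + (1 - t) * I.prob a' ω)

/-- The agent's expected utility from taking action `a` under the contract `p`. -/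
def agentUtility (p : Contract m) (a : I.Action) : ℝ := ∑ ω, I.prob a ω * (p ω : ℝ) - I.cost a

/-- The principal's expected utility under the contract `p` if the agent takes action `a`. -/
def principalUtilityOf (p : Contract m) (a : I.Action) : ℝ :=
  ∑ ω, I.prob a ω * (I.value ω - (p ω : ℝ))

/-- `a` maximizes the agent's utility under `p`. -/
def IsOptimalAction (p : Contract m) (a : I.Action) : Prop :=
  ∀ a', I.agentUtility p a' ≤ I.agentUtility p a

/-- `a` is a best response to `p`: it maximizes the agent's utility, ties being broken in favor of
the principal. -/
def IsBestResponse (p : Contract m) (a : I.Action) : Prop :=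
  I.IsOptimalAction p a ∧
    ∀ a', I.IsOptimalAction p a' → I.principalUtilityOf p a' ≤ I.principalUtilityOf p a

/-- The principal's expected utility of the contract `p` when the agent responds with `br p`. -/
def principalUtility (br : Contract m → I.Action) (p : Contract m) : ℝ :=
  I.principalUtilityOf p (br p)

/-- The optimal principal's utility achievable by `H`-bounded contracts (a supremum over a set that
is nonempty for `0 ≤ H` and bounded above by `1`). -/
def optBounded (br : Contract m → I.Action) (H : ℝ) : ℝ :=
  sSup (I.principalUtility br '' {p | p.IsBounded H})

/-- The contract oracle: a posted contract `p` is answered by an outcome drawn from the outcome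
distribution of the agent's best response. Only the outcome is revealed. -/
def contractOracle (br : Contract m → I.Action) (p : Contract m) : PMF (Fin m) := I.dist (br p)

end Problem

/-! ## The machine model

A real RAM with access to an oracle, programmed in a while language. The memory consists of natural
number registers, real registers, and tables (two-dimensional arrays) of naturals and of reals. Real
arithmetic and comparisons are exact; there is no rounding and no conversion from reals to naturals.
Programs are finite syntactic objects containing only rational constants. -/

/-- The memory of the machine. -/
structure Store where
  nvar : ℕ → ℕ
  rvar : ℕ → ℝ
  ntab : ℕ → ℕ → ℕ → ℕ
  rtab : ℕ → ℕ → ℕ → ℝ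

/-- Natural number expressions; subtraction is truncated. -/
inductive NExp where
  | lit (n : ℕ)
  | var (x : ℕ)
  | tab (t : ℕ) (i j : NExp)
  | add (e e' : NExp)
  | sub (e e' : NExp)

/-- The value of a natural number expression. -/
def NExp.eval (s : Store) : NExp → ℕ
  | .lit n => n
  | .var x => s.nvar x
  | .tab t i j => s.ntab t (i.eval s) (j.eval s)
  | .add e e' => e.eval s + e'.eval s
  | .sub e e' => e.eval s - e'.eval s

/-- Real expressions; a division by zero returns zero. -/
inductive RExp where
  | lit (q : ℚ)
  | var (x : ℕ)
  | tab (t : ℕ) (i j : NExp)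
  | ofNat (e : NExp)
  | add (e e' : RExp)
  | sub (e e' : RExp)
  | mul (e e' : RExp)
  | div (e e' : RExp)

/-- The value of a real expression. -/
def RExp.eval (s : Store) : RExp → ℝ
  | .lit q => (q : ℝ)
  | .var x => s.rvar x
  | .tab t i j => s.rtab t (i.eval s) (j.eval s)
  | .ofNat e => (e.eval s : ℝ)
  | .add e e' => e.eval s + e'.eval s
  | .sub e e' => e.eval s - e'.eval s
  | .mul e e' => e.eval s * e'.eval s
  | .div e e' => e.eval s / e'.eval s

/-- Boolean expressions: comparisons of naturals and of reals, negation and conjunction. -/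
inductive BExp where
  | nle (e e' : NExp)
  | rle (e e' : RExp)
  | not (b : BExp)
  | and (b b' : BExp)

/-- The truth value of a Boolean expression. -/
def BExp.eval (s : Store) : BExp → Prop
  | .nle e e' => e.eval s ≤ e'.eval s
  | .rle e e' => e.eval s ≤ e'.eval s
  | .not b => ¬ b.eval s
  | .and b b' => b.eval s ∧ b'.eval s

/-- Programs. `setN`, `setR` assign to registers and `setNTab`, `setRTab` to table entries;
`query x t i` posts row `i` of the real table `t` as a contract to the oracle and stores the observed
outcome in the natural number register `x`; `loop b c` is the loop "while `b` do `c`". -/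
inductive Cmd where
  | setN (x : ℕ) (e : NExp)
  | setR (x : ℕ) (e : RExp)
  | setNTab (t : ℕ) (i j e : NExp)
  | setRTab (t : ℕ) (i j : NExp) (e : RExp)
  | query (x t : ℕ) (i : NExp)
  | seq (c c' : Cmd)
  | ite (b : BExp) (c c' : Cmd)
  | loop (b : BExp) (c : Cmd)

namespace Store

/-- Assignment to a natural number register. -/
def setN (s : Store) (x n : ℕ) : Store := { s with nvar := Function.update s.nvar x n }

/-- Assignment to a real register. -/
def setR (s : Store) (x : ℕ) (r : ℝ) : Store := { s with rvar := Function.update s.rvar x r }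

/-- Assignment to an entry of a table of naturals. -/
def setNTab (s : Store) (t i j n : ℕ) : Store :=
  { s with ntab := fun t' i' j' => if t' = t ∧ i' = i ∧ j' = j then n else s.ntab t' i' j' }

/-- Assignment to an entry of a table of reals. -/
def setRTab (s : Store) (t i j : ℕ) (r : ℝ) : Store :=
  { s with rtab := fun t' i' j' => if t' = t ∧ i' = i ∧ j' = j then r else s.rtab t' i' j' }

/-- Row `i` of the real table `t`, read as a contract for `m` outcomes (a negative entry is read as
the payment `0`). -/
def contract (s : Store) (m t i : ℕ) : Contract m := fun ω => (s.rtab t i ω).toNNReal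

end Store

/-- A configuration: the stack of commands that remain to be executed, the memory, and the number of
oracle queries made so far. -/
structure Config where
  todo : List Cmd
  store : Store
  queries : ℕ

/-- The machine halts when nothing remains to be executed. -/
def Config.Halted (c : Config) : Prop := c.todo = []

open Classical in
/-- One step of the machine. A step executes one assignment, one query, one test, or unfolds one
sequential composition. (Expressions occurring in a fixed program have bounded size, so the number
of steps agrees with the number of elementary operations up to a constant factor that depends only
on the program.) Only a query is random: it is answered by a fresh sample from the oracle's
distribution for the posted contract. A halted configuration no longer changes. -/
def step {m : ℕ} (oracle : Contract m → PMF (Fin m)) : Config → PMF Config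
  | ⟨[], s, q⟩ => PMF.pure ⟨[], s, q⟩
  | ⟨.setN x e :: k, s, q⟩ => PMF.pure ⟨k, s.setN x (e.eval s), q⟩
  | ⟨.setR x e :: k, s, q⟩ => PMF.pure ⟨k, s.setR x (e.eval s), q⟩
  | ⟨.setNTab t i j e :: k, s, q⟩ =>
      PMF.pure ⟨k, s.setNTab t (i.eval s) (j.eval s) (e.eval s), q⟩
  | ⟨.setRTab t i j e :: k, s, q⟩ =>
      PMF.pure ⟨k, s.setRTab t (i.eval s) (j.eval s) (e.eval s), q⟩
  | ⟨.query x t i :: k, s, q⟩ =>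
      (oracle (s.contract m t (i.eval s))).map fun ω => ⟨k, s.setN x (ω : ℕ), q + 1⟩
  | ⟨.seq c c' :: k, s, q⟩ => PMF.pure ⟨c :: c' :: k, s, q⟩
  | ⟨.ite b c c' :: k, s, q⟩ => PMF.pure ⟨(if b.eval s then c else c') :: k, s, q⟩
  | ⟨.loop b c :: k, s, q⟩ =>
      PMF.pure (if b.eval s then ⟨c :: .loop b c :: k, s, q⟩ else ⟨k, s, q⟩)

/-- The distribution of the configuration after `T` steps. -/
def run {m : ℕ} (oracle : Contract m → PMF (Fin m)) : ℕ → Config → PMF Config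
  | 0, c => PMF.pure c
  | T + 1, c => (step oracle c).bind (run oracle T)

/-- The initial memory: the number `m` of outcomes in natural number register `0`; the payment bound
`H`, the accuracy `ε` and the error probability `δ` in the real registers `0`, `1`, `2`; the
principal's values in row `0` of the real table `0`; everything else is zero. -/
def inputStore (m : ℕ) (v : Fin m → ℝ) (H ε δ : ℝ) : Store where
  nvar x := if x = 0 then m else 0
  rvar x := if x = 0 then H else if x = 1 then ε else if x = 2 then δ else 0
  ntab _ _ _ := 0
  rtab t i j := if t = 0 ∧ i = 0 then (if h : j < m then v ⟨j, h⟩ else 0) else 0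

/-- The initial configuration of the program `P`. -/
def initial (P : Cmd) (m : ℕ) (v : Fin m → ℝ) (H ε δ : ℝ) : Config :=
  ⟨[P], inputStore m v H ε δ, 0⟩

/-- The distribution of the configuration after the learning algorithm `P`, given `m`, the values,
`H`, `ε` and `δ` as input, has interacted for `T` steps with the contract oracle of `I`. -/
def Problem.execute {m : ℕ} [NeZero m] (I : Problem.{u} m) (br : Contract m → I.Action) (P : Cmd)
    (H ε δ : ℝ) (T : ℕ) : PMF Config :=
  run (I.contractOracle br) T (initial P m I.value H ε δ)

/-- The contract output by the machine: row `0` of the real table `1`. -/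
def Config.output (c : Config) (m : ℕ) : Contract m := c.store.contract m 1 0

end ContractLearning

end

noncomputable section

namespace ContractLearning

section

/-! ## Expectations -/

/-! The algorithm enumerates candidate actions by means of linear contracts and, for each of them,
searches for a contract by projected gradient descent. An action `a` and a contract `p'` are
compared through `penalizedUtility`, the principal's utility of the pair minus `1 / s` times the
agent's regret; this makes sense even if `p'` does not induce `a`.

Structure (`exists_penalizedUtility_ge`). Let `b` be the response to a bounded contract `p`, with
cost between those of the responses to two neighbouring slopes of the grid. By CDFP, the
distribution of `b` dominates the mixture of these two responses that has the cost of `b` on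
average. Optimality at the two slopes forces the expected outcomes of `b` and of the mixture to
differ by at most `τ / α₀ ^ 2` (`mixture_mean_le`). Under dominance, close means imply close
expectations of every function of bounded oscillation (`Dominates.sum_sub_le`). So the penalized
utilities of the two responses at `p`, averaged with the mixture weights, nearly reach the
principal's utility of `p`, and one of the two does so by itself. FOSD settles the two ends of the
grid.

Search (`Problem.principalUtility_mix_ge`, `Problem.descent_step`). The contract posted is `q = (1 -
s) p + s v`. Optimality of the agent at `q` and at `p'` shows that `q` earns nearly the penalized
utility of `(a, p')`, unless the direction `D_{br q} - (1 - s) D_a` has a large inner product with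
`p - p'`. In that case a projected step against this direction lowers the squared distance from `p`
to `p'` by `θ ^ 2 / 8`. That distance is at most `m H ^ 2` at the start, so a good `q` occurs within
the allotted iterations. The direction depends on outcome distributions only: neither costs nor `p'`
are needed, and the argument covers all `p'` at once.

Sampling (`samplingLoop_reaches`). An exponential potential of the deviations, summed over outcomes
and signs, is a supermartingale after normalization. It bounds the failure probability of one
estimate, and a union bound covers all estimates.

The program is verified in a quantitative Hoare logic. `Reaches` combines bounds on steps and
queries, a postcondition that always holds, and one that fails with bounded probability; these
bounds add up under composition. The resulting number of queries is of order `m ^ 5 H ^ 6 / ε ^ 12`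
times a logarithm, which is within the stated bound. -/

/-- The expectation of an extended nonnegative function. -/
def expect {α : Type*} (p : PMF α) (g : α → ℝ≥0∞) : ℝ≥0∞ := ∑' x, p x * g x

theorem expect_pure {α : Type*} (a : α) (g : α → ℝ≥0∞) : expect (PMF.pure a) g = g a := by
  classical
  rw [expect, tsum_eq_single a]
  · simp
  · intro b hb
    simp [PMF.pure_apply, hb]

theorem expect_bind {α β : Type*} (p : PMF α) (f : α → PMF β) (g : β → ℝ≥0∞) :
    expect (p.bind f) g = expect p fun a => expect (f a) g := by
  simp only [expect, PMF.bind_apply, ← ENNReal.tsum_mul_right, ← ENNReal.tsum_mul_left]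
  rw [ENNReal.tsum_comm]
  simp only [mul_assoc]

theorem expect_map {α β : Type*} (p : PMF α) (f : α → β) (g : β → ℝ≥0∞) :
    expect (p.map f) g = expect p (g ∘ f) := by
  rw [PMF.map, expect_bind]
  simp [expect_pure, Function.comp_def]

theorem expect_mono {α : Type*} (p : PMF α) {g g' : α → ℝ≥0∞}
    (h : ∀ a ∈ p.support, g a ≤ g' a) : expect p g ≤ expect p g' := by
  refine ENNReal.tsum_le_tsum fun a => ?_
  by_cases ha : p a = 0
  · simp [ha]
  · exact mul_le_mul_right (h a ((p.mem_support_iff a).2 ha)) _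

theorem expect_const {α : Type*} (p : PMF α) (b : ℝ≥0∞) : expect p (fun _ => b) = b := by
  rw [expect, ENNReal.tsum_mul_right, p.tsum_coe, one_mul]

theorem expect_const_add {α : Type*} (p : PMF α) (b : ℝ≥0∞) (g : α → ℝ≥0∞) :
    expect p (fun a => b + g a) = b + expect p g := by
  simp only [expect, mul_add]
  rw [ENNReal.tsum_add]
  congr 1
  exact expect_const p b

theorem ne_top_of_expect_ne_top {α : Type*} {p : PMF α} {g : α → ℝ≥0∞} (h : expect p g ≠ ⊤)
    {a : α} (ha : a ∈ p.support) : g a ≠ ⊤ := by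
  intro hg
  refine h (top_le_iff.1 (le_trans ?_ (ENNReal.le_tsum a)))
  rw [hg, ENNReal.mul_top ((p.mem_support_iff a).1 ha)]

theorem bind_congr_support {α β : Type*} (p : PMF α) {f g : α → PMF β}
    (h : ∀ a ∈ p.support, f a = g a) : p.bind f = p.bind g := by
  ext b
  simp only [PMF.bind_apply]
  refine tsum_congr fun a => ?_
  by_cases ha : p a = 0
  · simp [ha]
  · rw [h a ((p.mem_support_iff a).2 ha)]

/-! ## Big-step semantics -/

section Logic

variable {m : ℕ} (𝒪 : Contract m → PMF (Fin m))

/-- `κ` is the joint distribution of the final memory, the number of steps and the number of queries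
of the command `c` started in the memory `s`. -/
def Runs (c : Cmd) (s : Store) (κ : PMF (Store × ℕ × ℕ)) : Prop :=
  ∀ (k : List Cmd) (q T : ℕ), (∀ x ∈ κ.support, x.2.1 ≤ T) →
    run 𝒪 T ⟨c :: k, s, q⟩ =
      κ.bind fun x => run 𝒪 (T - x.2.1) ⟨k, x.1, q + x.2.2⟩

variable {𝒪}

theorem Runs.of_step {c c' : Cmd} {s s' : Store} {κ : PMF (Store × ℕ × ℕ)}
    (hs : ∀ k q, step 𝒪 ⟨c :: k, s, q⟩ = PMF.pure ⟨c' :: k, s', q⟩) (h : Runs 𝒪 c' s' κ) :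
    Runs 𝒪 c s (κ.map fun x => (x.1, 1 + x.2.1, x.2.2)) := by
  intro k q T hT
  have hT' : ∀ x ∈ κ.support, 1 + x.2.1 ≤ T := fun x hx =>
    hT (x.1, 1 + x.2.1, x.2.2) ((PMF.mem_support_map_iff _ _ _).2 ⟨x, hx, rfl⟩)
  obtain ⟨x₀, hx₀⟩ := κ.support_nonempty
  obtain ⟨T, rfl⟩ : ∃ T', T = T' + 1 := ⟨T - 1, by have := hT' x₀ hx₀; omega⟩
  rw [run, hs, PMF.pure_bind, h k q T fun x hx => by have := hT' x hx; omega, PMF.bind_map]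
  refine bind_congr_support _ fun x hx => ?_
  simp only [Function.comp]
  congr 1
  omega

theorem Runs.pure_step {c : Cmd} {s s' : Store}
    (hs : ∀ k q, step 𝒪 ⟨c :: k, s, q⟩ = PMF.pure ⟨k, s', q⟩) :
    Runs 𝒪 c s (PMF.pure (s', 1, 0)) := by
  intro k q T hT
  have hT' : 1 ≤ T := hT (s', 1, 0) (by simp)
  obtain ⟨T, rfl⟩ : ∃ T', T = T' + 1 := ⟨T - 1, by omega⟩
  rw [run, hs, PMF.pure_bind, PMF.pure_bind]
  simp

theorem Runs.bind {c c' : Cmd} {s : Store} {κ : PMF (Store × ℕ × ℕ)}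
    {κ' : Store → PMF (Store × ℕ × ℕ)} (h : Runs 𝒪 c s κ)
    (h' : ∀ x ∈ κ.support, Runs 𝒪 c' x.1 (κ' x.1)) (k : List Cmd) (q T : ℕ)
    (hT : ∀ x ∈ κ.support, ∀ y ∈ (κ' x.1).support, x.2.1 + y.2.1 ≤ T) :
    run 𝒪 T ⟨c :: c' :: k, s, q⟩ =
      κ.bind fun x => (κ' x.1).bind fun y =>
        run 𝒪 (T - (x.2.1 + y.2.1)) ⟨k, y.1, q + (x.2.2 + y.2.2)⟩ := by
  rw [h]
  · refine bind_congr_support _ fun x hx => ?_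
    rw [h' x hx]
    · simp only [Nat.sub_sub, add_assoc]
    · intro y hy
      have := hT x hx y hy
      omega
  · intro x hx
    obtain ⟨y, hy⟩ := (κ' x.1).support_nonempty
    have := hT x hx y hy
    omega

/-- The law of the composition of two computations, with `d` additional steps. -/
def composeLaw (d : ℕ) (κ : PMF (Store × ℕ × ℕ)) (κ' : Store → PMF (Store × ℕ × ℕ)) :
    PMF (Store × ℕ × ℕ) :=
  κ.bind fun x => (κ' x.1).map fun y => (y.1, d + (x.2.1 + y.2.1), x.2.2 + y.2.2)

theorem mem_support_composeLaw {d : ℕ} {κ : PMF (Store × ℕ × ℕ)}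
    {κ' : Store → PMF (Store × ℕ × ℕ)} {z : Store × ℕ × ℕ} :
    z ∈ (composeLaw d κ κ').support ↔ ∃ x ∈ κ.support, ∃ y ∈ (κ' x.1).support,
      (y.1, d + (x.2.1 + y.2.1), x.2.2 + y.2.2) = z := by
  simp only [composeLaw, PMF.mem_support_bind_iff, PMF.mem_support_map_iff]

theorem Runs.compose {c₀ c c' : Cmd} {s : Store} {κ : PMF (Store × ℕ × ℕ)}
    {κ' : Store → PMF (Store × ℕ × ℕ)}
    (hs : ∀ k q, step 𝒪 ⟨c₀ :: k, s, q⟩ = PMF.pure ⟨c :: c' :: k, s, q⟩)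
    (h : Runs 𝒪 c s κ) (h' : ∀ x ∈ κ.support, Runs 𝒪 c' x.1 (κ' x.1)) :
    Runs 𝒪 c₀ s (composeLaw 1 κ κ') := by
  intro k q T hT
  have hT' : ∀ x ∈ κ.support, ∀ y ∈ (κ' x.1).support, 1 + (x.2.1 + y.2.1) ≤ T := fun x hx y hy =>
    hT _ (mem_support_composeLaw.2 ⟨x, hx, y, hy, rfl⟩)
  obtain ⟨x₀, hx₀⟩ := κ.support_nonempty
  obtain ⟨y₀, hy₀⟩ := (κ' x₀.1).support_nonempty
  obtain ⟨T, rfl⟩ : ∃ T', T = T' + 1 := ⟨T - 1, by have := hT' x₀ hx₀ y₀ hy₀; omega⟩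
  rw [run, hs, PMF.pure_bind, h.bind h' k q T fun x hx y hy => by have := hT' x hx y hy; omega]
  rw [composeLaw, PMF.bind_bind]
  refine bind_congr_support _ fun x hx => ?_
  rw [PMF.bind_map]
  refine bind_congr_support _ fun y hy => ?_
  simp only [Function.comp]
  congr 1
  omega

/-! ## Weakest preconditions -/

variable (𝒪) in
/-- Started in `s`, the command `c` takes at most `t` steps and `q` queries, and the expectation of
`g` in the final memory is at most `b`. -/
def WP (c : Cmd) (s : Store) (t q : ℕ) (g : Store → ℝ≥0∞) (b : ℝ≥0∞) : Prop :=
  ∃ κ, Runs 𝒪 c s κ ∧ (∀ x ∈ κ.support, x.2.1 ≤ t ∧ x.2.2 ≤ q) ∧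
    expect κ (fun x => g x.1) ≤ b

theorem WP.mono {c : Cmd} {s : Store} {t t' q q' : ℕ} {g g' : Store → ℝ≥0∞} {b b' : ℝ≥0∞}
    (h : WP 𝒪 c s t q g b) (ht : t ≤ t') (hq : q ≤ q') (hg : ∀ s', g' s' ≤ g s')
    (hb : b ≤ b') : WP 𝒪 c s t' q' g' b' := by
  obtain ⟨κ, h1, h2, h3⟩ := h
  exact ⟨κ, h1, fun x hx => ⟨(h2 x hx).1.trans ht, (h2 x hx).2.trans hq⟩,
    (expect_mono _ fun x _ => hg x.1).trans (h3.trans hb)⟩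

theorem WP.const_add {c : Cmd} {s : Store} {t q : ℕ} {g : Store → ℝ≥0∞} {b : ℝ≥0∞}
    (h : WP 𝒪 c s t q g b) (a : ℝ≥0∞) : WP 𝒪 c s t q (fun s' => a + g s') (a + b) := by
  obtain ⟨κ, h1, h2, h3⟩ := h
  refine ⟨κ, h1, h2, ?_⟩
  rw [expect_const_add κ a fun x => g x.1]
  gcongr

/-- A finite expectation of `f` excludes memories with `f s' = ⊤` from the support. Hence the value
`⊤` encodes "never happens", and the second command needs analysis only where `f` is finite. -/
theorem WP.compose {c₀ c c' : Cmd} {s : Store} {t q t' q' : ℕ} {f g : Store → ℝ≥0∞} {b : ℝ≥0∞}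
    (hs : ∀ k q, step 𝒪 ⟨c₀ :: k, s, q⟩ = PMF.pure ⟨c :: c' :: k, s, q⟩) (hb : b ≠ ⊤)
    (h : WP 𝒪 c s t q f b) (h' : ∀ s', f s' ≠ ⊤ → WP 𝒪 c' s' t' q' g (f s')) :
    WP 𝒪 c₀ s (1 + (t + t')) (q + q') g b := by
  obtain ⟨κ, h1, h2, h3⟩ := h
  choose! κ' h1' h2' h3' using h'
  have hf : ∀ x ∈ κ.support, f x.1 ≠ ⊤ := fun x hx =>
    ne_top_of_expect_ne_top (g := fun x => f x.1) (ne_top_of_le_ne_top hb h3) hx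
  refine ⟨composeLaw 1 κ κ', h1.compose hs fun x hx => h1' _ (hf x hx), ?_, ?_⟩
  · intro z hz
    obtain ⟨x, hx, y, hy, rfl⟩ := mem_support_composeLaw.1 hz
    have := h2 x hx
    have := h2' _ (hf x hx) y hy
    dsimp only
    omega
  · rw [composeLaw, expect_bind]
    refine le_trans (expect_mono _ fun x hx => ?_) h3
    rw [expect_map]
    exact h3' _ (hf x hx)

theorem WP.seq {c c' : Cmd} {s : Store} {t q t' q' : ℕ} {f g : Store → ℝ≥0∞} {b : ℝ≥0∞}
    (hb : b ≠ ⊤) (h : WP 𝒪 c s t q f b)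
    (h' : ∀ s', f s' ≠ ⊤ → WP 𝒪 c' s' t' q' g (f s')) :
    WP 𝒪 (.seq c c') s (1 + (t + t')) (q + q') g b :=
  h.compose (fun _ _ => rfl) hb h'

theorem step_ite_true {b : BExp} {s : Store} (hb : b.eval s) (c c' : Cmd) (k : List Cmd) (q : ℕ) :
    step 𝒪 ⟨.ite b c c' :: k, s, q⟩ = PMF.pure ⟨c :: k, s, q⟩ := by
  simp [step, hb]

theorem step_ite_false {b : BExp} {s : Store} (hb : ¬ b.eval s) (c c' : Cmd) (k : List Cmd)
    (q : ℕ) : step 𝒪 ⟨.ite b c c' :: k, s, q⟩ = PMF.pure ⟨c' :: k, s, q⟩ := by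
  simp [step, hb]

theorem step_loop_true {b : BExp} {s : Store} (hb : b.eval s) (c : Cmd) (k : List Cmd) (q : ℕ) :
    step 𝒪 ⟨.loop b c :: k, s, q⟩ = PMF.pure ⟨c :: .loop b c :: k, s, q⟩ := by
  simp [step, hb]

theorem step_loop_false {b : BExp} {s : Store} (hb : ¬ b.eval s) (c : Cmd) (k : List Cmd)
    (q : ℕ) : step 𝒪 ⟨.loop b c :: k, s, q⟩ = PMF.pure ⟨k, s, q⟩ := by
  simp [step, hb]

theorem WP.of_pure_step {c : Cmd} {s s' : Store}
    (hs : ∀ k q, step 𝒪 ⟨c :: k, s, q⟩ = PMF.pure ⟨k, s', q⟩) (g : Store → ℝ≥0∞) :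
    WP 𝒪 c s 1 0 g (g s') := by
  refine ⟨_, Runs.pure_step hs, ?_, ?_⟩
  · simp
  · rw [expect_pure]

theorem WP.query (x tb : ℕ) (i : NExp) (s : Store) (g : Store → ℝ≥0∞) :
    WP 𝒪 (.query x tb i) s 1 1 g
      (∑ ω, 𝒪 (s.contract m tb (i.eval s)) ω * g (s.setN x (ω : ℕ))) := by
  refine ⟨(𝒪 (s.contract m tb (i.eval s))).map fun ω : Fin m => (s.setN x (ω : ℕ), 1, 1),
    ?_, ?_, ?_⟩
  · intro k q T hT
    obtain ⟨ω, hω⟩ := (𝒪 (s.contract m tb (i.eval s))).support_nonempty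
    have hT' : 1 ≤ T := hT _ ((PMF.mem_support_map_iff _ _ _).2 ⟨ω, hω, rfl⟩)
    obtain ⟨T, rfl⟩ : ∃ T', T = T' + 1 := ⟨T - 1, by omega⟩
    rw [run, step, PMF.bind_map, PMF.bind_map]
    change ((𝒪 _).bind fun a => PMF.pure (a : ℕ)).bind _ = _
    rw [PMF.bind_bind]
    simp only [PMF.pure_bind]
    rfl
  · intro z hz
    obtain ⟨ω, -, rfl⟩ := (PMF.mem_support_map_iff _ _ _).1 hz
    simp
  · rw [expect_map, expect, tsum_fintype]
    rfl

/-- The index of `f` is a budget of remaining iterations. By `h0`, an exhausted budget with a true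
guard has value `⊤`, so it is unreachable; this yields termination and the resource bounds along
with the expectation. -/
theorem WP.loop {bx : BExp} {c : Cmd} {t q : ℕ} {f : ℕ → Store → ℝ≥0∞} {g : Store → ℝ≥0∞}
    (hbody : ∀ j s, bx.eval s → f (j + 1) s ≠ ⊤ → WP 𝒪 c s t q (f j) (f (j + 1) s))
    (hexit : ∀ j s, ¬ bx.eval s → g s ≤ f j s) (h0 : ∀ s, bx.eval s → f 0 s = ⊤) :
    ∀ (N : ℕ) (s : Store), f N s ≠ ⊤ →
      WP 𝒪 (.loop bx c) s (N * (t + 1) + 1) (N * q) g (f N s) := by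
  intro N
  induction N with
  | zero =>
    intro s hs
    have hb : ¬ bx.eval s := fun hb => hs (h0 s hb)
    exact (WP.of_pure_step (step_loop_false hb c) g).mono (by omega) (by omega) (fun _ => le_rfl)
      (hexit 0 s hb)
  | succ N ih =>
    intro s hs
    by_cases hb : bx.eval s
    · refine ((hbody N s hb hs).compose (step_loop_true hb c) hs ih).mono ?_ ?_ (fun _ => le_rfl)
        le_rfl
      · ring_nf; omega
      · ring_nf; omega
    · exact (WP.of_pure_step (step_loop_false hb c) g).mono (by omega) (by omega)
        (fun _ => le_rfl) (hexit _ s hb)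

/-! ## Deterministic commands -/

variable (𝒪) in
/-- Started in `s`, the command `c` makes no query and ends in `s'` after at most `t` steps. -/
def Det (c : Cmd) (s : Store) (t : ℕ) (s' : Store) : Prop :=
  ∃ t' ≤ t, Runs 𝒪 c s (PMF.pure (s', t', 0))

theorem Det.wp {c : Cmd} {s s' : Store} {t : ℕ} (h : Det 𝒪 c s t s') (g : Store → ℝ≥0∞) :
    WP 𝒪 c s t 0 g (g s') := by
  obtain ⟨t', ht, h⟩ := h
  exact ⟨_, h, by simpa using ht, by rw [expect_pure]⟩

theorem Det.mono {c : Cmd} {s s' : Store} {t t' : ℕ} (h : Det 𝒪 c s t s') (ht : t ≤ t') :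
    Det 𝒪 c s t' s' := by
  obtain ⟨u, hu, h⟩ := h
  exact ⟨u, hu.trans ht, h⟩

theorem Det.compose {c₀ c c' : Cmd} {s s' s'' : Store} {t t' : ℕ}
    (hs : ∀ k q, step 𝒪 ⟨c₀ :: k, s, q⟩ = PMF.pure ⟨c :: c' :: k, s, q⟩)
    (h : Det 𝒪 c s t s') (h' : Det 𝒪 c' s' t' s'') :
    Det 𝒪 c₀ s (1 + (t + t')) s'' := by
  obtain ⟨u, hu, h⟩ := h
  obtain ⟨u', hu', h'⟩ := h'
  refine ⟨1 + (u + u'), by omega, ?_⟩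
  have := h.compose (κ' := fun _ => PMF.pure (s'', u', 0)) hs
    (fun x hx => by
      rw [PMF.support_pure, Set.mem_singleton_iff] at hx
      subst hx
      exact h')
  simpa [composeLaw, PMF.pure_bind, PMF.pure_map] using this

theorem Det.seq {c c' : Cmd} {s s' s'' : Store} {t t' : ℕ}
    (h : Det 𝒪 c s t s') (h' : Det 𝒪 c' s' t' s'') :
    Det 𝒪 (.seq c c') s (1 + (t + t')) s'' :=
  h.compose (fun _ _ => rfl) h'

theorem Det.of_step {c c' : Cmd} {s s' s'' : Store} {t : ℕ}
    (hs : ∀ k q, step 𝒪 ⟨c :: k, s, q⟩ = PMF.pure ⟨c' :: k, s', q⟩)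
    (h : Det 𝒪 c' s' t s'') : Det 𝒪 c s (1 + t) s'' := by
  obtain ⟨u, hu, h⟩ := h
  refine ⟨1 + u, by omega, ?_⟩
  simpa [PMF.pure_map] using h.of_step hs

theorem Det.setN (x : ℕ) (e : NExp) (s : Store) :
    Det 𝒪 (.setN x e) s 1 (s.setN x (e.eval s)) :=
  ⟨1, le_rfl, Runs.pure_step fun _ _ => rfl⟩

theorem Det.setR (x : ℕ) (e : RExp) (s : Store) :
    Det 𝒪 (.setR x e) s 1 (s.setR x (e.eval s)) :=
  ⟨1, le_rfl, Runs.pure_step fun _ _ => rfl⟩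

theorem Det.setRTab (tb : ℕ) (i j : NExp) (e : RExp) (s : Store) :
    Det 𝒪 (.setRTab tb i j e) s 1 (s.setRTab tb (i.eval s) (j.eval s) (e.eval s)) :=
  ⟨1, le_rfl, Runs.pure_step fun _ _ => rfl⟩

theorem Det.ite_true {bx : BExp} {c c' : Cmd} {s s' : Store} {t : ℕ} (hb : bx.eval s)
    (h : Det 𝒪 c s t s') : Det 𝒪 (.ite bx c c') s (1 + t) s' :=
  h.of_step (step_ite_true hb c c')

theorem Det.ite_false {bx : BExp} {c c' : Cmd} {s s' : Store} {t : ℕ} (hb : ¬ bx.eval s)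
    (h : Det 𝒪 c' s t s') : Det 𝒪 (.ite bx c c') s (1 + t) s' :=
  h.of_step (step_ite_false hb c c')

theorem Det.loop_exit {bx : BExp} {c : Cmd} {s : Store} (hb : ¬ bx.eval s) :
    Det 𝒪 (.loop bx c) s 1 s :=
  ⟨1, le_rfl, Runs.pure_step fun k q => step_loop_false hb c k q⟩

theorem Det.loop {bx : BExp} {c : Cmd} {t : ℕ} (S : ℕ → Store) (N : ℕ)
    (hb : ∀ j < N, bx.eval (S j)) (hN : ¬ bx.eval (S N))
    (hc : ∀ j < N, Det 𝒪 c (S j) t (S (j + 1))) :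
    Det 𝒪 (.loop bx c) (S 0) (N * (t + 1) + 1) (S N) := by
  -- The induction runs backwards, on the number of iterations that remain.
  suffices ∀ j ≤ N, Det 𝒪 (.loop bx c) (S (N - j)) (j * (t + 1) + 1) (S N) by
    simpa using this N le_rfl
  intro j
  induction j with
  | zero => intro _; simpa using Det.loop_exit hN
  | succ j ih =>
    intro hj
    have e : N - (j + 1) + 1 = N - j := by omega
    have h := hc (N - (j + 1)) (by omega)
    rw [e] at h
    refine (h.compose (step_loop_true (hb _ (by omega)) c) (ih (by omega))).mono ?_
    ring_nf; omega

/-! ### Counting loops and the filling of table rows. -/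

/-- `for x₁ = 0, …, x₀ - 1 do c`, where `xᵢ` is the `i`-th natural number register. -/
def forCmd (c : Cmd) : Cmd :=
  .seq (.setN 1 (.lit 0)) (.loop (.nle (.add (.var 1) (.lit 1)) (.var 0))
    (.seq c (.setN 1 (.add (.var 1) (.lit 1)))))

theorem Det.forCmd {c : Cmd} {t N : ℕ} {s : Store} (S : ℕ → Store) (h0 : s.setN 1 0 = S 0)
    (hm : ∀ j ≤ N, (S j).nvar 0 = N) (hj : ∀ j ≤ N, (S j).nvar 1 = j)
    (hc : ∀ j < N, ∃ s', Det 𝒪 c (S j) t s' ∧ s'.nvar 1 = j ∧ s'.setN 1 (j + 1) = S (j + 1)) :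
    Det 𝒪 (forCmd c) s (N * (t + 3) + 3) (S N) := by
  have key := Det.loop (𝒪 := 𝒪) (bx := .nle (.add (.var 1) (.lit 1)) (.var 0))
    (c := .seq c (.setN 1 (.add (.var 1) (.lit 1)))) (t := 1 + (t + 1)) S N
    (fun j hjN => by simp only [BExp.eval, NExp.eval, hm j hjN.le, hj j hjN.le]; omega)
    (by simp only [BExp.eval, NExp.eval, hm N le_rfl, hj N le_rfl]; omega)
    (fun j hjN => by
      obtain ⟨s', h1, h2, h3⟩ := hc j hjN
      refine h1.seq ?_
      have := Det.setN (𝒪 := 𝒪) 1 (.add (.var 1) (.lit 1)) s'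
      simpa only [NExp.eval, h2, h3] using this)
  have h := Det.setN (𝒪 := 𝒪) 1 (.lit 0) s
  simp only [NExp.eval, h0] at h
  refine (h.seq key).mono ?_
  ring_nf; omega

/-- The memory `s` with the first `k` entries of row `0` of the real table `tb` replaced by the
values of `E`, and `k` in the natural number register `1`. -/
def Store.fill (s : Store) (tb : ℕ) (E : ℕ → ℝ) (k : ℕ) : Store where
  nvar := Function.update s.nvar 1 k
  rvar := s.rvar
  ntab := s.ntab
  rtab t i j := if t = tb ∧ i = 0 ∧ j < k then E j else s.rtab t i j

/-- The body is run in a memory whose earlier entries are already overwritten but whose entry `j` is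
still the old one. This permits updates of a row in place. -/
theorem Det.fill {c : Cmd} {t tb : ℕ} {s : Store} (E : ℕ → ℝ)
    (hc : ∀ j < s.nvar 0, Det 𝒪 c (s.fill tb E j) t ((s.fill tb E j).setRTab tb 0 j (E j))) :
    Det 𝒪 (ContractLearning.forCmd c) s (s.nvar 0 * (t + 3) + 3)
      (s.fill tb E (s.nvar 0)) := by
  refine Det.forCmd (s.fill tb E) ?_ ?_ ?_ ?_
  · simp [Store.fill, Store.setN]
  · simp [Store.fill]
  · simp [Store.fill]
  · intro j hj
    refine ⟨_, hc j hj, by simp [Store.fill, Store.setRTab], ?_⟩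
    simp only [Store.fill, Store.setRTab, Store.setN, Store.mk.injEq, true_and,
      Function.update_idem]
    funext t' i' j'
    by_cases h : t' = tb ∧ i' = 0
    · obtain ⟨rfl, rfl⟩ := h
      rcases lt_trichotomy j' j with h | rfl | h
      · simp [h, h.ne, Nat.lt_succ_of_lt h]
      · simp
      · simp [h.ne', h.not_gt, show ¬ j' < j + 1 by omega]
    · have h1 : ∀ p : Prop, ¬ (t' = tb ∧ i' = 0 ∧ p) := fun p hp => h ⟨hp.1, hp.2.1⟩
      simp [h1]

/-! ## Reachability up to a failure probability -/

open Classical in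
/-- The function that is infinite off `S`, zero on `S ∩ G` and one on `S \ G`. -/
def level (S G : Store → Prop) (s : Store) : ℝ≥0∞ :=
  if S s then (if G s then 0 else 1) else ⊤

theorem level_le_one {S G : Store → Prop} {s : Store} (h : S s) : level S G s ≤ 1 := by
  unfold level; split_ifs <;> simp

theorem level_good {S G : Store → Prop} {s : Store} (h : S s) (h' : G s) : level S G s = 0 := by
  simp [level, h, h']

theorem level_bad {S G : Store → Prop} {s : Store} (h : S s) (h' : ¬ G s) : level S G s = 1 := by
  simp [level, h, h']

theorem level_ne_top {S G : Store → Prop} {s : Store} : level S G s ≠ ⊤ ↔ S s := by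
  unfold level; split_ifs <;> simp_all

theorem level_mono {S G S' G' : Store → Prop} {s : Store} (hS : S s → S' s)
    (hG : S s → G s → G' s) : level S' G' s ≤ level S G s := by
  unfold level; split_ifs <;> simp_all

variable (𝒪) in
/-- Started in `s`, the command `c` takes at most `t` steps and `q` queries, always ends in a memory
satisfying `S`, and in one satisfying `G` except with probability at most `b`. -/
def Reaches (c : Cmd) (s : Store) (t q : ℕ) (S G : Store → Prop) (b : ℝ≥0∞) : Prop :=
  WP 𝒪 c s t q (level S G) b

theorem Reaches.mono {c : Cmd} {s : Store} {t t' q q' : ℕ} {S S' G G' : Store → Prop} {b b' : ℝ≥0∞}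
    (h : Reaches 𝒪 c s t q S G b) (ht : t ≤ t') (hq : q ≤ q') (hS : ∀ s', S s' → S' s')
    (hG : ∀ s', S s' → G s' → G' s') (hb : b ≤ b') : Reaches 𝒪 c s t' q' S' G' b' :=
  WP.mono h ht hq (fun s' => level_mono (hS s') (hG s')) hb

theorem Det.reaches {c : Cmd} {s s' : Store} {t : ℕ} {S G : Store → Prop}
    (h : Det 𝒪 c s t s') (hS : S s') (hG : G s') : Reaches 𝒪 c s t 0 S G 0 := by
  have := h.wp (level S G)
  rwa [level_good hS hG] at this

/-- The union bound in the logic. The second command is analysed from every safe memory, since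
resource bounds and safety must survive a failure of the first; the goodness of its result may
presuppose `G s'`. -/
theorem Reaches.compose {c₀ c c' : Cmd} {s : Store} {t q t' q' : ℕ} {S G S' G' : Store → Prop}
    {b b' : ℝ≥0∞} (hs : ∀ k q, step 𝒪 ⟨c₀ :: k, s, q⟩ = PMF.pure ⟨c :: c' :: k, s, q⟩)
    (hb : b ≠ ⊤) (hb' : b' ≠ ⊤) (h : Reaches 𝒪 c s t q S G b)
    (h' : ∀ s', S s' → Reaches 𝒪 c' s' t' q' S' (fun s'' => G s' → G' s'') b') :
    Reaches 𝒪 c₀ s (1 + (t + t')) (q + q') S' G' (b + b') := by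
  rw [add_comm b b']
  -- The intermediate function is `b' + level S G`: a good memory has the allowance `b'` left, and a
  -- bad one has the additional `1` that pays for certain failure.
  refine WP.compose hs (by simp [hb, hb']) (WP.const_add h b') fun s' hs' => ?_
  have hS : S s' := (level_ne_top (G := G)).1 fun h => hs' (by simp [h])
  by_cases hG : G s'
  · rw [level_good hS hG, add_zero]
    exact Reaches.mono (h' s' hS) le_rfl le_rfl (fun _ h => h) (fun _ _ h => h hG) le_rfl
  · rw [level_bad hS hG]
    refine (WP.const_add (h' s' hS) 1).mono le_rfl le_rfl (fun s'' => ?_) (add_comm _ _).le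
    by_cases h : S' s''
    · exact (level_le_one h).trans le_self_add
    · simp [level, h]

theorem Reaches.seq {c c' : Cmd} {s : Store} {t q t' q' : ℕ} {S G S' G' : Store → Prop}
    {b b' : ℝ≥0∞} (hb : b ≠ ⊤) (hb' : b' ≠ ⊤) (h : Reaches 𝒪 c s t q S G b)
    (h' : ∀ s', S s' → Reaches 𝒪 c' s' t' q' S' (fun s'' => G s' → G' s'') b') :
    Reaches 𝒪 (.seq c c') s (1 + (t + t')) (q + q') S' G' (b + b') :=
  h.compose (fun _ _ => rfl) hb hb' h'

theorem Det.seq_reaches {c c' : Cmd} {s s' : Store} {t t' q : ℕ} {S G : Store → Prop} {b : ℝ≥0∞}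
    (hb : b ≠ ⊤) (h : Det 𝒪 c s t s') (h' : Reaches 𝒪 c' s' t' q S G b) :
    Reaches 𝒪 (.seq c c') s (1 + (t + t')) q S G b := by
  have := Reaches.seq (S := fun s'' => s'' = s') (G := fun _ => True) (by simp) hb
    (h.reaches rfl trivial) (c' := c') (t' := t') (q' := q) (S' := S) (G' := G)
    (by rintro _ rfl; simpa using h')
  simpa using this

theorem Reaches.seq_det {c c' : Cmd} {s : Store} {t t' q : ℕ} {S G S' G' : Store → Prop}
    {b : ℝ≥0∞} (hb : b ≠ ⊤) (h : Reaches 𝒪 c s t q S G b)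
    (h' : ∀ s', S s' → ∃ s'', Det 𝒪 c' s' t' s'' ∧ S' s'' ∧ (G s' → G' s'')) :
    Reaches 𝒪 (.seq c c') s (1 + (t + t')) q S' G' b := by
  have := Reaches.seq (c' := c') (t' := t') (q' := 0) (S' := S') (G' := G') (b' := 0) hb (by simp) h
    (fun s' hs' => by
      obtain ⟨s'', h1, h2, h3⟩ := h' s' hs'
      exact h1.reaches h2 h3)
  simpa using this

/-- As in `WP.loop`, the index is a budget of iterations, and `h0` says that it cannot run out
before the guard fails. The failure probabilities of the iterations add up. -/
theorem Reaches.loop {bx : BExp} {c : Cmd} {t q : ℕ} {S G : ℕ → Store → Prop}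
    {S' G' : Store → Prop} {b : ℝ≥0∞} (hb : b ≠ ⊤)
    (hbody : ∀ j s, bx.eval s → S (j + 1) s →
      Reaches 𝒪 c s t q (S j) (fun s' => G (j + 1) s → G j s') b)
    (hexit : ∀ j s, ¬ bx.eval s → S j s → S' s ∧ (G j s → G' s))
    (h0 : ∀ s, bx.eval s → ¬ S 0 s) :
    ∀ (N : ℕ) (s : Store), S N s →
      Reaches 𝒪 (.loop bx c) s (N * (t + 1) + 1) (N * q) S' (fun s' => G N s → G' s')
        (N * b) := by
  intro N
  induction N with
  | zero =>
    intro s hs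
    have hx : ¬ bx.eval s := fun hx => h0 s hx hs
    exact Reaches.mono ((Det.loop_exit hx).reaches (hexit 0 s hx hs).1 (hexit 0 s hx hs).2)
      (by omega) (by omega) (fun _ h => h) (fun _ _ h => h) (by simp)
  | succ N ih =>
    intro s hs
    by_cases hx : bx.eval s
    · refine ((hbody N s hx hs).compose (step_loop_true hx c) hb
        (ENNReal.mul_ne_top (by simp) hb) (fun s' hs' => (ih s' hs').mono le_rfl le_rfl
          (fun _ h => h) (fun s'' _ h h1 h2 => h (h1 h2)) le_rfl)).mono ?_ ?_ (fun _ h => h)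
        (fun _ _ h => h) ?_
      · ring_nf; omega
      · ring_nf; omega
      · push_cast; rw [add_mul, one_mul, add_comm]
    · exact Reaches.mono ((Det.loop_exit hx).reaches (hexit _ s hx hs).1 (hexit _ s hx hs).2)
        (by omega) (by omega) (fun _ h => h) (fun _ _ h => h) (by simp)

/-- A halted configuration no longer changes, so running for exactly the time bound `t` shows the
final memory whatever the random running time was. -/
theorem Reaches.halts {P : Cmd} {s : Store} {t q : ℕ} {S G : Store → Prop} {b : ℝ≥0∞}
    (hb : b ≠ ⊤) (h : Reaches 𝒪 P s t q S G b) :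
    (∀ c ∈ (run 𝒪 t ⟨[P], s, 0⟩).support, c.Halted ∧ S c.store ∧ c.queries ≤ q) ∧
      1 - b ≤ (run 𝒪 t ⟨[P], s, 0⟩).toOuterMeasure {c | G c.store} := by
  obtain ⟨κ, h1, h2, h3⟩ := h
  have halt : ∀ (T : ℕ) (s : Store) (q : ℕ), run 𝒪 T ⟨[], s, q⟩ = PMF.pure ⟨[], s, q⟩ := by
    intro T
    induction T with
    | zero => intro s q; rfl
    | succ T ih => intro s q; rw [run, step, PMF.pure_bind, ih]
  have hrun : run 𝒪 t ⟨[P], s, 0⟩ = κ.map fun x => ⟨[], x.1, x.2.2⟩ := by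
    rw [h1 [] 0 t fun x hx => (h2 x hx).1]
    simp only [halt, zero_add]
    rfl
  have hS : ∀ x ∈ κ.support, S x.1 := fun x hx => level_ne_top.1
    (ne_top_of_expect_ne_top (g := fun x => level S G x.1) (ne_top_of_le_ne_top hb h3) hx)
  rw [hrun]
  constructor
  · intro c hc
    obtain ⟨x, hx, rfl⟩ := (PMF.mem_support_map_iff _ _ _).1 hc
    exact ⟨rfl, hS x hx, (h2 x hx).2⟩
  · rw [PMF.toOuterMeasure_map_apply, PMF.toOuterMeasure_apply]
    rw [tsub_le_iff_right]
    calc (1 : ℝ≥0∞) = ∑' x, κ x := κ.tsum_coe.symm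
      _ ≤ ∑' x, (Set.indicator ((fun x : Store × ℕ × ℕ => (⟨[], x.1, x.2.2⟩ : Config)) ⁻¹'
            {c | G c.store}) κ x + κ x * level S G x.1) := by
          refine ENNReal.tsum_le_tsum fun x => ?_
          by_cases hx : κ x = 0
          · simp [hx]
          · by_cases hG : G x.1
            · rw [Set.indicator_of_mem (by exact hG)]
              exact le_self_add
            · rw [level_bad (hS x ((κ.mem_support_iff x).2 hx)) hG, mul_one]
              exact le_add_self
      _ ≤ _ := by
          rw [ENNReal.tsum_add]
          gcongr
          exact h3

end Logic

end

section

/-! ## Stochastic dominance -/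

/-- Summation by parts: the difference of the expectations is the sum of the increments of `r` times
the differences of the upper tails, and all these products are nonnegative. -/
theorem Dominates.sum_le {m : ℕ} [NeZero m] {f g r : Fin m → ℝ} (h : Dominates f g)
    (hs : ∑ ω, f ω = ∑ ω, g ω) (hr : Monotone r) : ∑ ω, g ω * r ω ≤ ∑ ω, f ω * r ω := by
  classical
  -- The extension by zero may have a negative increment at `j = m - 1`; that increment is harmless
  -- because it multiplies an empty tail.
  set R : ℕ → ℝ := fun j => if hj : j < m then r ⟨j, hj⟩ else 0 with hR
  have hdec : ∀ ω : Fin m, r ω = R 0 +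
      ∑ j ∈ Finset.range m, if j < (ω : ℕ) then R (j + 1) - R j else 0 := by
    intro ω
    have h1 : ∑ j ∈ Finset.range m, (if j < (ω : ℕ) then R (j + 1) - R j else 0) =
        ∑ j ∈ Finset.range (ω : ℕ), (R (j + 1) - R j) := by
      rw [← Finset.sum_filter]
      congr 1
      ext j
      simp only [Finset.mem_filter, Finset.mem_range]
      have := ω.2
      omega
    rw [h1, Finset.sum_range_sub]
    simp [hR]
  have hkey : ∀ j ∈ Finset.range m,
      0 ≤ (R (j + 1) - R j) * ∑ ω : Fin m, if j < (ω : ℕ) then f ω - g ω else 0 := by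
    intro j hj
    rw [Finset.mem_range] at hj
    by_cases hj1 : j + 1 < m
    · refine mul_nonneg ?_ ?_
      · simp only [hR, hj, hj1, dif_pos, sub_nonneg]
        exact hr (by simp)
      · rw [← Finset.sum_filter]
        have e : (Finset.univ.filter fun ω : Fin m => j < (ω : ℕ)) =
            Finset.Ici (⟨j + 1, hj1⟩ : Fin m) := by
          ext ω
          simp [Fin.le_def]
        rw [e, Finset.sum_sub_distrib, sub_nonneg]
        exact h _
    · rw [Finset.sum_eq_zero, mul_zero]
      intro ω _
      have := ω.2
      rw [if_neg (by omega)]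
  have hexp : ∑ ω, (f ω - g ω) * r ω = ∑ j ∈ Finset.range m,
      (R (j + 1) - R j) * ∑ ω : Fin m, if j < (ω : ℕ) then f ω - g ω else 0 := by
    calc ∑ ω, (f ω - g ω) * r ω
        = ∑ ω, ((f ω - g ω) * R 0 + ∑ j ∈ Finset.range m,
            (R (j + 1) - R j) * if j < (ω : ℕ) then f ω - g ω else 0) := by
          refine Finset.sum_congr rfl fun ω _ => ?_
          rw [hdec ω, mul_add, Finset.mul_sum]
          congr 1
          refine Finset.sum_congr rfl fun j _ => ?_
          split_ifs <;> ring
      _ = _ := by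
          rw [Finset.sum_add_distrib, ← Finset.sum_mul, Finset.sum_sub_distrib, hs, sub_self,
            zero_mul, zero_add, Finset.sum_comm]
          simp only [Finset.mul_sum]
  have := Finset.sum_nonneg hkey
  rw [← hexp] at this
  simp only [sub_mul, Finset.sum_sub_distrib] at this
  linarith

/-- If `f` dominates `g`, the expectations of a function of oscillation at most `B` differ by at most
`B` times the difference of the expected outcomes. -/
theorem Dominates.sum_sub_le {m : ℕ} [NeZero m] {f g q : Fin m → ℝ} {B : ℝ} (h : Dominates f g)
    (hs : ∑ ω, f ω = ∑ ω, g ω) (hB : 0 ≤ B) (hq : ∀ i j, q i - q j ≤ B) :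
    ∑ ω, g ω * q ω - ∑ ω, f ω * q ω ≤
      B * (∑ ω, f ω * (ω : ℝ) - ∑ ω, g ω * (ω : ℝ)) := by
  -- Distinct outcomes differ by at least one, so adding slope `B` compensates every decrease of
  -- `q`.
  have hmono : Monotone fun ω : Fin m => B * (ω : ℝ) + q ω := by
    refine monotone_iff_forall_lt.2 fun i j hij => ?_
    have h1 : ((i : ℕ) : ℝ) + 1 ≤ ((j : ℕ) : ℝ) := by exact_mod_cast hij
    have h2 := hq i j
    have h3 := mul_le_mul_of_nonneg_left h1 hB
    nlinarith
  have key := h.sum_le hs hmono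
  have e : ∀ k : Fin m → ℝ, ∑ ω, k ω * (B * (ω : ℝ) + q ω) =
      B * ∑ ω, k ω * (ω : ℝ) + ∑ ω, k ω * q ω := by
    intro k
    rw [Finset.mul_sum, ← Finset.sum_add_distrib]
    exact Finset.sum_congr rfl fun ω _ => by ring
  rw [e, e] at key
  linarith

/-- Two optimality conditions for linear contracts bound the concavity gap of the expected outcome
as a function of the cost. -/
theorem mixture_mean_le {α₀ x τ G G₀ G₁ c c₀ c₁ t : ℝ} (hα₀ : 0 < α₀)
    (hτ : 0 ≤ τ) (hx : α₀ ≤ x) (ht0 : 0 ≤ t) (ht1 : t ≤ 1) (hc0 : c₀ ≤ c)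
    (hct : c = t * c₀ + (1 - t) * c₁) (hc : c - c₀ ≤ 1)
    (h1 : x * G - c ≤ x * G₀ - c₀) (h2 : (x + τ) * G - c ≤ (x + τ) * G₁ - c₁) :
    G - (t * G₀ + (1 - t) * G₁) ≤ τ / α₀ ^ 2 := by
  have ha : 0 < x := hα₀.trans_le hx
  have ha' : 0 < x + τ := by linarith
  have h1' : G ≤ G₀ + (c - c₀) / x := by
    rw [← sub_le_iff_le_add', le_div_iff₀ ha]
    linarith
  have h2' : G ≤ G₁ - (c₁ - c) / (x + τ) := by
    rw [le_sub_iff_add_le, ← le_sub_iff_add_le', div_le_iff₀ ha']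
    linarith
  -- Both sides are the same weight, so the gap is at most this weight times the difference of the
  -- reciprocal slopes `1 / x` and `1 / (x + τ)`.
  have hw : t * (c - c₀) = (1 - t) * (c₁ - c) := by rw [hct]; ring
  have hw1 : t * (c - c₀) ≤ 1 := mul_le_one₀ ht1 (by linarith) hc
  have h3 := mul_le_mul_of_nonneg_left h1' ht0
  have h4 := mul_le_mul_of_nonneg_left h2' (sub_nonneg.2 ht1)
  have e1 : t * (c - c₀) * (1 / x - 1 / (x + τ)) =
      t * ((c - c₀) / x) - (1 - t) * ((c₁ - c) / (x + τ)) := by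
    have : t * (c - c₀) * (1 / (x + τ)) = (1 - t) * ((c₁ - c) / (x + τ)) := by
      rw [hw]; ring
    rw [mul_sub, this]; ring
  have h6 : 1 / x - 1 / (x + τ) ≤ τ / α₀ ^ 2 := by
    have : 1 / x - 1 / (x + τ) = τ / (x * (x + τ)) := by field_simp; ring
    rw [this, sq]
    gcongr
    linarith
  have h7 : 0 ≤ 1 / x - 1 / (x + τ) := by
    rw [sub_nonneg]
    gcongr
    linarith
  have h8 := mul_le_mul_of_nonneg_right hw1 h7
  linarith

/-! ## Linear contracts and the penalized utility -/

/-- The linear contract paying `α` per outcome index. -/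
def linearContract (m : ℕ) (α : ℝ) : Contract m := fun ω => (α * (ω : ℝ)).toNNReal

namespace Problem

variable {m : ℕ} [NeZero m] (I : Problem.{u} m)

theorem prob_nonneg (a : I.Action) (ω : Fin m) : 0 ≤ I.prob a ω := ENNReal.toReal_nonneg

theorem sum_prob (a : I.Action) : ∑ ω, I.prob a ω = 1 := by
  unfold prob
  rw [← ENNReal.toReal_sum fun ω _ => (I.dist a).apply_ne_top ω, ← tsum_fintype (L := .unconditional _), (I.dist a).tsum_coe]
  rfl

/-- The expected outcome index of an action. -/
def meanOutcome (a : I.Action) : ℝ := ∑ ω, I.prob a ω * (ω : ℝ)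

theorem agentUtility_linearContract {α : ℝ} (hα : 0 ≤ α) (a : I.Action) :
    I.agentUtility (linearContract m α) a = α * I.meanOutcome a - I.cost a := by
  unfold agentUtility meanOutcome linearContract
  rw [Finset.mul_sum]
  congr 1
  refine Finset.sum_congr rfl fun ω _ => ?_
  rw [Real.coe_toNNReal _ (by positivity)]
  ring

/-- The principal's utility if the agent takes action `a` under `p`, penalized by `1 / s` times the
amount by which the agent would gain from a best response. -/
def penalizedUtility (br : Contract m → I.Action) (s : ℝ) (a : I.Action) (p : Contract m) : ℝ :=
  I.principalUtilityOf p a - (I.agentUtility p (br p) - I.agentUtility p a) / s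

theorem principalUtilityOf_eq (p : Contract m) (a : I.Action) :
    I.principalUtilityOf p a = ∑ ω, I.prob a ω * I.value ω - ∑ ω, I.prob a ω * (p ω : ℝ) := by
  simp only [principalUtilityOf, mul_sub, Finset.sum_sub_distrib]

/-- Some linear contract of the grid `α₀, α₀ + τ, …, α₀ + N τ` induces an action with nearly optimal
penalized utility. -/
theorem exists_penalizedUtility_ge {br : Contract m → I.Action} (hF : I.FOSD) (hC : I.CDFP)
    (hbr : ∀ p, I.IsBestResponse p (br p)) {H s α₀ τ e : ℝ} (hH : 0 ≤ H) (hs : 0 < s)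
    (hα₀ : 0 < α₀) (hτ : 0 < τ) (N : ℕ) (hN : H < α₀ + N * τ) (hα₀H : α₀ * m ≤ H)
    (he : α₀ * m ≤ e) (he' : (1 + H + H / s) * (τ / α₀ ^ 2) ≤ e) {p : Contract m}
    (hp : p.IsBounded H) :
    ∃ i ≤ N, ∃ p' : Contract m, p'.IsBounded H ∧
      I.principalUtility br p - e ≤
        I.penalizedUtility br s (br (linearContract m (α₀ + i * τ))) p' := by
  set act : ℕ → I.Action := fun i => br (linearContract m (α₀ + i * τ)) with hact
  have hαpos : ∀ i : ℕ, 0 < α₀ + i * τ := fun i => by positivity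
  have hopt : ∀ (i : ℕ) (a : I.Action), (α₀ + i * τ) * I.meanOutcome a - I.cost a ≤
      (α₀ + i * τ) * I.meanOutcome (act i) - I.cost (act i) := by
    intro i a
    rw [← I.agentUtility_linearContract (hαpos i).le, ← I.agentUtility_linearContract (hαpos i).le]
    exact (hbr _).1 a
  set b := br p with hb
  have hpopt : ∀ a, ∑ ω, I.prob a ω * (p ω : ℝ) - I.cost a ≤
      ∑ ω, I.prob b ω * (p ω : ℝ) - I.cost b := (hbr p).1
  have hosc : ∀ i j, (p i : ℝ) - (p j : ℝ) ≤ H := fun i j => by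
    have := hp i
    have := (p j).coe_nonneg
    linarith
  have hosc' : ∀ i j, -(p i : ℝ) - -(p j : ℝ) ≤ H := fun i j => by
    have := hp j
    have := (p i).coe_nonneg
    linarith
  have hoscv : ∀ i j, I.value i - I.value j ≤ 1 := fun i j => by
    have := I.value_le_one i
    have := I.value_nonneg j
    linarith
  -- At a slope above `H`, a unit of expected outcome is worth more to the agent than any
  -- `H`-bounded contract can make it. If `b` were costlier, FOSD and optimality at that slope would
  -- leave no gain in expected outcome, and `p` could not repay the extra cost.
  have htop : I.cost b ≤ I.cost (act N) := by
    by_contra! hlt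
    have hd := hF b (act N) hlt.le
    have h1 := hd.sum_sub_le (by rw [I.sum_prob, I.sum_prob]) hH hosc'
    simp only [mul_neg, Finset.sum_neg_distrib] at h1
    have h2 := hpopt (act N)
    have h3 := hopt N b
    change _ ≤ H * (I.meanOutcome b - I.meanOutcome (act N)) at h1
    have h4 : (α₀ + N * τ - H) * (I.meanOutcome b - I.meanOutcome (act N)) ≤ 0 := by nlinarith
    have h5 : I.meanOutcome b - I.meanOutcome (act N) ≤ 0 := by
      by_contra! h
      nlinarith [mul_pos (sub_pos.2 hN) h]
    nlinarith
  classical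
  -- The first such grid point and its predecessor enclose the cost of `b`.
  have hex : ∃ i, I.cost b ≤ I.cost (act i) := ⟨N, htop⟩
  have hjN : Nat.find hex ≤ N := Nat.find_min' hex htop
  have hjspec := Nat.find_spec hex
  have hjmin := fun i (hi : i < Nat.find hex) => Nat.find_min hex hi
  generalize Nat.find hex = j at hjN hjspec hjmin
  rcases j with _ | i
  -- The lowest slope already induces an action at least as costly as `b`. By FOSD its expected
  -- value is no smaller, its regret under its own contract is zero, and it is paid at most `α₀ *
  -- m`.
  · refine ⟨0, Nat.zero_le _, linearContract m α₀, ?_, ?_⟩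
    · intro ω
      rw [linearContract, Real.coe_toNNReal _ (by positivity)]
      have : ((ω : ℕ) : ℝ) ≤ m := by exact_mod_cast ω.2.le
      nlinarith
    · have e1 : linearContract m (α₀ + (0 : ℕ) * τ) = linearContract m α₀ := by simp
      have e2 : act 0 = br (linearContract m α₀) := by simp [hact]
      rw [e1, penalizedUtility, sub_self, zero_div, sub_zero, ← e2, principalUtility,
        ← hb, principalUtilityOf_eq, principalUtilityOf_eq]
      have h1 := (hF _ _ hjspec).sum_le (by rw [I.sum_prob, I.sum_prob]) I.value_mono
      have h2 : 0 ≤ ∑ ω, I.prob b ω * (p ω : ℝ) :=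
        Finset.sum_nonneg fun ω _ => mul_nonneg (I.prob_nonneg _ _) (p ω).coe_nonneg
      have h3 : ∑ ω, I.prob (act 0) ω * (linearContract m α₀ ω : ℝ) ≤ α₀ * m := by
        calc ∑ ω, I.prob (act 0) ω * (linearContract m α₀ ω : ℝ)
            ≤ ∑ ω, I.prob (act 0) ω * (α₀ * m) := by
              refine Finset.sum_le_sum fun ω _ =>
                mul_le_mul_of_nonneg_left ?_ (I.prob_nonneg _ _)
              rw [linearContract, Real.coe_toNNReal _ (by positivity)]
              have : ((ω : ℕ) : ℝ) ≤ m := by exact_mod_cast ω.2.le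
              nlinarith
          _ = α₀ * m := by rw [← Finset.sum_mul, I.sum_prob, one_mul]
      linarith
  · have hlt : I.cost (act i) < I.cost b := not_le.1 (hjmin i (by omega))
    set c₀ := I.cost (act i)
    set c₁ := I.cost (act (i + 1))
    set c := I.cost b
    have hc01 : 0 < c₁ - c₀ := by linarith
    set t := (c₁ - c) / (c₁ - c₀) with ht
    have ht0 : 0 ≤ t := div_nonneg (by linarith) hc01.le
    have ht1 : t ≤ 1 := (div_le_one hc01).2 (by linarith)
    have hct : c = t * c₀ + (1 - t) * c₁ := by
      rw [ht]; field_simp; ring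
    have hdom := hC (act i) (act (i + 1)) b t ht0 ht1 hct
    set mix : Fin m → ℝ := fun ω => t * I.prob (act i) ω + (1 - t) * I.prob (act (i + 1)) ω
    have hmix : ∀ r : Fin m → ℝ, ∑ ω, mix ω * r ω =
        t * ∑ ω, I.prob (act i) ω * r ω + (1 - t) * ∑ ω, I.prob (act (i + 1)) ω * r ω := by
      intro r
      rw [Finset.mul_sum, Finset.mul_sum, ← Finset.sum_add_distrib]
      exact Finset.sum_congr rfl fun ω _ => by ring
    have hmix1 : ∑ ω, I.prob b ω = ∑ ω, mix ω := by
      have := hmix fun _ => 1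
      simp only [mul_one, I.sum_prob] at this
      rw [this, I.sum_prob]; ring
    have hv := hdom.sum_sub_le (q := fun ω => -I.value ω) hmix1 zero_le_one
      (fun i j => by have := hoscv j i; linarith)
    have hv' := hdom.sum_sub_le hmix1 zero_le_one hoscv
    have hp1 := hdom.sum_sub_le hmix1 hH hosc
    have hp2 := hdom.sum_sub_le hmix1 hH hosc'
    have hv0 := hdom.sum_le hmix1 I.value_mono
    simp only [mul_neg, Finset.sum_neg_distrib] at hp2 hv
    -- the expected outcomes of `b` and of the mixture are close
    have hρ : ∑ ω, I.prob b ω * (ω : ℝ) - ∑ ω, mix ω * (ω : ℝ) ≤ τ / α₀ ^ 2 := by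
      rw [hmix fun ω => (ω : ℝ)]
      change I.meanOutcome b - (t * I.meanOutcome (act i) + (1 - t) * I.meanOutcome (act (i + 1))) ≤ _
      have h1 := hopt i b
      have h2 := hopt (i + 1) b
      rw [show α₀ + ((i + 1 : ℕ) : ℝ) * τ = α₀ + i * τ + τ by push_cast; ring] at h2
      refine mixture_mean_le hα₀ hτ.le (le_add_of_nonneg_right (by positivity)) ht0 ht1 hlt.le
        hct ?_ h1 h2
      have := I.cost_le_one b
      have := I.cost_nonneg (act i)
      linarith
    set ρ := ∑ ω, I.prob b ω * (ω : ℝ) - ∑ ω, mix ω * (ω : ℝ)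
    -- Averaging: if both neighbours fell short at `p`, so would their combination with weights `t`
    -- and `1 - t`. There the costs cancel, leaving only expectations under `mix`.
    by_contra! hcon
    have k0 := hcon i (by omega) p hp
    have k1 := hcon (i + 1) hjN p hp
    change I.penalizedUtility br s (act i) p < _ at k0
    change I.penalizedUtility br s (act (i + 1)) p < _ at k1
    have hcomb : t * I.penalizedUtility br s (act i) p +
        (1 - t) * I.penalizedUtility br s (act (i + 1)) p < I.principalUtility br p - e := by
      rcases ht0.eq_or_lt with h | h
      · rw [← h]; linarith
      · have := mul_lt_mul_of_pos_left k0 h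
        have := mul_le_mul_of_nonneg_left k1.le (sub_nonneg.2 ht1)
        linarith
    have hval : t * I.penalizedUtility br s (act i) p +
        (1 - t) * I.penalizedUtility br s (act (i + 1)) p =
        (∑ ω, mix ω * I.value ω - ∑ ω, mix ω * (p ω : ℝ)) -
          (∑ ω, I.prob b ω * (p ω : ℝ) - ∑ ω, mix ω * (p ω : ℝ)) / s := by
      rw [hmix, hmix, penalizedUtility, penalizedUtility, principalUtilityOf_eq,
        principalUtilityOf_eq, ← hb]
      simp only [agentUtility]
      change t * (_ - (_ - c - (_ - c₀)) / s) + (1 - t) * (_ - (_ - c - (_ - c₁)) / s) = _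
      field_simp
      rw [hct]
      ring
    rw [hval, principalUtility, ← hb, principalUtilityOf_eq] at hcomb
    have hdiv : (∑ ω, I.prob b ω * (p ω : ℝ) - ∑ ω, mix ω * (p ω : ℝ)) / s ≤ H / s * ρ := by
      rw [div_mul_eq_mul_div]
      exact div_le_div_of_nonneg_right (by linarith) hs.le
    have hfin : (1 + H + H / s) * ρ ≤ e :=
      (mul_le_mul_of_nonneg_left hρ (by positivity)).trans he'
    nlinarith

/-- If the direction `D_{br q} - (1 - s) D_a` at `p` is almost orthogonal to `p - p'`, then the mixture
`q = (1 - s) p + s v` is as good as the penalized utility of `p'`. -/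
theorem principalUtility_mix_ge {br : Contract m → I.Action}
    (hbr : ∀ p, I.IsBestResponse p (br p)) {s θ : ℝ} (hs : 0 < s)
    {p : Fin m → ℝ} {p' q : Contract m} (hp : ∀ ω, 0 ≤ p ω)
    (hq : ∀ ω, (q ω : ℝ) = (1 - s) * p ω + s * I.value ω) (a : I.Action)
    (h : ∑ ω, (I.prob (br q) ω - (1 - s) * I.prob a ω) * (p ω - p' ω) ≤ θ) :
    I.penalizedUtility br s a p' - θ / s - s ≤ I.principalUtility br q := by
  have h1 := (hbr q).1 a
  have h2 := (hbr p').1 (br q)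
  simp only [principalUtility, penalizedUtility, principalUtilityOf_eq, agentUtility, hq] at *
  have hv1 : ∑ ω, I.prob (br q) ω * I.value ω ≤ 1 := by
    rw [← I.sum_prob (br q)]
    exact Finset.sum_le_sum fun ω _ => by
      have := I.value_le_one ω
      have := I.prob_nonneg (br q) ω
      nlinarith
  have e1 : ∀ a, ∑ ω, I.prob a ω * ((1 - s) * p ω + s * I.value ω) =
      (1 - s) * ∑ ω, I.prob a ω * p ω + s * ∑ ω, I.prob a ω * I.value ω := by
    intro a
    rw [Finset.mul_sum, Finset.mul_sum, ← Finset.sum_add_distrib]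
    exact Finset.sum_congr rfl fun ω _ => by ring
  have e2 : ∑ ω, (I.prob (br q) ω - (1 - s) * I.prob a ω) * (p ω - p' ω) =
      (∑ ω, I.prob (br q) ω * p ω - ∑ ω, I.prob (br q) ω * (p' ω : ℝ)) -
      (1 - s) * (∑ ω, I.prob a ω * p ω - ∑ ω, I.prob a ω * (p' ω : ℝ)) := by
    rw [← Finset.sum_sub_distrib, ← Finset.sum_sub_distrib, Finset.mul_sum,
      ← Finset.sum_sub_distrib]
    exact Finset.sum_congr rfl fun ω _ => by ring
  rw [e1, e1] at h1
  rw [e1]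
  rw [e2] at h
  set A := ∑ ω, I.prob (br q) ω * I.value ω
  set B := ∑ ω, I.prob (br q) ω * p ω
  set C := ∑ ω, I.prob (br q) ω * (p' ω : ℝ)
  set A' := ∑ ω, I.prob a ω * I.value ω
  set B' := ∑ ω, I.prob a ω * p ω
  set C' := ∑ ω, I.prob a ω * (p' ω : ℝ)
  set U := ∑ ω, I.prob (br p') ω * (p' ω : ℝ) - I.cost (br p')
  -- Multiplied by `s`, this is a linear combination of optimality at `q` against `a`, optimality at
  -- `p'` against `br q`, and the hypothesis on the direction; the cost of `br q` cancels.
  have key : A' - C' - (U - (C' - I.cost a)) / s - θ / s ≤ A - B := by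
    rw [sub_sub, ← add_div, sub_le_comm, le_div_iff₀ hs]
    nlinarith
  -- The principal keeps the fraction `1 - s` of `A - B`, and `A - B ≤ 1`, so the mixing costs at
  -- most `s`.
  have hpB : A - ((1 - s) * B + s * A) = (1 - s) * (A - B) := by ring
  rw [hpB]
  have hB : 0 ≤ B := Finset.sum_nonneg fun ω _ => mul_nonneg (I.prob_nonneg _ _) (hp ω)
  nlinarith

end Problem

/-! ### Projected gradient descent with estimated directions. -/

/-- The projection of `x` to the interval `[0, H]`. -/
def clip (H x : ℝ) : ℝ := if x ≤ 0 then 0 else if H ≤ x then H else x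

theorem clip_nonneg {H : ℝ} (hH : 0 ≤ H) (x : ℝ) : 0 ≤ clip H x := by
  unfold clip; split_ifs <;> linarith

theorem clip_le {H : ℝ} (hH : 0 ≤ H) (x : ℝ) : clip H x ≤ H := by
  unfold clip; split_ifs <;> linarith

theorem sq_clip_sub_le {H y : ℝ} (hy : 0 ≤ y) (hyH : y ≤ H) (x : ℝ) :
    (clip H x - y) ^ 2 ≤ (x - y) ^ 2 := by
  unfold clip
  split_ifs with h1 h2
  · nlinarith
  · nlinarith
  · exact le_rfl

/-- One step of projected gradient descent. -/
theorem sum_sq_clip_sub_le {ι : Type*} (t : Finset ι) {H η : ℝ} (p y g : ι → ℝ)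
    (hy : ∀ i, 0 ≤ y i ∧ y i ≤ H) :
    ∑ i ∈ t, (clip H (p i - η * g i) - y i) ^ 2 ≤
      ∑ i ∈ t, (p i - y i) ^ 2 - 2 * η * ∑ i ∈ t, g i * (p i - y i) + η ^ 2 * ∑ i ∈ t, g i ^ 2 := by
  rw [Finset.mul_sum, Finset.mul_sum, ← Finset.sum_sub_distrib, ← Finset.sum_add_distrib]
  refine Finset.sum_le_sum fun i _ => ?_
  refine (sq_clip_sub_le (hy i).1 (hy i).2 _).trans (le_of_eq ?_)
  ring

theorem sum_mul_sub_le {ι : Type*} [Fintype ι] {f g r : ι → ℝ} {κ B : ℝ} (hκ : 0 ≤ κ)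
    (hfg : ∀ i, |f i - g i| ≤ κ) (hr : ∀ i, |r i| ≤ B) :
    |∑ i, f i * r i - ∑ i, g i * r i| ≤ Fintype.card ι * (κ * B) := by
  rw [← Finset.sum_sub_distrib]
  calc |∑ i, (f i * r i - g i * r i)| ≤ ∑ i, |f i * r i - g i * r i| :=
        Finset.abs_sum_le_sum_abs _ _
    _ ≤ ∑ _i : ι, κ * B := by
        refine Finset.sum_le_sum fun i _ => ?_
        rw [← sub_mul, abs_mul]
        exact mul_le_mul (hfg i) (hr i) (abs_nonneg _) hκ
    _ = _ := by simp

/-- Entries of a probability vector lie in `[0, 1]`, so squares are bounded by the entries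
themselves. Thus the squared length of the descent direction is bounded independently of the number
of outcomes. -/
theorem sum_sq_sub_mul_le {ι : Type*} [Fintype ι] {f g : ι → ℝ} {s : ℝ} (hs : 0 ≤ s) (hs1 : s ≤ 1)
    (hf : ∀ i, 0 ≤ f i) (hf1 : ∑ i, f i = 1) (hg : ∀ i, 0 ≤ g i) (hg1 : ∑ i, g i = 1) :
    ∑ i, (f i - (1 - s) * g i) ^ 2 ≤ 2 := by
  have le1 : ∀ {f : ι → ℝ}, (∀ i, 0 ≤ f i) → ∑ i, f i = 1 → ∀ i, f i ≤ 1 := by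
    intro f hf hf1 i
    rw [← hf1]
    exact Finset.single_le_sum (fun j _ => hf j) (Finset.mem_univ i)
  calc ∑ i, (f i - (1 - s) * g i) ^ 2 ≤ ∑ i, (f i + g i) := by
        refine Finset.sum_le_sum fun i _ => ?_
        have h1 := le1 hf hf1 i
        have h2 := le1 hg hg1 i
        have h3 := hf i
        have h4 := hg i
        have h5 : 0 ≤ (1 - s) * g i := mul_nonneg (by linarith) h4
        have h6 : (1 - s) * g i ≤ g i := by nlinarith
        nlinarith [mul_nonneg h3 h5]
    _ = 2 := by rw [Finset.sum_add_distrib, hf1, hg1]; norm_num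

/-- The dichotomy that drives the inner loop: a small inner product with the true direction makes
`q` good, and a large one stays large for the estimated direction, so that the step approaches `p'`.
-/
theorem Problem.descent_step {m : ℕ} [NeZero m] (I : Problem.{u} m) {br : Contract m → I.Action}
    (hbr : ∀ p, I.IsBestResponse p (br p)) {H s θ κ : ℝ} (hs : 0 < s) (hs1 : s ≤ 1)
    (hθ : 0 < θ) (hκ : 0 ≤ κ) (hκθ : 4 * (m * (κ * H)) ≤ θ)
    {p f g : Fin m → ℝ} {p' q : Contract m} (hp : ∀ ω, 0 ≤ p ω ∧ p ω ≤ H) (hp' : p'.IsBounded H)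
    (hq : ∀ ω, (q ω : ℝ) = (1 - s) * p ω + s * I.value ω) (a : I.Action)
    (hf : ∀ ω, 0 ≤ f ω) (hf1 : ∑ ω, f ω = 1) (hg : ∀ ω, 0 ≤ g ω) (hg1 : ∑ ω, g ω = 1)
    (hfa : ∀ ω, |f ω - I.prob (br q) ω| ≤ κ) (hga : ∀ ω, |g ω - I.prob a ω| ≤ κ) :
    I.penalizedUtility br s a p' - θ / s - s ≤ I.principalUtility br q ∨
      ∑ ω, (clip H (p ω - θ / 4 * (f ω - (1 - s) * g ω)) - p' ω) ^ 2 ≤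
        ∑ ω, (p ω - p' ω) ^ 2 - θ ^ 2 / 8 := by
  by_cases h : ∑ ω, (I.prob (br q) ω - (1 - s) * I.prob a ω) * (p ω - p' ω) ≤ θ
  · exact Or.inl (I.principalUtility_mix_ge hbr hs (fun ω => (hp ω).1) hq a h)
  right
  push Not at h
  have hr : ∀ ω, |p ω - p' ω| ≤ H := fun ω => by
    rw [abs_le]
    have := hp ω
    have := hp' ω
    have := (p' ω).coe_nonneg
    constructor <;> linarith
  have h1 := abs_le.1 (sum_mul_sub_le hκ hfa hr)
  have h2 := abs_le.1 (sum_mul_sub_le hκ hga hr)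
  have h3 := sum_sq_clip_sub_le Finset.univ (H := H) (η := θ / 4) p (fun ω => (p' ω : ℝ))
    (fun ω => f ω - (1 - s) * g ω) (fun ω => ⟨(p' ω).coe_nonneg, hp' ω⟩)
  have h4 := sum_sq_sub_mul_le hs.le hs1 hf hf1 hg hg1
  have e : ∀ f g : Fin m → ℝ, ∑ ω, (f ω - (1 - s) * g ω) * (p ω - p' ω) =
      ∑ ω, f ω * (p ω - p' ω) - (1 - s) * ∑ ω, g ω * (p ω - p' ω) := by
    intro f g
    rw [Finset.mul_sum, ← Finset.sum_sub_distrib]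
    exact Finset.sum_congr rfl fun ω _ => by ring
  rw [e] at h h3
  rw [Fintype.card_fin] at h1 h2
  set A := ∑ ω, f ω * (p ω - p' ω)
  set B := ∑ ω, g ω * (p ω - p' ω)
  set A' := ∑ ω, I.prob (br q) ω * (p ω - p' ω)
  set B' := ∑ ω, I.prob a ω * (p ω - p' ω)
  set κ' := (m : ℝ) * (κ * H)
  have hs2 : 0 ≤ 1 - s := by linarith
  have h5 : (1 - s) * B ≤ (1 - s) * B' + κ' := by
    have h6 : 0 ≤ κ' := by linarith [h1.1, h1.2]
    nlinarith
  -- Each of the two estimates costs at most `θ / 4`. With step size `θ / 4`, the distance then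
  -- changes by at most `-θ ^ 2 / 4 + θ ^ 2 / 8`.
  have h6 : θ / 2 ≤ A - (1 - s) * B := by linarith
  nlinarith [mul_le_mul_of_nonneg_left h6 hθ.le, mul_le_mul_of_nonneg_left h4 (sq_nonneg (θ / 4))]

end

section

/-! ## Estimating an outcome distribution -/

theorem exp_le_one_add_add_sq {x : ℝ} (hx : |x| ≤ 1) : Real.exp x ≤ 1 + x + x ^ 2 := by
  have := (abs_le.1 (Real.abs_exp_sub_one_sub_id_le hx)).2
  linarith

/-- The exponential moment of a centered indicator. -/
theorem sum_mul_exp_indicator_le {ι : Type*} [Fintype ι] [DecidableEq ι] {f : ι → ℝ}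
    (hf : ∀ i, 0 ≤ f i) (hf1 : ∑ i, f i = 1) {l : ℝ} (hl : |l| ≤ 1) (i : ι) :
    ∑ j, f j * Real.exp (l * ((if i = j then 1 else 0) - f i)) ≤ Real.exp (l ^ 2) := by
  have hfi : f i ≤ 1 := by
    rw [← hf1]
    exact Finset.single_le_sum (fun j _ => hf j) (Finset.mem_univ i)
  have habs : ∀ j, |(if i = j then (1 : ℝ) else 0) - f i| ≤ 1 := by
    intro j
    have := hf i
    rw [abs_le]
    split_ifs <;> constructor <;> linarith
  calc ∑ j, f j * Real.exp (l * ((if i = j then 1 else 0) - f i))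
      ≤ ∑ j, f j * (1 + l * ((if i = j then 1 else 0) - f i) + l ^ 2) := by
        refine Finset.sum_le_sum fun j _ => mul_le_mul_of_nonneg_left ?_ (hf j)
        refine (exp_le_one_add_add_sq ?_).trans ?_
        · rw [abs_mul]
          exact mul_le_one₀ hl (abs_nonneg _) (habs j)
        · rw [mul_pow]
          have h1 : ((if i = j then (1 : ℝ) else 0) - f i) ^ 2 ≤ 1 := by
            rw [sq_le_one_iff_abs_le_one]; exact habs j
          have := mul_le_mul_of_nonneg_left h1 (sq_nonneg l)
          linarith
    _ = ∑ j, (f j * (1 - l * f i + l ^ 2) + if i = j then f j * l else 0) := by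
        refine Finset.sum_congr rfl fun j _ => ?_
        split_ifs <;> ring
    _ = 1 + l ^ 2 := by
        rw [Finset.sum_add_distrib, ← Finset.sum_mul, hf1, Finset.sum_ite_eq]
        simp
        ring
    _ ≤ Real.exp (l ^ 2) := by rw [add_comm]; exact Real.add_one_le_exp _

/-- The exponential potential of the deviations of the counts `cnt` after `k` samples. -/
def deviationPotential {m : ℕ} (f : Fin m → ℝ) (l k : ℝ) (cnt : ℕ → ℝ) : ℝ :=
  ∑ ω : Fin m, (Real.exp (l * (cnt ω - k * f ω)) + Real.exp (-l * (cnt ω - k * f ω)))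

/-- One more sample multiplies the exponential moment of each count, for either sign, by at most
`exp (l ^ 2)`, hence also their sum. This is the supermartingale property behind the tail bound. -/
theorem sum_mul_deviationPotential_le {m : ℕ} {f : Fin m → ℝ} (hf : ∀ i, 0 ≤ f i)
    (hf1 : ∑ i, f i = 1) {l : ℝ} (hl : |l| ≤ 1) (k : ℝ) (cnt : ℕ → ℝ) :
    ∑ ω : Fin m, f ω * deviationPotential f l (k + 1)
        (fun i => if i = (ω : ℕ) then cnt i + 1 else cnt i) ≤
      Real.exp (l ^ 2) * deviationPotential f l k cnt := by
  have hterm : ∀ l' : ℝ, |l'| ≤ 1 → ∀ i : Fin m, ∑ ω : Fin m, f ω * Real.exp (l' *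
      ((if (i : ℕ) = (ω : ℕ) then cnt i + 1 else cnt i) - (k + 1) * f i)) ≤
        Real.exp (l' ^ 2) * Real.exp (l' * (cnt i - k * f i)) := by
    intro l' hl' i
    calc _ = (∑ ω : Fin m, f ω * Real.exp (l' * ((if i = ω then 1 else 0) - f i))) *
          Real.exp (l' * (cnt i - k * f i)) := by
          rw [Finset.sum_mul]
          refine Finset.sum_congr rfl fun ω _ => ?_
          rw [mul_assoc, ← Real.exp_add]
          congr 2
          simp only [Fin.ext_iff]
          split_ifs <;> ring
      _ ≤ _ := mul_le_mul_of_nonneg_right (sum_mul_exp_indicator_le hf hf1 hl' i)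
          (Real.exp_pos _).le
  unfold deviationPotential
  simp only [Finset.mul_sum]
  rw [Finset.sum_comm]
  refine Finset.sum_le_sum fun i _ => ?_
  simp only [mul_add, Finset.sum_add_distrib]
  have h1 := hterm l hl i
  have h2 := hterm (-l) (by rwa [abs_neg]) i
  rw [neg_sq] at h2
  exact add_le_add h1 h2

theorem exp_le_deviationPotential {m : ℕ} {f : Fin m → ℝ} {l k κ : ℝ} {cnt : ℕ → ℝ} (hl : 0 ≤ l)
    {ω : Fin m} (h : κ < |cnt ω - k * f ω|) :
    Real.exp (l * κ) ≤ deviationPotential f l k cnt := by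
  have h1 : Real.exp (l * κ) ≤ Real.exp (l * (cnt ω - k * f ω)) +
      Real.exp (-l * (cnt ω - k * f ω)) := by
    rcases lt_abs.1 h with h | h
    · refine le_add_of_le_of_nonneg (Real.exp_le_exp.2 ?_) (Real.exp_pos _).le
      nlinarith
    · refine le_add_of_nonneg_of_le (Real.exp_pos _).le (Real.exp_le_exp.2 ?_)
      nlinarith
  refine h1.trans (Finset.single_le_sum (f := fun ω : Fin m =>
    Real.exp (l * (cnt ω - k * f ω)) + Real.exp (-l * (cnt ω - k * f ω)))
    (fun i _ => by positivity) (Finset.mem_univ ω))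

/-! ### The sampling program and its analysis. -/

/-- The entry of row `0` of the real table `t` at the index in register `1`. -/
def entry (t : ℕ) : RExp := .tab t (.lit 0) (.var 1)

/-- Assignment to row `0` of real table `t` at the index in register `1`. -/
def setEntry (t : ℕ) (e : RExp) : Cmd := .setRTab t (.lit 0) (.var 1) e

/-- The body of the sampling loop. -/
def sampleCmd : Cmd :=
  .seq (.query 2 2 (.lit 0)) <|
  .seq (.setRTab 3 (.lit 0) (.var 2) (.add (.tab 3 (.lit 0) (.var 2)) (.lit 1))) <|
  .seq (.setR 14 (.sub (.var 14) (.lit 1))) (.setR 15 (.add (.var 15) (.lit 1)))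

/-- Estimate the outcome distribution of the contract in table `2` from as many samples as register
`7` demands, and store it in table `3`. -/
def estimateCmd : Cmd :=
  .seq (forCmd (setEntry 3 (.lit 0))) <|
  .seq (.setR 14 (.var 7)) <|
  .seq (.setR 15 (.lit 0)) <|
  .seq (.loop (.not (.rle (.var 14) (.lit 0))) sampleCmd)
    (forCmd (setEntry 3 (.div (entry 3) (.var 15))))

/-- The memory `s` changed at the places to which `estimateCmd` writes. -/
def Store.sampled (s : Store) (i x : ℕ) (r k : ℝ) (E : ℕ → ℝ) : Store where
  nvar := Function.update (Function.update s.nvar 1 i) 2 x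
  rvar := Function.update (Function.update s.rvar 14 r) 15 k
  ntab := s.ntab
  rtab t i j := if t = 3 ∧ i = 0 ∧ j < s.nvar 0 then E j else s.rtab t i j

section

variable {m : ℕ} {𝒪 : Contract m → PMF (Fin m)}

theorem sampled_contract (s : Store) (i x : ℕ) (r k : ℝ) (E : ℕ → ℝ) :
    (s.sampled i x r k E).contract m 2 0 = s.contract m 2 0 := by
  funext ω
  simp [Store.contract, Store.sampled]

theorem Det.afterQuery (s : Store) (i x : ℕ) (r k : ℝ) (E : ℕ → ℝ) {ω : ℕ} (hω : ω < s.nvar 0) :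
    Det 𝒪 (.seq (.setRTab 3 (.lit 0) (.var 2) (.add (.tab 3 (.lit 0) (.var 2)) (.lit 1))) <|
      .seq (.setR 14 (.sub (.var 14) (.lit 1))) (.setR 15 (.add (.var 15) (.lit 1))))
      ((s.sampled i x r k E).setN 2 ω) 5
      (s.sampled i ω (r - 1) (k + 1) fun j => if j = ω then E j + 1 else E j) := by
  have h := (Det.setRTab (𝒪 := 𝒪) 3 (.lit 0) (.var 2)
    (.add (.tab 3 (.lit 0) (.var 2)) (.lit 1)) ((s.sampled i x r k E).setN 2 ω)).seq
      ((Det.setR 14 (.sub (.var 14) (.lit 1)) _).seq (Det.setR 15 (.add (.var 15) (.lit 1)) _))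
  convert h using 1
  simp only [Store.sampled, Store.setN, Store.setR, Store.setRTab, RExp.eval, NExp.eval,
    Store.mk.injEq]
  refine ⟨?_, ?_, trivial, ?_⟩
  · rw [Function.update_idem]
  · funext y
    by_cases h15 : y = 15
    · subst h15; simp
    · by_cases h14 : y = 14
      · subst h14; simp
      · simp [h14, h15]
  · funext t i' j
    by_cases h3 : t = 3 ∧ i' = 0
    · obtain ⟨rfl, rfl⟩ := h3
      by_cases hj : j = ω
      · subst hj; simp [hω]
      · simp [hj]
    · have h1 : ∀ p : Prop, ¬ (t = 3 ∧ i' = 0 ∧ p) := fun p hp => h3 ⟨hp.1, hp.2.1⟩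
      simp [h1]

theorem sum_update_succ {m : ℕ} (E : ℕ → ℝ) (ω : Fin m) :
    ∑ i : Fin m, (if (i : ℕ) = (ω : ℕ) then E i + 1 else E i) = ∑ i : Fin m, E i + 1 := by
  have : ∀ i : Fin m, (if (i : ℕ) = (ω : ℕ) then E i + 1 else E i) =
      E i + if i = ω then 1 else 0 := by
    intro i
    simp only [Fin.ext_iff]
    split_ifs <;> simp
  simp only [this, Finset.sum_add_distrib]
  simp

/-- The memories that occur in the sampling loop started in `s` with `j` samples missing. -/
def Sampling (m : ℕ) (s : Store) (j : ℕ) (s' : Store) : Prop :=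
  ∃ (x k : ℕ) (E : ℕ → ℝ), s' = s.sampled m x (s.rvar 7 - k) k E ∧ k + j = ⌈s.rvar 7⌉₊ ∧
    (∀ ω : Fin m, 0 ≤ E ω) ∧ ∑ ω : Fin m, E ω = k

/-- The empirical frequencies in the memory `s'` are within `κ` of the outcome distribution of the
contract in the memory `s`. -/
def CloseEstimate (𝒪 : Contract m → PMF (Fin m)) (κ : ℝ) (s s' : Store) : Prop :=
  ∀ ω : Fin m, |s'.rtab 3 0 ω - (𝒪 (s.contract m 2 0) ω).toReal| ≤ κ

/-- A Chernoff bound carried out inside the loop rule: the normalized potential serves as the loop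
function. Its initial value is the claimed failure probability, and at the exit it dominates the
indicator of failure. -/
theorem samplingLoop_reaches {s : Store} (hm : s.nvar 0 = m) {κ : ℝ} (hκ : 0 < κ) (hκ1 : κ ≤ 1)
    {s₀ : Store} (hs₀ : s₀ = s.sampled m (s.nvar 2) (s.rvar 7) 0 (fun _ => 0)) :
    Reaches 𝒪 (.loop (.not (.rle (.var 14) (.lit 0))) sampleCmd) s₀
      (⌈s.rvar 7⌉₊ * 8 + 1) ⌈s.rvar 7⌉₊ (Sampling m s 0)
      (fun s' => ∀ ω : Fin m, |s'.rtab 3 0 ω -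
        s'.rvar 15 * (𝒪 (s.contract m 2 0) ω).toReal| ≤ ⌈s.rvar 7⌉₊ * κ)
      (ENNReal.ofReal (2 * m * Real.exp (-(κ ^ 2 * s.rvar 7 / 4)))) := by
  classical
  set N := ⌈s.rvar 7⌉₊ with hN
  set f : Fin m → ℝ := fun ω => (𝒪 (s.contract m 2 0) ω).toReal with hf
  have hf0 : ∀ ω, 0 ≤ f ω := fun ω => ENNReal.toReal_nonneg
  have hf1 : ∑ ω, f ω = 1 := by
    rw [hf, ← ENNReal.toReal_sum fun ω _ => PMF.apply_ne_top _ ω,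
      ← tsum_fintype (L := .unconditional _), PMF.tsum_coe]
    rfl
  -- The choice `l = κ / 2` minimizes `l ^ 2 - l * κ`. The term with `j` prepays the growth over the
  -- `j` missing samples, and the other one normalizes the potential to at least `1` upon failure.
  set pot : ℕ → Store → ℝ := fun j s' => Real.exp ((κ / 2) ^ 2 * j - κ / 2 * (N * κ)) *
    deviationPotential f (κ / 2) (s'.rvar 15) (s'.rtab 3 0) with hpot
  set F : ℕ → Store → ℝ≥0∞ := fun j s' =>
    if Sampling m s j s' then ENNReal.ofReal (pot j s') else ⊤ with hF
  have hFtop : ∀ {j s'}, F j s' ≠ ⊤ → Sampling m s j s' := by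
    intro j s' h
    by_contra hcon
    exact h (if_neg hcon)
  have guard : ∀ {j s'}, Sampling m s j s' →
      (BExp.eval s' (.not (.rle (.var 14) (.lit 0))) ↔ j ≠ 0) := by
    rintro j s' ⟨x, k, E, rfl, hk, -, -⟩
    have h14 : (s.sampled m x (s.rvar 7 - k) k E).rvar 14 = s.rvar 7 - k := by
      simp [Store.sampled]
    simp only [BExp.eval, RExp.eval, h14]
    -- Counting down a real register to a value at most zero takes exactly `⌈s.rvar 7⌉₊` rounds, so
    -- the machine needs no rounding.
    rw [show ((0 : ℚ) : ℝ) = 0 by simp, not_le, sub_pos, ← Nat.lt_ceil]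
    omega
  have hpotE : ∀ (j i x : ℕ) (r k : ℝ) (E : ℕ → ℝ), pot j (s.sampled i x r k E) =
      Real.exp ((κ / 2) ^ 2 * j - κ / 2 * (N * κ)) * deviationPotential f (κ / 2) k E := by
    intro j i x r k E
    simp only [hpot, deviationPotential, Store.sampled]
    simp [hm]
  have hloop := WP.loop (𝒪 := 𝒪) (bx := .not (.rle (.var 14) (.lit 0)))
    (c := sampleCmd) (t := 7) (q := 1) (f := F)
    (g := level (Sampling m s 0) fun s' => ∀ ω : Fin m, |s'.rtab 3 0 ω - s'.rvar 15 * f ω| ≤ N * κ)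
    ?_ ?_ ?_ N s₀
  · have h0 : Sampling m s N s₀ := ⟨s.nvar 2, 0, fun _ => 0, by simpa using hs₀, by simp [hN],
      by simp, by simp⟩
    have hF0 : F N s₀ = ENNReal.ofReal (pot N s₀) := if_pos h0
    refine (hloop (by rw [hF0]; simp)).mono (by omega) (by omega) (fun _ => le_rfl) ?_
    rw [hF0, hs₀, hpotE]
    apply ENNReal.ofReal_le_ofReal
    have e : deviationPotential f (κ / 2) 0 (fun _ => 0) = 2 * m := by
      simp [deviationPotential]; ring
    rw [e, mul_comm]
    refine mul_le_mul_of_nonneg_left (Real.exp_le_exp.2 ?_) (by positivity)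
    have := Nat.le_ceil (s.rvar 7)
    nlinarith [sq_nonneg κ]
  · intro j s' hb hs'
    have hS := hFtop hs'
    have hFs : F (j + 1) s' = ENNReal.ofReal (pot (j + 1) s') := if_pos hS
    obtain ⟨x, k, E, rfl, hk, hE, hE1⟩ := hS
    -- The function after the query anticipates the bookkeeping that follows, and is infinite at
    -- memories that do not arise from an answer of the oracle.
    have hq := WP.query (𝒪 := 𝒪) 2 2 (.lit 0) (s.sampled m x (s.rvar 7 - k) k E)
      (fun s'' => if ∃ ω : Fin m, s'' = (s.sampled m x (s.rvar 7 - k) k E).setN 2 ω then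
        F j (s.sampled m (s''.nvar 2) (s.rvar 7 - (k + 1 : ℕ)) (k + 1 : ℕ)
          fun i => if i = s''.nvar 2 then E i + 1 else E i) else ⊤)
    have hnext : ∀ ω : Fin m, Sampling m s j (s.sampled m ω (s.rvar 7 - (k + 1 : ℕ)) (k + 1 : ℕ)
        fun i => if i = ω then E i + 1 else E i) := by
      refine fun ω => ⟨ω, k + 1, _, rfl, by omega, fun i => ?_, ?_⟩
      · have := hE i
        split_ifs <;> linarith
      · rw [sum_update_succ, hE1]; push_cast; rfl
    have hqb : (∑ ω : Fin m, 𝒪 ((s.sampled m x (s.rvar 7 - k) k E).contract m 2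
        (NExp.eval (s.sampled m x (s.rvar 7 - k) k E) (.lit 0))) ω *
        (fun s'' => if ∃ ω : Fin m, s'' = (s.sampled m x (s.rvar 7 - k) k E).setN 2 ω then
        F j (s.sampled m (s''.nvar 2) (s.rvar 7 - (k + 1 : ℕ)) (k + 1 : ℕ)
          fun i => if i = s''.nvar 2 then E i + 1 else E i) else ⊤)
          ((s.sampled m x (s.rvar 7 - k) k E).setN 2 (ω : ℕ))) ≤
        F (j + 1) (s.sampled m x (s.rvar 7 - k) k E) := by
      rw [hFs, hpotE]
      simp only [NExp.eval, sampled_contract]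
      have hterm : ∀ ω : Fin m, 𝒪 (s.contract m 2 0) ω *
          (if ∃ ω' : Fin m, (s.sampled m x (s.rvar 7 - k) k E).setN 2 (ω : ℕ) =
            (s.sampled m x (s.rvar 7 - k) k E).setN 2 ω' then
          F j (s.sampled m (((s.sampled m x (s.rvar 7 - k) k E).setN 2 (ω : ℕ)).nvar 2)
            (s.rvar 7 - (k + 1 : ℕ)) (k + 1 : ℕ)
            fun i => if i = ((s.sampled m x (s.rvar 7 - k) k E).setN 2 (ω : ℕ)).nvar 2
              then E i + 1 else E i) else ⊤) =
          ENNReal.ofReal (Real.exp ((κ / 2) ^ 2 * j - κ / 2 * (N * κ)) *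
            (f ω * deviationPotential f (κ / 2) (k + 1)
              fun i => if i = (ω : ℕ) then E i + 1 else E i)) := by
        intro ω
        have hn : ((s.sampled m x (s.rvar 7 - k) k E).setN 2 (ω : ℕ)).nvar 2 = ω := by
          simp [Store.setN]
        rw [if_pos ⟨ω, rfl⟩, hn]
        simp only [hF, if_pos (hnext ω)]
        rw [hpotE, ← ENNReal.ofReal_toReal (PMF.apply_ne_top (𝒪 (s.contract m 2 0)) ω),
          ← ENNReal.ofReal_mul (hf0 ω), mul_left_comm]
        push_cast
        rfl
      simp only [hterm]
      rw [← ENNReal.ofReal_sum_of_nonneg]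
      · apply ENNReal.ofReal_le_ofReal
        rw [← Finset.mul_sum]
        have hstep := sum_mul_deviationPotential_le hf0 hf1 (l := κ / 2)
          (by rw [abs_of_pos (by linarith)]; linarith) k E
        refine (mul_le_mul_of_nonneg_left hstep (Real.exp_pos _).le).trans (le_of_eq ?_)
        rw [← mul_assoc, ← Real.exp_add]
        congr 2
        push_cast
        ring
      · intro ω _
        refine mul_nonneg (Real.exp_pos _).le (mul_nonneg (hf0 ω) ?_)
        exact Finset.sum_nonneg fun i _ => by positivity
    have hfin : F (j + 1) (s.sampled m x (s.rvar 7 - k) k E) ≠ ⊤ := hs'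
    refine (WP.seq hfin (hq.mono le_rfl le_rfl (fun _ => le_rfl) hqb) (t' := 5) (q' := 0)
      fun s'' hs'' => ?_).mono (by omega) (by omega) (fun _ => le_rfl) le_rfl
    obtain ⟨ω, rfl⟩ : ∃ ω : Fin m, s'' = (s.sampled m x (s.rvar 7 - k) k E).setN 2 ω := by
      by_contra hcon
      exact hs'' (if_neg hcon)
    rw [if_pos ⟨ω, rfl⟩]
    have hd := (Det.afterQuery (𝒪 := 𝒪) s m x (s.rvar 7 - k) k E
      (by rw [hm]; exact ω.2)).wp (F j)
    refine hd.mono le_rfl le_rfl (fun _ => le_rfl) (le_of_eq ?_)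
    have hn : ((s.sampled m x (s.rvar 7 - k) k E).setN 2 (ω : ℕ)).nvar 2 = ω := by
      simp [Store.setN]
    rw [hn]
    push_cast
    rw [sub_sub]
  · intro j s' hb
    by_cases hS : Sampling m s j s'
    · have hj : j = 0 := by
        by_contra hj
        exact hb ((guard hS).2 hj)
      subst hj
      by_cases hG : ∀ ω : Fin m, |s'.rtab 3 0 ω - s'.rvar 15 * f ω| ≤ N * κ
      · rw [level_good hS hG]; exact zero_le
      · rw [level_bad hS hG]
        simp only [hF, if_pos hS]
        rw [← ENNReal.ofReal_one]
        apply ENNReal.ofReal_le_ofReal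
        push Not at hG
        -- A single deviating count already pushes the potential above `exp (κ / 2 * (N * κ))`.
        obtain ⟨ω, hω⟩ := hG
        have := exp_le_deviationPotential (by linarith : 0 ≤ κ / 2) hω
        calc (1 : ℝ) = Real.exp ((κ / 2) ^ 2 * (0 : ℕ) - κ / 2 * (N * κ)) *
              Real.exp (κ / 2 * (N * κ)) := by rw [← Real.exp_add]; simp
          _ ≤ _ := mul_le_mul_of_nonneg_left this (Real.exp_pos _).le
    · simp only [hF, if_neg hS]; exact le_top
  · intro s' hb
    by_contra hcon
    exact (guard (hFtop hcon)).1 hb rfl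

/-- The memories that occur as results of `estimateCmd` started in `s`. -/
def Estimated (m : ℕ) (s s' : Store) : Prop :=
  ∃ (x : ℕ) (r k : ℝ) (E : ℕ → ℝ), s' = s.sampled m x r k E ∧ (∀ ω : Fin m, 0 ≤ E ω) ∧
    ∑ ω : Fin m, E ω = 1

theorem estimateCmd_reaches {s : Store} (hm : s.nvar 0 = m) {κ : ℝ} (hκ : 0 < κ) (hκ1 : κ ≤ 1)
    (hn : 0 < s.rvar 7) :
    Reaches 𝒪 estimateCmd s (8 * m + 8 * ⌈s.rvar 7⌉₊ + 20) ⌈s.rvar 7⌉₊ (Estimated m s)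
      (CloseEstimate 𝒪 κ s) (ENNReal.ofReal (2 * m * Real.exp (-(κ ^ 2 * s.rvar 7 / 4)))) := by
  have d1 : Det 𝒪 (forCmd (setEntry 3 (.lit 0))) s _ _ :=
    Det.fill (tb := 3) (t := 1) (fun _ => 0) fun j hj => by
      have := Det.setRTab (𝒪 := 𝒪) 3 (.lit 0) (.var 1) (.lit 0)
        (s.fill 3 (fun _ => 0) j)
      simpa [setEntry, NExp.eval, RExp.eval, Store.fill] using this
  have d2 := Det.setR (𝒪 := 𝒪) 14 (.var 7) (s.fill 3 (fun _ => 0) (s.nvar 0))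
  have d3 := Det.setR (𝒪 := 𝒪) 15 (.lit 0)
    ((s.fill 3 (fun _ => 0) (s.nvar 0)).setR 14 (RExp.eval (s.fill 3 (fun _ => 0) (s.nvar 0))
      (.var 7)))
  have h3 : ((s.fill 3 (fun _ => 0) (s.nvar 0)).setR 14 (RExp.eval (s.fill 3 (fun _ => 0)
      (s.nvar 0)) (.var 7))).setR 15 (RExp.eval ((s.fill 3 (fun _ => 0) (s.nvar 0)).setR 14
        (RExp.eval (s.fill 3 (fun _ => 0) (s.nvar 0)) (.var 7))) (.lit 0)) =
      s.sampled m (s.nvar 2) (s.rvar 7) 0 (fun _ => 0) := by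
    simp only [Store.fill, Store.setR, Store.sampled, RExp.eval, hm, Store.mk.injEq]
    refine ⟨?_, by simp, trivial, trivial⟩
    funext y
    simp only [Function.update_apply]
    split_ifs <;> simp_all
  have hl := samplingLoop_reaches (𝒪 := 𝒪) hm hκ hκ1 h3
  refine Reaches.mono (d1.seq_reaches ENNReal.ofReal_ne_top (d2.seq_reaches ENNReal.ofReal_ne_top
    (d3.seq_reaches ENNReal.ofReal_ne_top
    (Reaches.seq_det (t' := m * 4 + 3) (S' := Estimated m s) (G' := CloseEstimate 𝒪 κ s)
      ENNReal.ofReal_ne_top hl ?_)))) ?_ le_rfl (fun _ h => h) (fun _ _ h => h) le_rfl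
  · rintro s' ⟨x, k, E, rfl, hk, hE, hE1⟩
    have hkpos : (0 : ℝ) < k := by
      have : 0 < ⌈s.rvar 7⌉₊ := Nat.ceil_pos.2 hn
      have : 0 < k := by omega
      exact_mod_cast this
    set s₁ := s.sampled m x (s.rvar 7 - k) k E with hs₁
    have hm1 : s₁.nvar 0 = m := by simp [hs₁, Store.sampled, hm]
    have d5 : Det 𝒪 (forCmd (setEntry 3 (.div (entry 3) (.var 15)))) s₁ _ _ :=
      Det.fill (tb := 3) (t := 1) (fun j => E j / k) fun j hj => by
        have := Det.setRTab (𝒪 := 𝒪) 3 (.lit 0) (.var 1) (.div (entry 3) (.var 15))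
          (s₁.fill 3 (fun j => E j / k) j)
        rw [hm1] at hj
        simpa [setEntry, NExp.eval, RExp.eval, Store.fill, entry, hs₁, Store.sampled, hj, hm] using this
    have hfin : s₁.fill 3 (fun j => E j / k) (s₁.nvar 0) =
        s.sampled m x (s.rvar 7 - k) k (fun j => E j / k) := by
      rw [hm1]
      simp only [hs₁, Store.fill, Store.sampled, Store.mk.injEq, true_and, hm]
      constructor
      · funext y
        simp only [Function.update_apply]
        split_ifs <;> simp_all
      · funext t i j
        split_ifs <;> rfl
    rw [hfin, hm1] at d5
    refine ⟨_, d5, ⟨x, _, _, _, rfl, fun ω => div_nonneg (hE ω) hkpos.le, ?_⟩, ?_⟩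
    · rw [← Finset.sum_div, hE1, div_self hkpos.ne']
    · intro hG ω
      have := hG ω
      have hk' : (⌈s.rvar 7⌉₊ : ℝ) = k := by rw [← hk, add_zero]
      simp only [hs₁, Store.sampled, hm, hk'] at this
      simp only [Store.sampled, hm]
      simp only [true_and, ω.2, if_true, Function.update_self] at this ⊢
      have e : E ω / k - (𝒪 (s.contract m 2 0) ω).toReal =
          (E ω - k * (𝒪 (s.contract m 2 0) ω).toReal) / k := by field_simp
      rw [e, abs_div, abs_of_pos hkpos, div_le_iff₀ hkpos, mul_comm κ]
      exact this
  · rw [hm]; omega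

end

end

section

/-! ## The learning algorithm -/

/-- Post the mixture of the current contract and the principal's values. -/
def mixCmd : Cmd :=
  forCmd (setEntry 2 (.add (.mul (.sub (.lit 1) (.var 3)) (entry 5)) (.mul (.var 3) (entry 0))))

/-- Estimate the principal's utility of the posted contract. -/
def utilityCmd : Cmd :=
  .seq (.setR 11 (.lit 0))
    (forCmd (.setR 11 (.add (.var 11) (.mul (entry 3) (.sub (entry 0) (entry 2))))))

/-- Record the posted contract as output if its estimated utility exceeds the best one so far. -/
def recordCmd : Cmd :=
  .ite (.not (.rle (.var 11) (.var 10)))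
    (.seq (.setR 10 (.var 11)) (forCmd (setEntry 1 (entry 2)))) (.setR 11 (.lit 0))

/-- The current contract after an unprojected descent step. -/
def descentExp : RExp :=
  .sub (entry 5) (.mul (.div (.var 4) (.lit 4))
    (.sub (entry 3) (.mul (.sub (.lit 1) (.var 3)) (entry 4))))

/-- A step of projected gradient descent. -/
def descentCmd : Cmd :=
  forCmd (.ite (.rle descentExp (.lit 0)) (setEntry 5 (.lit 0))
    (.ite (.rle (.var 0) descentExp) (setEntry 5 (.var 0)) (setEntry 5 descentExp)))

/-- What follows the estimation of the outcome distribution in an iteration of the inner loop. -/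
def updateCmd : Cmd :=
  .seq utilityCmd <| .seq recordCmd <| .seq descentCmd (.setR 12 (.sub (.var 12) (.lit 1)))

/-- An iteration of the inner loop. -/
def innerCmd : Cmd := .seq mixCmd (.seq estimateCmd updateCmd)

/-- An iteration of the outer loop. -/
def outerCmd : Cmd :=
  .seq (forCmd (setEntry 2 (.mul (.var 9) (.ofNat (.var 1))))) <|
  .seq estimateCmd <|
  .seq (forCmd (setEntry 4 (entry 3))) <|
  .seq (forCmd (setEntry 5 (.lit 0))) <|
  .seq (.setR 12 (.var 8)) <|
  .seq (.loop (.not (.rle (.var 12) (.lit 0))) innerCmd) (.setR 9 (.add (.var 9) (.var 6)))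

/-- The outer loop. -/
def searchCmd : Cmd := .loop (.rle (.var 9) (.mul (.lit 3) (.var 0))) outerCmd

/-! ### Frame conditions and the effects of the deterministic commands. -/

/-- `s` and `s'` agree in the register `0`, outside the real registers `R`, and outside the real
tables `U`. -/
structure Frame (R U : Finset ℕ) (s s' : Store) : Prop where
  nvar : s'.nvar 0 = s.nvar 0
  rvar : ∀ x, x ∉ R → s'.rvar x = s.rvar x
  rtab : ∀ t i j, t ∉ U → s'.rtab t i j = s.rtab t i j

theorem Frame.trans {R U R' U' : Finset ℕ} {s s' s'' : Store} (h : Frame R U s s')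
    (h' : Frame R' U' s' s'') : Frame (R ∪ R') (U ∪ U') s s'' where
  nvar := h'.nvar.trans h.nvar
  rvar x hx := by
    rw [Finset.mem_union, not_or] at hx
    exact (h'.rvar x hx.2).trans (h.rvar x hx.1)
  rtab t i j ht := by
    rw [Finset.mem_union, not_or] at ht
    exact (h'.rtab t i j ht.2).trans (h.rtab t i j ht.1)

theorem Frame.mono {R U R' U' : Finset ℕ} {s s' : Store} (h : Frame R U s s') (hR : R ⊆ R')
    (hU : U ⊆ U') : Frame R' U' s s' where
  nvar := h.nvar
  rvar x hx := h.rvar x fun h => hx (hR h)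
  rtab t i j ht := h.rtab t i j fun h => ht (hU h)

theorem Frame.fill (s : Store) (tb : ℕ) (E : ℕ → ℝ) (k : ℕ) : Frame ∅ {tb} s (s.fill tb E k) where
  nvar := by simp [Store.fill]
  rvar x _ := rfl
  rtab t i j ht := by
    rw [Finset.mem_singleton] at ht
    simp [Store.fill, ht]

theorem Frame.setR (s : Store) (x : ℕ) (r : ℝ) : Frame {x} ∅ s (s.setR x r) where
  nvar := rfl
  rvar y hy := by
    rw [Finset.mem_singleton] at hy
    simp [Store.setR, hy]
  rtab _ _ _ _ := rfl

theorem Frame.sampled (s : Store) (i x : ℕ) (r k : ℝ) (E : ℕ → ℝ) :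
    Frame {14, 15} {3} s (s.sampled i x r k E) where
  nvar := by simp [Store.sampled]
  rvar y hy := by
    simp only [Finset.mem_insert, Finset.mem_singleton, not_or] at hy
    simp [Store.sampled, hy]
  rtab t i j ht := by
    rw [Finset.mem_singleton] at ht
    simp [Store.sampled, ht]

theorem fill_rtab {s : Store} {tb : ℕ} {E : ℕ → ℝ} {k j : ℕ} (hj : j < k) :
    (s.fill tb E k).rtab tb 0 j = E j := by simp [Store.fill, hj]

section

variable {m : ℕ} {𝒪 : Contract m → PMF (Fin m)}

theorem Det.fillRow {s : Store} (tb : ℕ) (e : RExp) (E : ℕ → ℝ)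
    (hE : ∀ j < s.nvar 0, e.eval (s.fill tb E j) = E j) :
    Det 𝒪 (ContractLearning.forCmd (setEntry tb e)) s (s.nvar 0 * 4 + 3)
      (s.fill tb E (s.nvar 0)) :=
  Det.fill E fun j hj => by
    have := Det.setRTab (𝒪 := 𝒪) tb (.lit 0) (.var 1) e (s.fill tb E j)
    rw [hE j hj] at this
    simpa only [setEntry, NExp.eval, Store.fill, Function.update_self] using this

/-- The hypothesis `hE` makes the summand independent of the accumulator, so the invariant is the
partial sum. -/
theorem Det.accumulate {s : Store} (x : ℕ) (e : RExp) (E : ℕ → ℝ) (h0 : s.rvar x = 0)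
    (hE : ∀ j < s.nvar 0, ∀ a, e.eval ((s.setN 1 j).setR x a) = E j) :
    Det 𝒪 (ContractLearning.forCmd (.setR x (.add (.var x) e))) s (s.nvar 0 * 4 + 3)
      ((s.setN 1 (s.nvar 0)).setR x (∑ j ∈ Finset.range (s.nvar 0), E j)) := by
  refine Det.forCmd (t := 1) (fun k => (s.setN 1 k).setR x (∑ j ∈ Finset.range k, E j)) ?_ ?_ ?_ ?_
  · simp only [Store.setN, Store.setR, Finset.range_zero, Finset.sum_empty, Store.mk.injEq, true_and,
      and_true]
    rw [← h0, Function.update_eq_self]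
  · simp [Store.setN, Store.setR]
  · simp [Store.setN, Store.setR]
  · intro j hj
    refine ⟨_, Det.setR _ _ _, by simp [Store.setN, Store.setR], ?_⟩
    simp only [RExp.eval, hE j hj]
    simp [Store.setN, Store.setR, Finset.sum_range_succ]

end

/-- The parameters of the algorithm. -/
structure Params where
  H : ℝ
  s : ℝ
  θ : ℝ
  κ : ℝ
  α₀ : ℝ
  τ : ℝ
  n : ℝ
  T : ℝ

/-- The requirements on the parameters of the algorithm. -/
structure Params.Valid (P : Params) (m : ℕ) : Prop where
  H : 1 ≤ P.H
  s : 0 < P.s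
  s_le : P.s ≤ 1
  θ : 0 < P.θ
  κ : 0 < P.κ
  κ_le : P.κ ≤ 1
  κθ : 4 * (m * (P.κ * P.H)) ≤ P.θ
  τ : 0 < P.τ
  n : 0 < P.n
  T : m * P.H ^ 2 < P.T * (P.θ ^ 2 / 8)

variable {m : ℕ} [NeZero m]

/-- The memory `st` contains the parameters and the input. -/
structure Fixed (I : Problem.{u} m) (P : Params) (st : Store) : Prop where
  size : st.nvar 0 = m
  H : st.rvar 0 = P.H
  s : st.rvar 3 = P.s
  θ : st.rvar 4 = P.θ
  τ : st.rvar 6 = P.τ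
  n : st.rvar 7 = P.n
  T : st.rvar 8 = P.T
  value : ∀ ω : Fin m, st.rtab 0 0 ω = I.value ω

theorem Fixed.frame {I : Problem.{u} m} {P : Params} {st st' : Store} (h : Fixed I P st)
    {R U : Finset ℕ} (hf : Frame R U st st') (hR : Disjoint R {0, 3, 4, 6, 7, 8}) (hU : 0 ∉ U) :
    Fixed I P st' := by
  have hx : ∀ x ∈ ({0, 3, 4, 6, 7, 8} : Finset ℕ), st'.rvar x = st.rvar x := fun x hx =>
    hf.rvar x (Finset.disjoint_right.1 hR hx)
  exact ⟨hf.nvar.trans h.size, (hx _ (by decide)).trans h.H, (hx _ (by decide)).trans h.s,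
    (hx _ (by decide)).trans h.θ, (hx _ (by decide)).trans h.τ, (hx _ (by decide)).trans h.n,
    (hx _ (by decide)).trans h.T, fun ω => (hf.rtab _ _ _ hU).trans (h.value ω)⟩

section

variable {I : Problem.{u} m} {P : Params} {𝒪 : Contract m → PMF (Fin m)}

theorem mixCmd_det {st : Store} (h : Fixed I P st) :
    ∃ st', Det 𝒪 mixCmd st (m * 4 + 3) st' ∧ Frame ∅ {2} st st' ∧
      ∀ ω : Fin m, st'.rtab 2 0 ω = (1 - P.s) * st.rtab 5 0 ω + P.s * I.value ω := by
  have hd := Det.fillRow (𝒪 := 𝒪) (s := st) 2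
    (.add (.mul (.sub (.lit 1) (.var 3)) (entry 5)) (.mul (.var 3) (entry 0)))
    (fun j => (1 - P.s) * st.rtab 5 0 j + P.s * st.rtab 0 0 j)
    (fun j _ => by simp [RExp.eval, NExp.eval, entry, Store.fill, h.s])
  rw [h.size] at hd
  refine ⟨_, hd, Frame.fill _ _ _ _, fun ω => ?_⟩
  rw [fill_rtab ω.2, h.value]

theorem utilityCmd_det {st : Store} (h : Fixed I P st) :
    ∃ st', Det 𝒪 utilityCmd st (m * 4 + 5) st' ∧ Frame {11} ∅ st st' ∧
      st'.rvar 11 = ∑ ω : Fin m, st.rtab 3 0 ω * (I.value ω - st.rtab 2 0 ω) := by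
  have hd := Det.accumulate (𝒪 := 𝒪) (s := st.setR 11 0) 11
    (.mul (entry 3) (.sub (entry 0) (entry 2)))
    (fun j => st.rtab 3 0 j * (st.rtab 0 0 j - st.rtab 2 0 j)) (by simp [Store.setR])
    (fun j _ a => by simp [RExp.eval, NExp.eval, entry, Store.setR, Store.setN])
  have hd0 := Det.setR (𝒪 := 𝒪) 11 (.lit 0) st
  rw [show RExp.eval st (.lit 0) = 0 by simp [RExp.eval]] at hd0
  have hn : (st.setR 11 0).nvar 0 = m := h.size
  rw [hn] at hd
  refine ⟨_, (hd0.seq hd).mono (by omega), ⟨?_, ?_, ?_⟩, ?_⟩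
  · simp [Store.setR, Store.setN]
  · intro x hx
    rw [Finset.mem_singleton] at hx
    simp [Store.setR, Store.setN, hx]
  · intro t i j _
    rfl
  · simp only [Store.setR, Function.update_self]
    rw [Finset.sum_range]
    simp only [h.value]

theorem recordCmd_det {st : Store} (h : Fixed I P st) :
    ∃ st', Det 𝒪 recordCmd st (m * 4 + 6) st' ∧ Frame {10, 11} {1} st st' ∧
      ((st.rvar 11 ≤ st.rvar 10 ∧ st'.rvar 10 = st.rvar 10 ∧
          ∀ ω : Fin m, st'.rtab 1 0 ω = st.rtab 1 0 ω) ∨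
        (st.rvar 10 < st.rvar 11 ∧ st'.rvar 10 = st.rvar 11 ∧
          ∀ ω : Fin m, st'.rtab 1 0 ω = st.rtab 2 0 ω)) := by
  by_cases hle : st.rvar 11 ≤ st.rvar 10
  -- The assignment to register `11` in this branch merely fills the place of an empty command.
  · refine ⟨_, (Det.ite_false (by simpa [BExp.eval, RExp.eval] using hle)
      (Det.setR 11 (.lit 0) st)).mono (by omega), (Frame.setR _ _ _).mono (by decide) (by decide),
      Or.inl ⟨hle, ?_, fun ω => rfl⟩⟩
    simp [Store.setR]
  · have hd0 := Det.setR (𝒪 := 𝒪) 10 (.var 11) st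
    have hd := Det.fillRow (𝒪 := 𝒪) (s := st.setR 10 (RExp.eval st (.var 11))) 1 (entry 2)
      (fun j => st.rtab 2 0 j)
      (fun j _ => by simp [RExp.eval, NExp.eval, entry, Store.fill, Store.setR])
    have hn : (st.setR 10 (RExp.eval st (.var 11))).nvar 0 = m := h.size
    rw [hn] at hd
    refine ⟨_, (Det.ite_true (by simpa [BExp.eval, RExp.eval] using hle) (hd0.seq hd)).mono
      (by omega), ((Frame.setR _ _ _).trans (Frame.fill _ _ _ _)).mono (by decide) (by decide),
      Or.inr ⟨not_le.1 hle, ?_, fun ω => fill_rtab ω.2⟩⟩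
    simp [Store.fill, Store.setR, RExp.eval]

theorem descentCmd_det {st : Store} (h : Fixed I P st) :
    ∃ st', Det 𝒪 descentCmd st (m * 6 + 3) st' ∧ Frame ∅ {5} st st' ∧
      ∀ ω : Fin m, st'.rtab 5 0 ω = clip P.H (st.rtab 5 0 ω -
        P.θ / 4 * (st.rtab 3 0 ω - (1 - P.s) * st.rtab 4 0 ω)) := by
  set E : ℕ → ℝ := fun j => st.rtab 5 0 j -
    P.θ / 4 * (st.rtab 3 0 j - (1 - P.s) * st.rtab 4 0 j) with hE
  have hd : Det 𝒪 descentCmd st _ _ :=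
    Det.fill (tb := 5) (t := 3) (fun j => clip P.H (E j)) fun j _ => by
      set st₁ := st.fill 5 (fun j => clip P.H (E j)) j with hst₁
      have he : descentExp.eval st₁ = E j := by
        simp [descentExp, RExp.eval, NExp.eval, entry, Store.fill, hst₁, hE, h.s, h.θ]
      have hH : st₁.rvar 0 = P.H := h.H
      have hj : st₁.nvar 1 = j := by simp [hst₁, Store.fill]
      have hset : ∀ e : RExp, Det 𝒪 (setEntry 5 e) st₁ 1 (st₁.setRTab 5 0 j (e.eval st₁)) := by
        intro e
        have := Det.setRTab (𝒪 := 𝒪) 5 (.lit 0) (.var 1) e st₁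
        simpa only [setEntry, NExp.eval, hj] using this
      by_cases h1 : E j ≤ 0
      · have hb : BExp.eval st₁ (.rle descentExp (.lit 0)) := by
          simpa [BExp.eval, RExp.eval, he] using h1
        have := hset (.lit 0)
        rw [show RExp.eval st₁ (.lit 0) = clip P.H (E j) by simp [RExp.eval, clip, h1]] at this
        exact (Det.ite_true hb this).mono (by omega)
      · have hb : ¬ BExp.eval st₁ (.rle descentExp (.lit 0)) := by
          simpa [BExp.eval, RExp.eval, he] using h1
        refine (Det.ite_false hb (t := 2) ?_).mono (by omega)
        by_cases h2 : P.H ≤ E j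
        · have hb : BExp.eval st₁ (.rle (.var 0) descentExp) := by
            simpa [BExp.eval, RExp.eval, he, hH] using h2
          have := hset (.var 0)
          rw [show RExp.eval st₁ (.var 0) = clip P.H (E j) by
            simp [RExp.eval, clip, h1, h2, hH]] at this
          exact Det.ite_true hb this
        · have hb : ¬ BExp.eval st₁ (.rle (.var 0) descentExp) := by
            simpa [BExp.eval, RExp.eval, he, hH] using h2
          have := hset descentExp
          rw [show RExp.eval st₁ descentExp = clip P.H (E j) by simp [he, clip, h1, h2]] at this
          exact Det.ite_false hb this
  rw [h.size] at hd
  exact ⟨_, hd, Frame.fill _ _ _ _, fun ω => fill_rtab ω.2⟩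

theorem updateCmd_det {st : Store} (h : Fixed I P st) :
    ∃ st', Det 𝒪 updateCmd st (m * 14 + 18) st' ∧ Frame {10, 11, 12} {1, 5} st st' ∧
      st'.rvar 12 = st.rvar 12 - 1 ∧
      (∀ ω : Fin m, st'.rtab 5 0 ω = clip P.H (st.rtab 5 0 ω -
        P.θ / 4 * (st.rtab 3 0 ω - (1 - P.s) * st.rtab 4 0 ω))) ∧
      ((∑ ω : Fin m, st.rtab 3 0 ω * (I.value ω - st.rtab 2 0 ω) ≤ st.rvar 10 ∧
          st'.rvar 10 = st.rvar 10 ∧ ∀ ω : Fin m, st'.rtab 1 0 ω = st.rtab 1 0 ω) ∨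
        (st.rvar 10 < ∑ ω : Fin m, st.rtab 3 0 ω * (I.value ω - st.rtab 2 0 ω) ∧
          st'.rvar 10 = ∑ ω : Fin m, st.rtab 3 0 ω * (I.value ω - st.rtab 2 0 ω) ∧
          ∀ ω : Fin m, st'.rtab 1 0 ω = st.rtab 2 0 ω)) := by
  obtain ⟨s₁, d1, f1, u1⟩ := utilityCmd_det (𝒪 := 𝒪) h
  have h1 := h.frame f1 (by decide) (by decide)
  obtain ⟨s₂, d2, f2, u2⟩ := recordCmd_det (𝒪 := 𝒪) h1
  have h2 := h1.frame f2 (by decide) (by decide)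
  obtain ⟨s₃, d3, f3, u3⟩ := descentCmd_det (𝒪 := 𝒪) h2
  have d4 := Det.setR (𝒪 := 𝒪) 12 (.sub (.var 12) (.lit 1)) s₃
  have f4 := Frame.setR s₃ 12 (RExp.eval s₃ (.sub (.var 12) (.lit 1)))
  refine ⟨_, (d1.seq (d2.seq (d3.seq d4))).mono (by omega),
    (((f1.trans f2).trans f3).trans f4).mono (by decide) (by decide), ?_, ?_, ?_⟩
  · simp only [Store.setR, RExp.eval, Function.update_self]
    rw [f3.rvar 12 (by decide), f2.rvar 12 (by decide), f1.rvar 12 (by decide)]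
    simp
  · intro ω
    rw [f4.rtab _ _ _ (by decide), u3]
    have e : ∀ t ∉ ({1} : Finset ℕ), s₂.rtab t 0 ω = st.rtab t 0 ω := fun t ht =>
      (f2.rtab _ _ _ ht).trans (f1.rtab _ _ _ (by simp))
    rw [e 5 (by decide), e 3 (by decide), e 4 (by decide)]
  · rw [f4.rvar 10 (by decide), f3.rvar 10 (by decide), ← u1]
    have e1 : ∀ ω : Fin m, (s₃.setR 12 (RExp.eval s₃ (.sub (.var 12) (.lit 1)))).rtab 1 0 ω =
        s₂.rtab 1 0 ω := fun ω =>
      (f4.rtab _ _ _ (by decide)).trans (f3.rtab _ _ _ (by decide))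
    have e2 : s₁.rvar 10 = st.rvar 10 := f1.rvar 10 (by decide)
    have e3 : ∀ t (ω : Fin m), s₁.rtab t 0 ω = st.rtab t 0 ω := fun t ω =>
      f1.rtab _ _ _ (by simp)
    simpa only [e1, e2, e3] using u2

end

/-! ### The invariants -/

/-- The payments in row `0` of table `t` lie between `0` and `H`. -/
def InBox (m t : ℕ) (H : ℝ) (st : Store) : Prop :=
  ∀ ω : Fin m, 0 ≤ st.rtab t 0 ω ∧ st.rtab t 0 ω ≤ H

theorem coe_contract {m t : ℕ} {H : ℝ} {st : Store} (h : InBox m t H st) (ω : Fin m) :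
    (st.contract m t 0 ω : ℝ) = st.rtab t 0 ω :=
  Real.coe_toNNReal _ (h ω).1

/-- Row `0` of table `t` is a probability vector. -/
def IsProb (m t : ℕ) (st : Store) : Prop :=
  (∀ ω : Fin m, 0 ≤ st.rtab t 0 ω) ∧ ∑ ω : Fin m, st.rtab t 0 ω = 1

variable (I : Problem.{u} m) (br : Contract m → I.Action) (P : Params)

/-- The recorded contract is almost as good as recorded, and it is good compared with the actions
induced by the grid points below `α`. -/
structure Recorded (α : ℝ) (st : Store) : Prop where
  value : st.rvar 10 ≤ I.principalUtility br (st.contract m 1 0) + P.θ / 4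
  grid : ∀ i : ℕ, P.α₀ + i * P.τ < α → ∀ p : Contract m, p.IsBounded P.H →
    I.penalizedUtility br P.s (br (linearContract m (P.α₀ + i * P.τ))) p -
      (P.θ / P.s + P.s + P.θ / 4) ≤ st.rvar 10

/-- The safety invariant of the inner loop. -/
structure InnerSafe (α : ℝ) (j : ℕ) (st : Store) : Prop where
  fixed : Fixed I P st
  output : InBox m 1 P.H st
  current : InBox m 5 P.H st
  target : IsProb m 4 st
  counter : st.rvar 12 ≤ j
  point : st.rvar 9 = α

/-- The invariant of the inner loop that may fail with small probability. -/
structure InnerGood (α : ℝ) (st : Store) : Prop where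
  recorded : Recorded I br P α st
  target : ∀ ω : Fin m, |st.rtab 4 0 ω - I.prob (br (linearContract m α)) ω| ≤ P.κ
  descent : ∀ p : Contract m, p.IsBounded P.H →
    I.penalizedUtility br P.s (br (linearContract m α)) p - (P.θ / P.s + P.s + P.θ / 4) ≤
      st.rvar 10 ∨
    ∑ ω : Fin m, (st.rtab 5 0 ω - p ω) ^ 2 ≤
      m * P.H ^ 2 - (P.T - st.rvar 12) * (P.θ ^ 2 / 8)

/-- The safety invariant of the outer loop. -/
structure OuterSafe (j : ℕ) (st : Store) : Prop where
  fixed : Fixed I P st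
  output : InBox m 1 P.H st
  point : ∃ i : ℕ, st.rvar 9 = P.α₀ + i * P.τ
  counter : 3 * P.H - st.rvar 9 < j * P.τ

/-- The bound on the failure probability of one estimate. -/
def failure (m : ℕ) (P : Params) : ℝ≥0∞ :=
  ENNReal.ofReal (2 * m * Real.exp (-(P.κ ^ 2 * P.n / 4)))

theorem failure_ne_top (m : ℕ) (P : Params) : failure m P ≠ ⊤ := ENNReal.ofReal_ne_top

/-! ### Correctness of the inner and the outer loop. -/

variable {I br P}

/-- Only the one estimate in the iteration can fail. If it is accurate, `Problem.descent_step`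
applies to every bounded `p` for which no sufficiently good value has been recorded yet. -/
theorem innerCmd_reaches (hbr : ∀ p, I.IsBestResponse p (br p)) (hP : P.Valid m) {α : ℝ} {j : ℕ}
    {st : Store} (hst : InnerSafe I P α (j + 1) st) :
    Reaches (I.contractOracle br) innerCmd st (26 * m + 8 * ⌈P.n⌉₊ + 50) ⌈P.n⌉₊
      (InnerSafe I P α j) (fun st' => InnerGood I br P α st → InnerGood I br P α st')
      (failure m P) := by
  have hH0 : 0 ≤ P.H := zero_le_one.trans hP.H
  obtain ⟨s₁, d1, f1, u1⟩ := mixCmd_det (𝒪 := I.contractOracle br) hst.fixed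
  have h1 := hst.fixed.frame f1 (by decide) (by decide)
  -- The posted mixture stays `H`-bounded because the values are at most `1 ≤ H`; thus whatever is
  -- recorded is a valid output, even when estimates fail.
  have box1 : InBox m 2 P.H s₁ := by
    intro ω
    have h5 := hst.current ω
    have hv0 := I.value_nonneg ω
    have hv1 := (I.value_le_one ω).trans hP.H
    have hs := hP.s
    have hs1 := hP.s_le
    rw [u1]
    constructor
    · have := mul_nonneg (sub_nonneg.2 hs1) h5.1
      have := mul_nonneg hs.le hv0
      linarith
    · have := mul_le_mul_of_nonneg_left h5.2 (sub_nonneg.2 hs1)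
      have := mul_le_mul_of_nonneg_left hv1 hs.le
      linarith
  have hest := estimateCmd_reaches (𝒪 := I.contractOracle br) h1.size hP.κ hP.κ_le
    (by rw [h1.n]; exact hP.n)
  rw [h1.n] at hest
  refine Reaches.mono (d1.seq_reaches ENNReal.ofReal_ne_top
    (hest.seq_det (t' := m * 14 + 18) (S' := InnerSafe I P α j)
    (G' := fun st' => InnerGood I br P α st → InnerGood I br P α st') ENNReal.ofReal_ne_top ?_))
    (by omega) le_rfl (fun _ h => h) (fun _ _ h => h) le_rfl
  rintro s₂ ⟨x, r, k, E, hs₂, hE0, hE1⟩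
  have f2 : Frame {14, 15} {3} s₁ s₂ := hs₂ ▸ Frame.sampled _ _ _ _ _ _
  have h2 := h1.frame f2 (by decide) (by decide)
  have hE : ∀ ω : Fin m, s₂.rtab 3 0 ω = E ω := by
    intro ω
    simp [hs₂, Store.sampled, h1.size]
  obtain ⟨s₃, d3, f3, u12, u5, u10⟩ := updateCmd_det (𝒪 := I.contractOracle br) h2
  have f12 := f1.trans f2
  have f13 := f12.trans f3
  have e5 : ∀ ω : Fin m, s₂.rtab 5 0 ω = st.rtab 5 0 ω := fun ω => f12.rtab _ _ _ (by decide)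
  have e4 : ∀ ω : Fin m, s₂.rtab 4 0 ω = st.rtab 4 0 ω := fun ω => f12.rtab _ _ _ (by decide)
  have e1 : ∀ ω : Fin m, s₂.rtab 1 0 ω = st.rtab 1 0 ω := fun ω => f12.rtab _ _ _ (by decide)
  have e2 : ∀ ω : Fin m, s₂.rtab 2 0 ω = s₁.rtab 2 0 ω := fun ω => f2.rtab _ _ _ (by decide)
  have e10 : s₂.rvar 10 = st.rvar 10 := f12.rvar _ (by decide)
  have e12 : s₂.rvar 12 = st.rvar 12 := f12.rvar _ (by decide)
  have e34 : ∀ ω : Fin m, s₃.rtab 4 0 ω = st.rtab 4 0 ω := fun ω => f13.rtab _ _ _ (by decide)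
  simp only [hE, e5, e4, e1, e2, e10, e12] at u12 u5 u10
  set q := s₁.contract m 2 0 with hq
  have hqω : ∀ ω, (q ω : ℝ) = s₁.rtab 2 0 ω := coe_contract box1
  refine ⟨s₃, d3, ?_, ?_⟩
  · refine ⟨h2.frame f3 (by decide) (by decide), ?_, ?_, ?_, ?_, ?_⟩
    · intro ω
      rcases u10 with ⟨-, -, u⟩ | ⟨-, -, u⟩
      · rw [u]; exact hst.output ω
      · rw [u]; exact box1 ω
    · intro ω
      rw [u5]
      exact ⟨clip_nonneg hH0 _, clip_le hH0 _⟩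
    · simpa only [IsProb, e34] using hst.target
    · have := hst.counter
      push_cast at this
      linarith
    · rw [f13.rvar 9 (by decide)]; exact hst.point
  · intro hclose hgood
    have hfa : ∀ ω : Fin m, |E ω - I.prob (br q) ω| ≤ P.κ := by
      intro ω
      have := hclose ω
      rwa [hE] at this
    set e := ∑ ω : Fin m, E ω * (I.value ω - s₁.rtab 2 0 ω) with he
    have hbest : st.rvar 10 ≤ s₃.rvar 10 := by
      rcases u10 with ⟨-, u, -⟩ | ⟨u', u, -⟩ <;> linarith
    have hebest : e ≤ s₃.rvar 10 := by
      rcases u10 with ⟨u', u, -⟩ | ⟨-, u, -⟩ <;> linarith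
    -- The margins `v - q` are bounded by `H`, so the error is at most `m * (κ * H)`.
    have hacc : |e - I.principalUtility br q| ≤ P.θ / 4 := by
      have hr : ∀ ω : Fin m, |I.value ω - s₁.rtab 2 0 ω| ≤ P.H := fun ω => by
        have := box1 ω
        have := I.value_nonneg ω
        have := (I.value_le_one ω).trans hP.H
        rw [abs_le]
        constructor <;> linarith
      have := sum_mul_sub_le hP.κ.le hfa hr
      rw [Fintype.card_fin] at this
      have hu : I.principalUtility br q =
          ∑ ω, I.prob (br q) ω * (I.value ω - s₁.rtab 2 0 ω) := by
        simp only [Problem.principalUtility, Problem.principalUtilityOf, hqω]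
      rw [hu]
      linarith [hP.κθ]
    have hacc' := abs_le.1 hacc
    refine ⟨⟨?_, ?_⟩, ?_, ?_⟩
    · rcases u10 with ⟨-, u, u'⟩ | ⟨-, u, u'⟩
      · have : s₃.contract m 1 0 = st.contract m 1 0 := by
          funext ω
          simp only [Store.contract, u']
        rw [u, this]
        exact hgood.recorded.value
      · have : s₃.contract m 1 0 = q := by
          funext ω
          simp only [Store.contract, u', hq]
        rw [u, this]
        linarith
    · intro i hi p hp
      exact (hgood.recorded.grid i hi p hp).trans hbest
    · intro ω
      rw [e34]
      exact hgood.target ω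
    · intro p hp
      rcases hgood.descent p hp with hd | hd
      · exact Or.inl (hd.trans hbest)
      have hqmix : ∀ ω, (q ω : ℝ) = (1 - P.s) * st.rtab 5 0 ω + P.s * I.value ω := fun ω =>
        (hqω ω).trans (u1 ω)
      rcases I.descent_step hbr hP.s hP.s_le hP.θ hP.κ.le hP.κθ (p := fun ω => st.rtab 5 0 ω)
        (f := fun ω => E ω) (g := fun ω => st.rtab 4 0 ω) hst.current hp hqmix
        (br (linearContract m α)) hE0 hE1 hst.target.1 hst.target.2 hfa hgood.target with h | h
      · left; linarith
      · right
        simp only [u5, u12]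
        refine h.trans ?_
        linarith

/-- One estimate for the linear contract and one per descent step account for the factor `1 +
⌈P.T⌉₊`. A successful iteration extends the recorded guarantee by the current slope. -/
theorem outerCmd_reaches (hbr : ∀ p, I.IsBestResponse p (br p)) (hP : P.Valid m) {j : ℕ}
    {st : Store} (hst : OuterSafe I P (j + 1) st) :
    Reaches (I.contractOracle br) outerCmd st
      (20 * m + 8 * ⌈P.n⌉₊ + 50 + ⌈P.T⌉₊ * (26 * m + 8 * ⌈P.n⌉₊ + 51))
      ((1 + ⌈P.T⌉₊) * ⌈P.n⌉₊) (OuterSafe I P j)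
      (fun st' => Recorded I br P (st.rvar 9) st → Recorded I br P (st'.rvar 9) st')
      (((1 + ⌈P.T⌉₊ : ℕ) : ℝ≥0∞) * failure m P) := by
  have hH0 : 0 ≤ P.H := zero_le_one.trans hP.H
  set α := st.rvar 9 with hα
  have d1 := Det.fillRow (𝒪 := I.contractOracle br) (s := st) 2
    (.mul (.var 9) (.ofNat (.var 1))) (fun j => α * j)
    (fun j _ => by simp [RExp.eval, NExp.eval, Store.fill, hα])
  have f1 := Frame.fill st 2 (fun j => α * j) (st.nvar 0)
  have h1 := hst.fixed.frame f1 (by decide) (by decide)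
  set s₁ := st.fill 2 (fun j => α * j) (st.nvar 0) with hs₁
  have hlin : s₁.contract m 2 0 = linearContract m α := by
    funext ω
    simp only [Store.contract, linearContract]
    rw [hs₁, fill_rtab (by rw [hst.fixed.size]; exact ω.2)]
  have hest := estimateCmd_reaches (𝒪 := I.contractOracle br) h1.size hP.κ hP.κ_le
    (by rw [h1.n]; exact hP.n)
  rw [h1.n] at hest
  have hrest : ∀ s₂, Estimated m s₁ s₂ → Reaches (I.contractOracle br)
      (.seq (forCmd (setEntry 4 (entry 3))) <| .seq (forCmd (setEntry 5 (.lit 0))) <|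
      .seq (.setR 12 (.var 8)) <|
      .seq (.loop (.not (.rle (.var 12) (.lit 0))) innerCmd) (.setR 9 (.add (.var 9) (.var 6))))
      s₂ (8 * m + 20 + ⌈P.T⌉₊ * (26 * m + 8 * ⌈P.n⌉₊ + 51)) (⌈P.T⌉₊ * ⌈P.n⌉₊) (OuterSafe I P j)
      (fun st' => CloseEstimate (I.contractOracle br) P.κ s₁ s₂ → Recorded I br P α st →
        Recorded I br P (st'.rvar 9) st') (⌈P.T⌉₊ * failure m P) := by
    rintro s₂ ⟨x, r, k, E, hs₂, hE0, hE1⟩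
    have f2 : Frame {14, 15} {3} s₁ s₂ := hs₂ ▸ Frame.sampled _ _ _ _ _ _
    have h2 := h1.frame f2 (by decide) (by decide)
    have hE : ∀ ω : Fin m, s₂.rtab 3 0 ω = E ω := by
      intro ω
      simp [hs₂, Store.sampled, h1.size]
    have d3 := Det.fillRow (𝒪 := I.contractOracle br) (s := s₂) 4 (entry 3)
      (fun j => s₂.rtab 3 0 j) (fun j _ => by simp [RExp.eval, NExp.eval, entry, Store.fill])
    have f3 := Frame.fill s₂ 4 (fun j => s₂.rtab 3 0 j) (s₂.nvar 0)
    rw [h2.size] at d3 f3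
    set s₃ := s₂.fill 4 (fun j => s₂.rtab 3 0 j) m with hs₃
    have h3 := h2.frame f3 (by decide) (by decide)
    have d4 := Det.fillRow (𝒪 := I.contractOracle br) (s := s₃) 5 (.lit 0)
      (fun _ => 0) (fun j _ => by simp [RExp.eval])
    have f4 := Frame.fill s₃ 5 (fun _ => 0) (s₃.nvar 0)
    rw [h3.size] at d4 f4
    set s₄ := s₃.fill 5 (fun _ => 0) m with hs₄
    have h4 := h3.frame f4 (by decide) (by decide)
    have d5 := Det.setR (𝒪 := I.contractOracle br) 12 (.var 8) s₄
    have f5 := Frame.setR s₄ 12 (RExp.eval s₄ (.var 8))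
    rw [show RExp.eval s₄ (.var 8) = P.T from h4.T] at d5 f5
    set s₅ := s₄.setR 12 P.T with hs₅
    have h5 := h4.frame f5 (by decide) (by decide)
    have f15 := (((f1.trans f2).trans f3).trans f4).trans f5
    have hr4 : ∀ ω : Fin m, s₅.rtab 4 0 ω = E ω := by
      intro ω
      rw [f5.rtab _ _ _ (by decide), f4.rtab _ _ _ (by decide), hs₃, fill_rtab ω.2, hE]
    have hr5 : ∀ ω : Fin m, s₅.rtab 5 0 ω = 0 := by
      intro ω
      rw [f5.rtab _ _ _ (by decide), hs₄, fill_rtab ω.2]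
    have hr1 : ∀ ω : Fin m, s₅.rtab 1 0 ω = st.rtab 1 0 ω := fun ω => f15.rtab _ _ _ (by decide)
    have hr12 : s₅.rvar 12 = P.T := by simp [hs₅, Store.setR]
    have hr10 : s₅.rvar 10 = st.rvar 10 := f15.rvar _ (by decide)
    have hsafe : InnerSafe I P α ⌈P.T⌉₊ s₅ := by
      refine ⟨h5, ?_, ?_, ⟨?_, ?_⟩, ?_, ?_⟩
      · intro ω; rw [hr1]; exact hst.output ω
      · intro ω; rw [hr5]; exact ⟨le_rfl, hH0⟩
      · intro ω; rw [hr4]; exact hE0 ω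
      · simp only [hr4]; exact hE1
      · rw [hr12]; exact Nat.le_ceil _
      · rw [f15.rvar 9 (by decide)]
    have guard : ∀ s : Store, BExp.eval s (.not (.rle (.var 12) (.lit 0))) ↔ 0 < s.rvar 12 := by
      intro s
      simp [BExp.eval, RExp.eval]
    have hloop := Reaches.loop (𝒪 := I.contractOracle br)
      (bx := .not (.rle (.var 12) (.lit 0))) (S := InnerSafe I P α)
      (G := fun _ => InnerGood I br P α)
      (S' := fun s => Fixed I P s ∧ InBox m 1 P.H s ∧ s.rvar 9 = α)
      (G' := fun s => Recorded I br P α s ∧ ∀ p : Contract m, p.IsBounded P.H →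
        I.penalizedUtility br P.s (br (linearContract m α)) p - (P.θ / P.s + P.s + P.θ / 4) ≤
          s.rvar 10)
      (failure_ne_top m P) (fun j s _ hs => innerCmd_reaches hbr hP hs)
      (fun j s hb hs => by
        refine ⟨⟨hs.fixed, hs.output, hs.point⟩, fun hg => ⟨hg.recorded, fun p hp => ?_⟩⟩
        rcases hg.descent p hp with h | h
        · exact h
        -- At the exit register `12` is at most zero, so `P.T` decreases have been charged, more
        -- than the initial squared distance allows.
        · exfalso
          rw [guard, not_lt] at hb
          have h0 : 0 ≤ ∑ ω : Fin m, (s.rtab 5 0 ω - p ω) ^ 2 :=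
            Finset.sum_nonneg fun _ _ => sq_nonneg _
          have h1 := hP.T
          have h2 : 0 ≤ P.θ ^ 2 / 8 := by positivity
          nlinarith)
      (fun s hb hs => by
        rw [guard] at hb
        have := hs.counter
        push_cast at this
        linarith) ⌈P.T⌉₊ s₅ hsafe
    have hne : (⌈P.T⌉₊ : ℝ≥0∞) * failure m P ≠ ⊤ :=
      ENNReal.mul_ne_top (by simp) (failure_ne_top m P)
    have hfin := hloop.seq_det (c' := .setR 9 (.add (.var 9) (.var 6))) (t' := 1)
      (S' := OuterSafe I P j) (G' := fun st' => InnerGood I br P α s₅ →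
        Recorded I br P (st'.rvar 9) st') hne ?_
    · refine Reaches.mono (d3.seq_reaches hne (d4.seq_reaches hne (d5.seq_reaches hne hfin)))
        (by ring_nf; omega) le_rfl (fun _ h => h) (fun s' _ h hclose hrec => h ?_) le_rfl
      refine ⟨⟨?_, ?_⟩, ?_, ?_⟩
      · have : s₅.contract m 1 0 = st.contract m 1 0 := by
          funext ω
          simp only [Store.contract, hr1]
        rw [hr10, this]
        exact hrec.value
      · rw [hr10]; exact hrec.grid
      · intro ω
        have := hclose ω
        rw [hE, hlin] at this
        rw [hr4]
        exact this
      · intro p hp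
        right
        rw [hr12, sub_self, zero_mul, sub_zero]
        -- Descent starts at the zero contract.
        calc ∑ ω : Fin m, (s₅.rtab 5 0 ω - p ω) ^ 2 ≤ ∑ _ω : Fin m, P.H ^ 2 := by
              refine Finset.sum_le_sum fun ω _ => ?_
              rw [hr5, zero_sub, neg_sq]
              exact pow_le_pow_left₀ (p ω).coe_nonneg (hp ω) 2
          _ = m * P.H ^ 2 := by simp
    · rintro s₆ ⟨h6, hbox, h69⟩
      have d7 := Det.setR (𝒪 := I.contractOracle br) 9 (.add (.var 9) (.var 6)) s₆
      have f7 := Frame.setR s₆ 9 (RExp.eval s₆ (.add (.var 9) (.var 6)))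
      rw [show RExp.eval s₆ (.add (.var 9) (.var 6)) = α + P.τ by
        simp [RExp.eval, h69, h6.τ]] at d7 f7
      have h79 : (s₆.setR 9 (α + P.τ)).rvar 9 = α + P.τ := by simp [Store.setR]
      refine ⟨_, d7, ⟨h6.frame f7 (by decide) (by decide), hbox, ?_, ?_⟩, ?_⟩
      · obtain ⟨i, hi⟩ := hst.point
        refine ⟨i + 1, ?_⟩
        rw [h79, hα, hi]
        push_cast
        ring
      · have := hst.counter
        rw [← hα] at this
        push_cast at this
        rw [h79]
        linarith
      · intro hG hgood
        obtain ⟨hrec, hnew⟩ := hG hgood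
        have h710 : (s₆.setR 9 (α + P.τ)).rvar 10 = s₆.rvar 10 := f7.rvar _ (by decide)
        refine ⟨?_, ?_⟩
        · rw [h710]; exact hrec.value
        · intro i hi p hp
          rw [h79] at hi
          rw [h710]
          by_cases hlt : P.α₀ + i * P.τ < α
          · exact hrec.grid i hlt p hp
          · obtain ⟨i₀, hi₀⟩ := hst.point
            rw [← hα] at hi₀
            -- The only grid point in `[α, α + τ)` is `α` itself.
            have hii : i = i₀ := by
              rw [hi₀] at hi hlt
              have h1 : ((i : ℕ) : ℝ) < i₀ + 1 := by
                by_contra! hcon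
                nlinarith [hP.τ]
              have h2 : (i₀ : ℝ) ≤ i := by
                by_contra! hcon
                apply hlt
                have := mul_lt_mul_of_pos_right hcon hP.τ
                linarith
              have h1' : i < i₀ + 1 := by exact_mod_cast h1
              have h2' : i₀ ≤ i := by exact_mod_cast h2
              omega
            rw [hii, ← hi₀]
            exact hnew p hp
  refine Reaches.mono (d1.seq_reaches ?_ (Reaches.seq (failure_ne_top m P)
    (ENNReal.mul_ne_top (by simp) (failure_ne_top m P)) hest hrest)) ?_ ?_ (fun _ h => h)
    (fun s' _ h hrec => ?_) (le_of_eq ?_)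
  · exact ENNReal.add_ne_top.2 ⟨failure_ne_top m P,
      ENNReal.mul_ne_top (by simp) (failure_ne_top m P)⟩
  · rw [hst.fixed.size]; omega
  · rw [add_mul, one_mul]
  · exact h hrec
  · push_cast; rw [add_mul, one_mul]

end

section

/-! ## The main program -/

/-- The parameters used for `m` outcomes, payment bound `H` and accuracy `8 * s`, where `l` governs the
number of samples. -/
def mainParams (m : ℕ) (H s l : ℝ) : Params where
  H := H
  s := s
  θ := s ^ 2
  κ := s ^ 2 / (4 * m * H)
  α₀ := s / m
  τ := (s / m) ^ 2 * s ^ 2 / (3 * H)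
  n := 4 * l / (s ^ 2 / (4 * m * H)) ^ 2
  T := 16 * m * H ^ 2 / (s ^ 2) ^ 2

/-- The accuracy `κ` meets its requirement with equality, and `T` is twice the number of descent
steps that the distance budget allows. -/
theorem mainParams_valid {m : ℕ} [NeZero m] {H s l : ℝ} (hH : 1 ≤ H) (hs : 0 < s) (hs1 : s ≤ 1)
    (hl : 0 < l) : (mainParams m H s l).Valid m := by
  have hm : (0 : ℝ) < m := by exact_mod_cast NeZero.pos m
  have hm1 : (1 : ℝ) ≤ m := by exact_mod_cast NeZero.pos m
  have hH0 : 0 < H := by linarith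
  have hmH : 1 ≤ (m : ℝ) * H := by nlinarith
  refine ⟨hH, hs, hs1, ?_, ?_, ?_, ?_, ?_, ?_, ?_⟩ <;> simp only [mainParams]
  · positivity
  · positivity
  · rw [div_le_one (by positivity)]
    nlinarith
  · refine le_of_eq ?_
    field_simp
  · positivity
  · positivity
  · have e : 16 * m * H ^ 2 / (s ^ 2) ^ 2 * ((s ^ 2) ^ 2 / 8) = 2 * (m * H ^ 2) := by
      field_simp; ring
    rw [e]
    have : 0 < (m : ℝ) * H ^ 2 := by positivity
    linarith

/-- The number whose binary logarithm governs the number of samples: a bound on the number of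
estimated probabilities, doubled and divided by the error probability `δ`. -/
def logArgument (m : ℕ) (H s δ : ℝ) : ℝ :=
  2 * m * ((3 * H / (mainParams m H s 1).τ + 1) * ((mainParams m H s 1).T + 2)) / δ

/-- Halve register `13` until it is at most one, counting in register `16`. -/
def halvingCmd : Cmd :=
  .loop (.not (.rle (.var 13) (.lit 1)))
    (.seq (.setR 13 (.div (.var 13) (.lit 2))) (.setR 16 (.add (.var 16) (.lit 1))))

/-- Compute the parameters. -/
def initCmd : Cmd :=
  .seq (.setR 3 (.div (.var 1) (.lit 8))) <|
  .seq (.setR 4 (.mul (.var 3) (.var 3))) <|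
  .seq (.setR 5 (.div (.var 3) (.ofNat (.var 0)))) <|
  .seq (.setR 6 (.div (.mul (.mul (.var 5) (.var 5)) (.mul (.var 3) (.var 3)))
    (.mul (.lit 3) (.var 0)))) <|
  .seq (.setR 8 (.div (.mul (.mul (.lit 16) (.ofNat (.var 0))) (.mul (.var 0) (.var 0)))
    (.mul (.var 4) (.var 4)))) <|
  .seq (.setR 17 (.div (.var 4) (.mul (.mul (.lit 4) (.ofNat (.var 0))) (.var 0)))) <|
  .seq (.setR 13 (.div (.mul (.mul (.lit 2) (.ofNat (.var 0)))
    (.mul (.add (.div (.mul (.lit 3) (.var 0)) (.var 6)) (.lit 1)) (.add (.var 8) (.lit 2))))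
    (.var 2))) <|
  .seq (.setR 16 (.lit 1)) <|
  .seq halvingCmd <|
  .seq (.setR 7 (.div (.mul (.lit 4) (.var 16)) (.mul (.var 17) (.var 17)))) (.setR 9 (.var 5))

/-- The learning algorithm. -/
def learnCmd : Cmd := .seq initCmd searchCmd

section

variable {m : ℕ} [NeZero m] {I : Problem.{u} m} {𝒪 : Contract m → PMF (Fin m)}

/-- The memory `s'` is `s` with `r` in the real register `x`. -/
structure Assigned (x : ℕ) (r : ℝ) (s s' : Store) : Prop where
  nvar : s'.nvar = s.nvar
  rvar : s'.rvar = Function.update s.rvar x r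
  rtab : s'.rtab = s.rtab

theorem exists_assigned {m : ℕ} (𝒪 : Contract m → PMF (Fin m)) {s : Store} (x : ℕ) (e : RExp)
    (r : ℝ) (h : e.eval s = r) : ∃ s', Det 𝒪 (.setR x e) s 1 s' ∧ Assigned x r s s' :=
  ⟨s.setR x r, h ▸ Det.setR x e s, rfl, rfl, rfl⟩

/-- Halving replaces the logarithm, which the machine cannot compute directly. The count `N` is the
least one with `Y ≤ 2 ^ N`, and its minimality gives the upper bound on `N`. -/
theorem halvingCmd_det {m : ℕ} {𝒪 : Contract m → PMF (Fin m)} {s : Store} {Y : ℝ}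
    (hY : 1 ≤ Y) (h13 : s.rvar 13 = Y) (h16 : s.rvar 16 = 1) :
    ∃ N : ℕ, Y ≤ 2 ^ N ∧ N * Real.log 2 ≤ Real.log Y + Real.log 2 ∧
      Det 𝒪 halvingCmd s (N * 4 + 1) ((s.setR 13 (Y / 2 ^ N)).setR 16 (1 + N)) := by
  classical
  have hex : ∃ N : ℕ, Y ≤ 2 ^ N := by
    obtain ⟨N, hN⟩ := pow_unbounded_of_one_lt Y (one_lt_two)
    exact ⟨N, hN.le⟩
  refine ⟨Nat.find hex, Nat.find_spec hex, ?_, ?_⟩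
  · have hlog2 : 0 < Real.log 2 := Real.log_pos one_lt_two
    have hlogY : 0 ≤ Real.log Y := Real.log_nonneg hY
    rcases Nat.eq_zero_or_pos (Nat.find hex) with h | h
    · rw [h]; simp; linarith
    · have := Nat.find_min hex (m := Nat.find hex - 1) (by omega)
      rw [not_le] at this
      have h1 := Real.log_le_log (by positivity) this.le
      rw [Real.log_pow, Nat.cast_sub h] at h1
      push_cast at h1
      linarith
  · have guard : ∀ j : ℕ, BExp.eval ((s.setR 13 (Y / 2 ^ j)).setR 16 (1 + j))
        (.not (.rle (.var 13) (.lit 1))) ↔ ¬ Y ≤ 2 ^ j := by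
      intro j
      have h : ((s.setR 13 (Y / 2 ^ j)).setR 16 (1 + j)).rvar 13 = Y / 2 ^ j := by
        simp [Store.setR]
      simp only [BExp.eval, RExp.eval, h, Rat.cast_one]
      rw [div_le_one (by positivity)]
    have hd := Det.loop (𝒪 := 𝒪) (bx := .not (.rle (.var 13) (.lit 1)))
      (c := .seq (.setR 13 (.div (.var 13) (.lit 2))) (.setR 16 (.add (.var 16) (.lit 1)))) (t := 3)
      (fun j => (s.setR 13 (Y / 2 ^ j)).setR 16 (1 + j)) (Nat.find hex)
      (fun j hj => (guard j).2 (Nat.find_min hex hj))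
      (fun h => (guard _).1 h (Nat.find_spec hex)) ?_
    · have h0 : (s.setR 13 (Y / 2 ^ 0)).setR 16 (1 + (0 : ℕ)) = s := by
        have e : Function.update (Function.update s.rvar 13 Y) 16 1 = s.rvar := by
          rw [← h13, Function.update_eq_self, ← h16, Function.update_eq_self]
        simp [Store.setR, e]
      rwa [h0] at hd
    · intro j _
      have := ((Det.setR (𝒪 := 𝒪) 13 (.div (.var 13) (.lit 2))
        ((s.setR 13 (Y / 2 ^ j)).setR 16 (1 + j))).seq
          (Det.setR 16 (.add (.var 16) (.lit 1)) _))
      convert this using 1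
      simp only [Store.setR, RExp.eval, Store.mk.injEq, true_and, and_true]
      funext y
      by_cases h1 : y = 16
      · subst h1; simp; ring
      · by_cases h2 : y = 13
        · subst h2; simp; rw [pow_succ, div_div]
        · simp [h1, h2]

theorem logArgument_ge_one {m : ℕ} [NeZero m] {H s δ : ℝ} (hH : 1 ≤ H) (hs : 0 < s) (hδ : 0 < δ)
    (hδ1 : δ < 1) : 1 ≤ logArgument m H s δ := by
  have hm1 : (1 : ℝ) ≤ m := by exact_mod_cast NeZero.pos m
  rw [logArgument, le_div_iff₀ hδ]
  have h1 : 0 ≤ 3 * H / (mainParams m H s 1).τ := by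
    simp only [mainParams]; positivity
  have h2 : 0 ≤ (mainParams m H s 1).T := by
    simp only [mainParams]; positivity
  have h3 : 1 ≤ (3 * H / (mainParams m H s 1).τ + 1) * ((mainParams m H s 1).T + 2) := by
    nlinarith
  nlinarith

theorem initCmd_det {H ε δ : ℝ} (hH : 1 ≤ H) (hε : 0 < ε) (hδ : 0 < δ) (hδ1 : δ < 1) :
    ∃ (N : ℕ) (st : Store), logArgument m H (ε / 8) δ ≤ 2 ^ N ∧
      N * Real.log 2 ≤ Real.log (logArgument m H (ε / 8) δ) + Real.log 2 ∧
      Det 𝒪 initCmd (inputStore m I.value H ε δ) (N * 4 + 30) st ∧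
      Fixed I (mainParams m H (ε / 8) (1 + N)) st ∧
      st.rvar 9 = (mainParams m H (ε / 8) (1 + N)).α₀ ∧ st.rvar 10 = 0 ∧
      ∀ j, st.rtab 1 0 j = 0 := by
  obtain ⟨P, hP⟩ : ∃ P, P = mainParams m H (ε / 8) 1 := ⟨_, rfl⟩
  have i0 : (inputStore m I.value H ε δ).rvar 0 = H := rfl
  have i1 : (inputStore m I.value H ε δ).rvar 1 = ε := rfl
  have i2 : (inputStore m I.value H ε δ).rvar 2 = δ := rfl
  have i10 : (inputStore m I.value H ε δ).rvar 10 = 0 := rfl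
  have im : (inputStore m I.value H ε δ).nvar 0 = m := rfl
  have iv : ∀ ω : Fin m, (inputStore m I.value H ε δ).rtab 0 0 ω = I.value ω := fun ω => by
    simp [inputStore]
  have io : ∀ j, (inputStore m I.value H ε δ).rtab 1 0 j = 0 := fun j => by
    simp [inputStore]
  -- The input memory is made opaque, so that the straight-line code is tracked only through the
  -- recorded facts.
  generalize inputStore m I.value H ε δ = st₀ at *
  obtain ⟨st₁, d1, a1⟩ := exists_assigned 𝒪 (s := st₀) 3 (.div (.var 1) (.lit 8)) P.s
    (by simp [RExp.eval, i1, hP, mainParams])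
  obtain ⟨st₂, d2, a2⟩ := exists_assigned 𝒪 (s := st₁) 4 (.mul (.var 3) (.var 3)) P.θ
    (by simp [RExp.eval, a1.rvar, hP, mainParams, sq])
  obtain ⟨st₃, d3, a3⟩ := exists_assigned 𝒪 (s := st₂) 5 (.div (.var 3) (.ofNat (.var 0))) P.α₀
    (by simp [RExp.eval, NExp.eval, im, a1.nvar, a2.nvar, a1.rvar, a2.rvar, hP, mainParams])
  obtain ⟨st₄, d4, a4⟩ := exists_assigned 𝒪 (s := st₃) 6
    (.div (.mul (.mul (.var 5) (.var 5)) (.mul (.var 3) (.var 3))) (.mul (.lit 3) (.var 0))) P.τ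
    (by simp [RExp.eval, i0, a1.rvar, a2.rvar, a3.rvar, hP, mainParams, sq])
  obtain ⟨st₅, d5, a5⟩ := exists_assigned 𝒪 (s := st₄) 8
    (.div (.mul (.mul (.lit 16) (.ofNat (.var 0))) (.mul (.var 0) (.var 0)))
      (.mul (.var 4) (.var 4))) P.T
    (by simp [RExp.eval, NExp.eval, im, i0, a1.nvar, a2.nvar, a3.nvar, a4.nvar, a1.rvar, a2.rvar,
      a3.rvar, a4.rvar, hP, mainParams, sq])
  obtain ⟨st₆, d6, a6⟩ := exists_assigned 𝒪 (s := st₅) 17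
    (.div (.var 4) (.mul (.mul (.lit 4) (.ofNat (.var 0))) (.var 0))) P.κ
    (by simp [RExp.eval, NExp.eval, im, i0, a1.nvar, a2.nvar, a3.nvar, a4.nvar, a5.nvar, a1.rvar,
      a2.rvar, a3.rvar, a4.rvar, a5.rvar, hP, mainParams])
  obtain ⟨st₇, d7, a7⟩ := exists_assigned 𝒪 (s := st₆) 13
    (.div (.mul (.mul (.lit 2) (.ofNat (.var 0)))
      (.mul (.add (.div (.mul (.lit 3) (.var 0)) (.var 6)) (.lit 1)) (.add (.var 8) (.lit 2))))
      (.var 2)) (logArgument m H (ε / 8) δ)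
    (by simp [RExp.eval, NExp.eval, im, i0, i2, a1.nvar, a2.nvar, a3.nvar, a4.nvar, a5.nvar,
      a6.nvar, a1.rvar, a2.rvar, a3.rvar, a4.rvar, a5.rvar, a6.rvar, logArgument, ← hP])
  obtain ⟨st₈, d8, a8⟩ := exists_assigned 𝒪 (s := st₇) 16 (.lit 1) 1 (by simp [RExp.eval])
  obtain ⟨N, hN1, hN2, d9⟩ := halvingCmd_det (𝒪 := 𝒪) (s := st₈)
    (logArgument_ge_one (m := m) (s := ε / 8) hH (by positivity) hδ hδ1)
    (by simp [a7.rvar, a8.rvar]) (by simp [a8.rvar])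
  obtain ⟨st₉, hst₉⟩ : ∃ st₉, st₉ = (st₈.setR 13 (logArgument m H (ε / 8) δ / 2 ^ N)).setR 16
    (1 + N) := ⟨_, rfl⟩
  rw [← hst₉] at d9
  obtain ⟨n, hn⟩ : ∃ n, n = (mainParams m H (ε / 8) (1 + N)).n := ⟨_, rfl⟩
  have r9 : st₉.rvar = Function.update (Function.update st₈.rvar 13
      (logArgument m H (ε / 8) δ / 2 ^ N)) 16 (1 + N) := by rw [hst₉]; rfl
  have n9 : st₉.nvar = st₈.nvar := by rw [hst₉]; rfl
  have t9 : st₉.rtab = st₈.rtab := by rw [hst₉]; rfl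
  clear hst₉
  obtain ⟨st₁₀, d10, a10⟩ := exists_assigned 𝒪 (s := st₉) 7
    (.div (.mul (.lit 4) (.var 16)) (.mul (.var 17) (.var 17))) n
    (by simp [RExp.eval, a6.rvar, a7.rvar, a8.rvar, r9, hn, hP, mainParams, sq])
  obtain ⟨st₁₁, d11, a11⟩ := exists_assigned 𝒪 (s := st₁₀) 9 (.var 5) P.α₀
    (by simp [RExp.eval, a3.rvar, a4.rvar, a5.rvar, a6.rvar, a7.rvar, a8.rvar, r9, a10.rvar])
  have ht : st₁₁.rtab = st₀.rtab := by
    rw [a11.rtab, a10.rtab, t9, a8.rtab, a7.rtab, a6.rtab, a5.rtab, a4.rtab, a3.rtab, a2.rtab,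
      a1.rtab]
  have hnv : st₁₁.nvar = st₀.nvar := by
    rw [a11.nvar, a10.nvar, n9, a8.nvar, a7.nvar, a6.nvar, a5.nvar, a4.nvar, a3.nvar, a2.nvar,
      a1.nvar]
  have hr : st₁₁.rvar 0 = H ∧ st₁₁.rvar 3 = P.s ∧ st₁₁.rvar 4 = P.θ ∧ st₁₁.rvar 6 = P.τ ∧
      st₁₁.rvar 7 = n ∧ st₁₁.rvar 8 = P.T ∧ st₁₁.rvar 9 = P.α₀ ∧ st₁₁.rvar 10 = 0 := by
    simp [a11.rvar, a10.rvar, r9, a8.rvar, a7.rvar, a6.rvar, a5.rvar, a4.rvar, a3.rvar, a2.rvar,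
      a1.rvar, i0, i10]
  obtain ⟨h0, h3, h4, h6, h7, h8, h9, h10⟩ := hr
  rw [hP] at h3 h4 h6 h8 h9
  rw [hn] at h7
  simp only [mainParams] at h3 h4 h6 h8 h9
  refine ⟨N, st₁₁, hN1, hN2, ?_, ⟨?_, h0, ?_, ?_, ?_, h7, ?_, ?_⟩, ?_, h10, ?_⟩
  · have d := d3.seq (d4.seq (d5.seq (d6.seq (d7.seq (d8.seq (d9.seq (d10.seq d11)))))))
    have d' := d1.seq (d2.seq d)
    refine d'.mono ?_
    clear * -
    omega
  · rw [hnv, im]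
  · simp only [mainParams]; exact h3
  · simp only [mainParams]; exact h4
  · simp only [mainParams]; exact h6
  · simp only [mainParams]; exact h8
  · intro ω; rw [ht, iv]
  · simp only [mainParams]; exact h9
  · intro j; rw [ht, io]

end

variable {m : ℕ} [NeZero m] {I : Problem.{u} m} {br : Contract m → I.Action}

/-- The loss `4 * s` consists of `s` from the grid, `θ / s + s = 2 * s` from the descent and the
mixing, and twice `θ / 4 ≤ s / 4` from estimated utilities. -/
theorem searchCmd_reaches (hF : I.FOSD) (hC : I.CDFP) (hbr : ∀ p, I.IsBestResponse p (br p))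
    {H s l : ℝ} (hH : 1 ≤ H) (hs : 0 < s) (hs1 : s ≤ 1) (hl : 0 < l) {P : Params}
    (hPdef : P = mainParams m H s l) {st : Store} (hfix : Fixed I P st)
    (h9 : st.rvar 9 = P.α₀) (h10 : st.rvar 10 = 0) (hout : ∀ j, st.rtab 1 0 j = 0) :
    Reaches (I.contractOracle br) searchCmd st
      (⌈3 * H / P.τ⌉₊ * (20 * m + 8 * ⌈P.n⌉₊ + 50 + ⌈P.T⌉₊ * (26 * m + 8 * ⌈P.n⌉₊ + 51) + 1) + 1)
      (⌈3 * H / P.τ⌉₊ * ((1 + ⌈P.T⌉₊) * ⌈P.n⌉₊)) (InBox m 1 H)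
      (fun st' => ∀ p : Contract m, p.IsBounded H →
        I.principalUtility br p - 4 * s ≤ I.principalUtility br (st'.contract m 1 0))
      (⌈3 * H / P.τ⌉₊ * (((1 + ⌈P.T⌉₊ : ℕ) : ℝ≥0∞) * failure m P)) := by
  have hP : P.Valid m := hPdef ▸ mainParams_valid hH hs hs1 hl
  have hm : (0 : ℝ) < m := by exact_mod_cast NeZero.pos m
  have hm1 : (1 : ℝ) ≤ m := by exact_mod_cast NeZero.pos m
  have hH0 : 0 < H := by linarith
  have pH : P.H = H := by rw [hPdef]; rfl
  have ps : P.s = s := by rw [hPdef]; rfl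
  have pθ : P.θ = s ^ 2 := by rw [hPdef]; rfl
  have pα : P.α₀ = s / m := by rw [hPdef]; rfl
  have pτ : P.τ = P.α₀ ^ 2 * s ^ 2 / (3 * H) := by rw [hPdef]; rfl
  have hα0 : 0 < P.α₀ := by rw [pα]; positivity
  have hτ := hP.τ
  have guard : ∀ st : Store, Fixed I P st →
      (BExp.eval st (.rle (.var 9) (.mul (.lit 3) (.var 0))) ↔ st.rvar 9 ≤ 3 * H) := by
    intro st h
    simp [BExp.eval, RExp.eval, h.H, pH]
  have hsafe : OuterSafe I P ⌈3 * H / P.τ⌉₊ st := by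
    refine ⟨hfix, ?_, ⟨0, by simp [h9]⟩, ?_⟩
    · intro ω
      rw [hout, pH]
      exact ⟨le_rfl, hH0.le⟩
    · have := Nat.le_ceil (3 * H / P.τ)
      rw [div_le_iff₀ hτ] at this
      rw [h9, pH]
      linarith
  have hgood : Recorded I br P (st.rvar 9) st := by
    constructor
    -- The initial record is the zero contract with value `0`, a valid underestimate because the
    -- principal's values are nonnegative.
    · have : 0 ≤ I.principalUtility br (st.contract m 1 0) := by
        rw [Problem.principalUtility, Problem.principalUtilityOf]
        refine Finset.sum_nonneg fun ω _ => mul_nonneg (I.prob_nonneg _ _) ?_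
        simp only [Store.contract, hout]
        simpa using I.value_nonneg ω
      have := hP.θ
      rw [h10]
      linarith
    · intro i hi
      rw [h9] at hi
      have : 0 ≤ (i : ℝ) * P.τ := by positivity
      linarith
  have hloop := Reaches.loop (𝒪 := I.contractOracle br)
    (bx := .rle (.var 9) (.mul (.lit 3) (.var 0))) (c := outerCmd) (S := OuterSafe I P)
    (G := fun _ st => Recorded I br P (st.rvar 9) st) (S' := InBox m 1 H)
    (G' := fun st' => ∀ p : Contract m, p.IsBounded H →
        I.principalUtility br p - 4 * s ≤ I.principalUtility br (st'.contract m 1 0))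
    (ENNReal.mul_ne_top (by simp) (failure_ne_top m P))
    (fun j s _ hs => outerCmd_reaches hbr hP hs) ?_ ?_ _ st hsafe
  · exact hloop.mono le_rfl le_rfl (fun _ h => h) (fun _ _ h => h hgood) le_rfl
  · intro j st' hb hst'
    rw [guard _ hst'.fixed, not_le] at hb
    refine ⟨by have := hst'.output; rwa [pH] at this, fun hrec p hp => ?_⟩
    have hτH : P.τ ≤ H := by
      rw [pτ, div_le_iff₀ (by positivity)]
      have h1 : P.α₀ ≤ 1 := by
        rw [pα, div_le_one hm]
        linarith
      have h2 : P.α₀ ^ 2 * s ^ 2 ≤ 1 :=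
        mul_le_one₀ (pow_le_one₀ hα0.le h1) (by positivity) (pow_le_one₀ hs.le hs1)
      nlinarith
    have hα0H : P.α₀ ≤ H := by
      rw [pα, div_le_iff₀ hm]
      nlinarith
    -- The last grid point not above `3 * H`. It exceeds `H` because `τ ≤ H`, and it has been
    -- visited because the loop has gone beyond `3 * H`.
    have hN1 : P.α₀ + ⌊(3 * H - P.α₀) / P.τ⌋₊ * P.τ ≤ 3 * H := by
      have := Nat.floor_le (a := (3 * H - P.α₀) / P.τ) (div_nonneg (by linarith) hτ.le)
      rw [le_div_iff₀ hτ] at this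
      linarith
    have hN2 : H < P.α₀ + ⌊(3 * H - P.α₀) / P.τ⌋₊ * P.τ := by
      have := Nat.lt_floor_add_one ((3 * H - P.α₀) / P.τ)
      rw [div_lt_iff₀ hτ] at this
      linarith
    have hαm : P.α₀ * m = s := by rw [pα]; field_simp
    obtain ⟨i, hi, p', hp', hu⟩ := I.exists_penalizedUtility_ge hF hC hbr hH0.le hs hα0 hτ
      ⌊(3 * H - P.α₀) / P.τ⌋₊ hN2 (by rw [hαm]; linarith) hαm.le (by
        have e : P.τ / P.α₀ ^ 2 = s ^ 2 / (3 * H) := by rw [pτ]; field_simp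
        rw [e, mul_div_assoc', div_le_iff₀ (by positivity)]
        have e2 : (1 + H + H / s) * s ^ 2 = (s + H * s + H) * s := by field_simp
        have e3 : s + H * s + H ≤ 3 * H := by nlinarith
        rw [e2, mul_comm s]
        exact mul_le_mul_of_nonneg_right e3 hs.le) hp
    have hlt : P.α₀ + i * P.τ < st'.rvar 9 := by
      have h1 : (i : ℝ) * P.τ ≤ ⌊(3 * H - P.α₀) / P.τ⌋₊ * P.τ := by
        gcongr
      linarith
    have h1 := hrec.grid i hlt p' (by rw [pH]; exact hp')
    have h2 := hrec.value
    rw [ps] at h1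
    have h3 : P.θ / s = s := by rw [pθ]; field_simp
    have h4 : P.θ ≤ s := by rw [pθ]; nlinarith
    rw [h3] at h1
    linarith
  · intro st' hb hst'
    rw [guard _ hst'.fixed] at hb
    have := hst'.counter
    rw [pH] at this
    push_cast at this
    linarith

theorem learnCmd_reaches (hF : I.FOSD) (hC : I.CDFP) (hbr : ∀ p, I.IsBestResponse p (br p))
    {H ε δ : ℝ} (hH : 1 ≤ H) (hε : 0 < ε) (hε1 : ε < 1 / 2) (hδ : 0 < δ) (hδ1 : δ < 1) :
    ∃ (N : ℕ) (P : Params), P = mainParams m H (ε / 8) (1 + N) ∧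
      N * Real.log 2 ≤ Real.log (logArgument m H (ε / 8) δ) + Real.log 2 ∧
      Reaches (I.contractOracle br) learnCmd (inputStore m I.value H ε δ)
        (N * 4 + 32 + ⌈3 * H / P.τ⌉₊ *
          (20 * m + 8 * ⌈P.n⌉₊ + 50 + ⌈P.T⌉₊ * (26 * m + 8 * ⌈P.n⌉₊ + 51) + 1))
        (⌈3 * H / P.τ⌉₊ * ((1 + ⌈P.T⌉₊) * ⌈P.n⌉₊)) (InBox m 1 H)
        (fun st' => ∀ p : Contract m, p.IsBounded H →
          I.principalUtility br p - ε ≤ I.principalUtility br (st'.contract m 1 0))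
        (ENNReal.ofReal δ) := by
  obtain ⟨N, st, hN1, hN2, hdet, hfix, h9, h10, hout⟩ :=
    initCmd_det (I := I) (𝒪 := I.contractOracle br) hH hε hδ hδ1
  obtain ⟨P, hP⟩ : ∃ P, P = mainParams m H (ε / 8) (1 + N) := ⟨_, rfl⟩
  rw [← hP] at hfix h9
  have hs : 0 < ε / 8 := by positivity
  have hl : (0 : ℝ) < 1 + N := by positivity
  have hval : P.Valid m := hP ▸ mainParams_valid hH hs (by linarith) hl
  have hm : (0 : ℝ) < m := by exact_mod_cast NeZero.pos m
  have hH0 : 0 < H := by linarith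
  have hsearch := searchCmd_reaches hF hC hbr hH hs (by linarith) hl hP hfix h9 h10 hout
  refine ⟨N, P, hP, hN2, Reaches.mono (hdet.seq_reaches ?_ hsearch) (by omega) le_rfl
    (fun _ h => h) (fun st' _ h p hp => ?_) ?_⟩
  · exact ENNReal.mul_ne_top (by simp) (ENNReal.mul_ne_top (by simp) (failure_ne_top m P))
  · have := h p hp
    linarith
  -- Each estimate fails with probability at most `2 * m * exp (-(1 + N)) ≤ 2 * m / 2 ^ N`. Since `2
  -- ^ N` is at least `logArgument`, the sum over all estimates is at most `δ`.
  · have hn : P.κ ^ 2 * P.n / 4 = 1 + N := by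
      rw [hP]
      simp only [mainParams]
      field_simp
    have hT : P.T = (mainParams m H (ε / 8) 1).T := by rw [hP]; simp only [mainParams]
    have hτ : P.τ = (mainParams m H (ε / 8) 1).τ := by rw [hP]; simp only [mainParams]
    have hT0 : 0 ≤ P.T := by rw [hP]; simp only [mainParams]; positivity
    have hτ0 : 0 ≤ 3 * H / P.τ := div_nonneg (by linarith) hval.τ.le
    rw [failure, hn, ← ENNReal.ofReal_natCast, ← ENNReal.ofReal_natCast (1 + ⌈P.T⌉₊),
      ← ENNReal.ofReal_mul (by positivity), ← ENNReal.ofReal_mul (by positivity)]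
    apply ENNReal.ofReal_le_ofReal
    have e1 : (⌈3 * H / P.τ⌉₊ : ℝ) ≤ 3 * H / P.τ + 1 := (Nat.ceil_lt_add_one hτ0).le
    have e2 : ((1 + ⌈P.T⌉₊ : ℕ) : ℝ) ≤ P.T + 2 := by
      have := (Nat.ceil_lt_add_one hT0).le
      push_cast
      linarith
    have e3 : Real.exp (-(1 + N : ℝ)) ≤ 1 / 2 ^ N := by
      rw [Real.exp_neg, one_div]
      refine inv_anti₀ (by positivity) ?_
      calc (2 : ℝ) ^ N ≤ Real.exp 1 ^ N := by
            have := Real.add_one_le_exp (1 : ℝ)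
            gcongr
            linarith
        _ = Real.exp N := by rw [← Real.exp_nat_mul, mul_one]
        _ ≤ Real.exp (1 + N) := Real.exp_le_exp.2 (by linarith)
    rw [logArgument, ← hT, ← hτ, div_le_iff₀ hδ] at hN1
    calc _ ≤ (3 * H / P.τ + 1) * ((P.T + 2) * (2 * m * (1 / 2 ^ N))) := by gcongr
      _ = 2 * m * ((3 * H / P.τ + 1) * (P.T + 2)) / 2 ^ N := by ring
      _ ≤ δ := by
        rw [div_le_iff₀ (by positivity)]
        linarith

/-! ## Complexity bounds -/

section Bounds

variable {H ε δ : ℝ}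

theorem three_mul_div_tau (hH : 1 ≤ H) (hε : 0 < ε) (l : ℝ) :
    3 * H / (mainParams m H (ε / 8) l).τ = 36864 * (m ^ 2 * H ^ 2 * (1 / ε) ^ 4) := by
  have hm : (0 : ℝ) < m := by exact_mod_cast NeZero.pos m
  simp only [mainParams]
  field_simp
  norm_num

theorem mainParams_T {m : ℕ} (l : ℝ) :
    (mainParams m H (ε / 8) l).T = 65536 * (m * H ^ 2 * (1 / ε) ^ 4) := by
  simp only [mainParams]
  field_simp
  ring

theorem mainParams_n {m : ℕ} (l : ℝ) :
    (mainParams m H (ε / 8) l).n = 262144 * (l * (m ^ 2 * H ^ 2 * (1 / ε) ^ 4)) := by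
  simp only [mainParams]
  field_simp
  ring

theorem log_two_le_log (hH : 1 ≤ H) (hε : 0 < ε) (hε1 : ε < 1 / 2) (hδ : 0 < δ) (hδ1 : δ < 1) :
    Real.log 2 ≤ Real.log (m * H / (ε * δ)) := by
  have hm1 : (1 : ℝ) ≤ m := by exact_mod_cast NeZero.pos m
  apply Real.log_le_log two_pos
  rw [le_div_iff₀ (by positivity)]
  have h1 : ε * δ ≤ 1 / 2 := by nlinarith
  nlinarith

/-- The argument is at most `2 ^ 35` times the eighth power of `m * H / (ε * δ)`. As `log 2` is
itself bounded by the logarithm of that ratio, the constant is `35 + 8`. -/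
theorem log_logArgument_le (hH : 1 ≤ H) (hε : 0 < ε) (hε1 : ε < 1 / 2) (hδ : 0 < δ)
    (hδ1 : δ < 1) :
    Real.log (logArgument m H (ε / 8) δ) ≤ 43 * Real.log (m * H / (ε * δ)) := by
  have hm1 : (1 : ℝ) ≤ m := by exact_mod_cast NeZero.pos m
  have hL := log_two_le_log (m := m) hH hε hε1 hδ hδ1
  have hE : 1 ≤ 1 / ε := by rw [le_div_iff₀ hε]; linarith
  have hD : 1 ≤ 1 / δ := by rw [le_div_iff₀ hδ]; linarith
  have hZ : (m : ℝ) * H / (ε * δ) = m * H * (1 / ε) * (1 / δ) := by field_simp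
  have h1 : logArgument m H (ε / 8) δ ≤ 2 ^ 35 * (m * H / (ε * δ)) ^ 8 := by
    rw [logArgument, three_mul_div_tau hH hε, mainParams_T, hZ, div_eq_mul_one_div _ δ]
    set E := 1 / ε
    set D := 1 / δ
    have a1 : 36864 * ((m : ℝ) ^ 2 * H ^ 2 * E ^ 4) + 1 ≤ 2 ^ 17 * (m ^ 2 * H ^ 2 * E ^ 4) := by
      have : 1 ≤ (m : ℝ) ^ 2 * H ^ 2 * E ^ 4 := one_le_mul_of_one_le_of_one_le
        (one_le_mul_of_one_le_of_one_le (one_le_pow₀ hm1) (one_le_pow₀ hH)) (one_le_pow₀ hE)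
      linarith
    have a2 : 65536 * ((m : ℝ) * H ^ 2 * E ^ 4) + 2 ≤ 2 ^ 17 * (m * H ^ 2 * E ^ 4) := by
      have : 1 ≤ (m : ℝ) * H ^ 2 * E ^ 4 := one_le_mul_of_one_le_of_one_le
        (one_le_mul_of_one_le_of_one_le hm1 (one_le_pow₀ hH)) (one_le_pow₀ hE)
      linarith
    calc 2 * (m : ℝ) * ((36864 * (m ^ 2 * H ^ 2 * E ^ 4) + 1) *
          (65536 * (m * H ^ 2 * E ^ 4) + 2)) * D
        ≤ 2 * (m : ℝ) * ((2 ^ 17 * (m ^ 2 * H ^ 2 * E ^ 4)) *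
          (2 ^ 17 * (m * H ^ 2 * E ^ 4))) * D := by gcongr
      _ = 2 ^ 35 * (m ^ 4 * H ^ 4 * E ^ 8 * D ^ 1) := by ring
      _ ≤ 2 ^ 35 * (m ^ 8 * H ^ 8 * E ^ 8 * D ^ 8) := by gcongr <;> norm_num
      _ = _ := by ring
  have hpos : 0 < logArgument m H (ε / 8) δ :=
    zero_lt_one.trans_le (logArgument_ge_one hH (by positivity) hδ hδ1)
  refine (Real.log_le_log hpos h1).trans ?_
  rw [Real.log_mul (by positivity) (by positivity), Real.log_pow, Real.log_pow]
  push_cast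
  linarith

theorem one_add_le_log {N : ℕ} (hH : 1 ≤ H) (hε : 0 < ε) (hε1 : ε < 1 / 2) (hδ : 0 < δ)
    (hδ1 : δ < 1)
    (hN : N * Real.log 2 ≤ Real.log (logArgument m H (ε / 8) δ) + Real.log 2) :
    (1 + N : ℝ) ≤ 90 * Real.log (m * H / (ε * δ)) := by
  have hL := log_two_le_log (m := m) hH hε hε1 hδ hδ1
  have h1 := log_logArgument_le (m := m) hH hε hε1 hδ hδ1
  have h2 : (1 : ℝ) / 2 < Real.log 2 := by
    have := Real.log_two_gt_d9
    linarith
  have h3 : (1 + N : ℝ) * Real.log 2 ≤ 45 * Real.log (m * H / (ε * δ)) := by linarith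
  have h4 : (1 + N : ℝ) * (1 / 2) ≤ (1 + N : ℝ) * Real.log 2 :=
    mul_le_mul_of_nonneg_left h2.le (by positivity)
  linarith

variable {N : ℕ}

theorem ceil_le_of_one_le {x : ℝ} (hx : 1 ≤ x) : (⌈x⌉₊ : ℝ) ≤ 2 * x := by
  have := (Nat.ceil_lt_add_one (zero_le_one.trans hx)).le
  linarith

/-- The bounds on the numbers of iterations of the three nested loops. -/
theorem iterations_le (hH : 1 ≤ H) (hε : 0 < ε) (hε1 : ε < 1 / 2) (N : ℕ) {P : Params}
    (hP : P = mainParams m H (ε / 8) (1 + N)) :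
    (⌈3 * H / P.τ⌉₊ : ℝ) ≤ 2 ^ 17 * (m ^ 2 * H ^ 2 * (1 / ε) ^ 4) ∧
    (1 + ⌈P.T⌉₊ : ℝ) ≤ 2 ^ 18 * (m * H ^ 2 * (1 / ε) ^ 4) ∧
    (⌈P.n⌉₊ : ℝ) ≤ 2 ^ 19 * ((1 + N) * (m ^ 2 * H ^ 2 * (1 / ε) ^ 4)) := by
  have hm1 : (1 : ℝ) ≤ m := by exact_mod_cast NeZero.pos m
  have hE : 1 ≤ 1 / ε := by rw [le_div_iff₀ hε]; linarith
  have a1 : 1 ≤ (m : ℝ) ^ 2 * H ^ 2 * (1 / ε) ^ 4 := one_le_mul_of_one_le_of_one_le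
    (one_le_mul_of_one_le_of_one_le (one_le_pow₀ hm1) (one_le_pow₀ hH)) (one_le_pow₀ hE)
  have a2 : 1 ≤ (m : ℝ) * H ^ 2 * (1 / ε) ^ 4 := one_le_mul_of_one_le_of_one_le
    (one_le_mul_of_one_le_of_one_le hm1 (one_le_pow₀ hH)) (one_le_pow₀ hE)
  have a3 : 1 ≤ (1 + N : ℝ) * (m ^ 2 * H ^ 2 * (1 / ε) ^ 4) :=
    one_le_mul_of_one_le_of_one_le (by linarith [N.cast_nonneg (α := ℝ)]) a1
  rw [hP, three_mul_div_tau hH hε, mainParams_T, mainParams_n]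
  refine ⟨?_, ?_, ?_⟩
  · exact (ceil_le_of_one_le (by linarith)).trans (by linarith)
  · have := ceil_le_of_one_le (x := 65536 * ((m : ℝ) * H ^ 2 * (1 / ε) ^ 4)) (by linarith)
    linarith
  · exact (ceil_le_of_one_le (by linarith)).trans (by linarith)

theorem queries_le (hH : 1 ≤ H) (hε : 0 < ε) (hε1 : ε < 1 / 2) (hδ : 0 < δ) (hδ1 : δ < 1)
    (hN : N * Real.log 2 ≤ Real.log (logArgument m H (ε / 8) δ) + Real.log 2) {P : Params}
    (hP : P = mainParams m H (ε / 8) (1 + N)) :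
    ((⌈3 * H / P.τ⌉₊ * ((1 + ⌈P.T⌉₊) * ⌈P.n⌉₊) : ℕ) : ℝ) ≤
      2 ^ 61 * (m ^ 11 * H ^ 10 / ε ^ 20) * Real.log (m * H / (ε * δ)) ^ 1 := by
  have hm1 : (1 : ℝ) ≤ m := by exact_mod_cast NeZero.pos m
  have hE : 1 ≤ 1 / ε := by rw [le_div_iff₀ hε]; linarith
  obtain ⟨b1, b2, b3⟩ := iterations_le (m := m) hH hε hε1 N hP
  have hl := one_add_le_log hH hε hε1 hδ hδ1 hN
  have hL : 0 ≤ Real.log (m * H / (ε * δ)) :=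
    (Real.log_nonneg one_le_two).trans (log_two_le_log (m := m) hH hε hε1 hδ hδ1)
  push_cast
  have e : (m : ℝ) ^ 11 * H ^ 10 / ε ^ 20 = m ^ 11 * H ^ 10 * (1 / ε) ^ 20 := by
    rw [one_div, inv_pow]; rfl
  rw [e, pow_one]
  set E := 1 / ε
  set L := Real.log (m * H / (ε * δ))
  calc _ ≤ 2 ^ 17 * ((m : ℝ) ^ 2 * H ^ 2 * E ^ 4) * (2 ^ 18 * (m * H ^ 2 * E ^ 4) *
        (2 ^ 19 * ((90 * L) * (m ^ 2 * H ^ 2 * E ^ 4)))) := by gcongr; exact b3.trans (by gcongr)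
    -- The true order of the bound; the exponents are then raised using `1 ≤ m`, `1 ≤ H` and `1 ≤
    -- E`, and `90 ≤ 2 ^ 7`.
    _ = 2 ^ 54 * 90 * (m ^ 5 * H ^ 6 * E ^ 12) * L := by ring
    _ ≤ 2 ^ 61 * (m ^ 11 * H ^ 10 * E ^ 20) * L := by
        gcongr <;> norm_num

theorem steps_le (hH : 1 ≤ H) (hε : 0 < ε) (hε1 : ε < 1 / 2) (hδ : 0 < δ) (hδ1 : δ < 1)
    (hN : N * Real.log 2 ≤ Real.log (logArgument m H (ε / 8) δ) + Real.log 2) {P : Params}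
    (hP : P = mainParams m H (ε / 8) (1 + N)) :
    ((N * 4 + 32 + ⌈3 * H / P.τ⌉₊ *
          (20 * m + 8 * ⌈P.n⌉₊ + 50 + ⌈P.T⌉₊ * (26 * m + 8 * ⌈P.n⌉₊ + 51) + 1) : ℕ) : ℝ) ≤
      2 ^ 70 * (m + H + 1 / ε + Real.log (1 / δ)) ^ 24 := by
  have hm1 : (1 : ℝ) ≤ m := by exact_mod_cast NeZero.pos m
  have hE : 1 ≤ 1 / ε := by rw [le_div_iff₀ hε]; linarith
  have hD : 1 ≤ 1 / δ := by rw [le_div_iff₀ hδ]; linarith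
  obtain ⟨b1, b2, b3⟩ := iterations_le (m := m) hH hε hε1 N hP
  have hl := one_add_le_log hH hε hε1 hδ hδ1 hN
  have hlogD := Real.log_nonneg hD
  have hL : Real.log (m * H / (ε * δ)) ≤ m + H + 1 / ε + Real.log (1 / δ) := by
    have hZ : (m : ℝ) * H / (ε * δ) = m * H * (1 / ε) * (1 / δ) := by field_simp
    rw [hZ, Real.log_mul (by positivity) (by positivity),
      Real.log_mul (by positivity) (by positivity), Real.log_mul (by positivity) (by positivity)]
    have h1 := Real.log_le_self (zero_le_one.trans hm1)
    have h2 := Real.log_le_self (zero_le_one.trans hH)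
    have h3 := Real.log_le_self (zero_le_one.trans hE)
    linarith
  set E := 1 / ε
  set X := m + H + E + Real.log (1 / δ) with hX
  have hmX : (m : ℝ) ≤ X := by linarith
  have hHX : H ≤ X := by linarith
  have hEX : E ≤ X := by linarith
  have hX1 : 1 ≤ X := by linarith
  clear_value X E
  have c1 : (⌈3 * H / P.τ⌉₊ : ℝ) ≤ 2 ^ 17 * X ^ 8 := by
    refine b1.trans ?_
    calc _ ≤ 2 ^ 17 * (X ^ 2 * X ^ 2 * X ^ 4) := by gcongr
      _ = _ := by ring
  have c2 : (1 + ⌈P.T⌉₊ : ℝ) ≤ 2 ^ 18 * X ^ 7 := by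
    refine b2.trans ?_
    calc _ ≤ 2 ^ 18 * (X * X ^ 2 * X ^ 4) := by gcongr
      _ = _ := by ring
  have c3 : (⌈P.n⌉₊ : ℝ) ≤ 2 ^ 19 * 90 * X ^ 9 := by
    refine b3.trans ?_
    calc _ ≤ 2 ^ 19 * ((90 * X) * (X ^ 2 * X ^ 2 * X ^ 4)) := by
          gcongr
          exact hl.trans (by gcongr)
      _ = _ := by ring
  have hX9 : X ≤ X ^ 9 := le_self_pow₀ hX1 (by norm_num)
  have hX9' : 1 ≤ X ^ 9 := one_le_pow₀ hX1
  have c4 : (26 * m + 8 * ⌈P.n⌉₊ + 51 : ℝ) ≤ 2 ^ 29 * X ^ 9 := by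
    linarith only [c3, hmX, hX9, hX9']
  have hNX : (N : ℝ) ≤ 90 * X := by linarith only [hl, hL]
  have hX24 : X ≤ X ^ 24 := le_self_pow₀ hX1 (by norm_num)
  have hX24' : 1 ≤ X ^ 24 := one_le_pow₀ hX1
  push_cast
  -- The overhead of an outer iteration is at most the cost of one more inner iteration, whence the
  -- factor `1 + ⌈P.T⌉₊`.
  calc _ ≤ (N : ℝ) * 4 + 32 + ⌈3 * H / P.τ⌉₊ *
        ((1 + ⌈P.T⌉₊) * (26 * m + 8 * ⌈P.n⌉₊ + 51)) := by
        gcongr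
        have h1 : (0 : ℝ) ≤ ⌈P.n⌉₊ := Nat.cast_nonneg _
        have h2 : (0 : ℝ) ≤ ⌈P.T⌉₊ := Nat.cast_nonneg _
        linarith only [h1, h2, hm1]
    _ ≤ 90 * X * 4 + 32 + 2 ^ 17 * X ^ 8 * (2 ^ 18 * X ^ 7 * (2 ^ 29 * X ^ 9)) := by gcongr
    _ = 90 * X * 4 + 32 + 2 ^ 64 * X ^ 24 := by ring
    _ ≤ _ := by linarith only [hX24, hX24']

end Bounds
end

end ContractLearning

end

/-! ### The final statement. -/

theorem theorem3p8 :
    ∃ (P : ContractLearning.Cmd) (C K : ℝ) (k d : ℕ),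
      ∀ (m : ℕ) [NeZero m] (I : ContractLearning.Problem.{u} m)
        (br : ContractLearning.Contract m → I.Action) (H ε δ : ℝ),
        I.FOSD → I.CDFP → (∀ p, I.IsBestResponse p (br p)) →
        1 ≤ H → 0 < ε → ε < 1 / 2 → 0 < δ → δ < 1 →
        ∃ T : ℕ,
          (T : ℝ) ≤ K * ((m : ℝ) + H + 1 / ε + Real.log (1 / δ)) ^ d ∧
          (∀ c ∈ (I.execute br P H ε δ T).support,
            c.Halted ∧ (c.output m).IsBounded H ∧
            (c.queries : ℝ) ≤
              C * ((m : ℝ) ^ 11 * H ^ 10 / ε ^ 20) *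
                Real.log ((m : ℝ) * H / (ε * δ)) ^ k) ∧
          ENNReal.ofReal (1 - δ) ≤
            (I.execute br P H ε δ T).toOuterMeasure
              {c | I.optBounded br H - ε ≤ I.principalUtility br (c.output m)} := by
  refine ⟨ContractLearning.learnCmd, 2 ^ 61, 2 ^ 70, 1, 24, ?_⟩
  intro m _ I br H ε δ hF hC hbr hH hε hε1 hδ hδ1
  obtain ⟨N, P, hP, hN, hreach⟩ :=
    ContractLearning.learnCmd_reaches hF hC hbr hH hε hε1 hδ hδ1
  obtain ⟨h1, h2⟩ := hreach.halts ENNReal.ofReal_ne_top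
  refine ⟨_, ContractLearning.steps_le hH hε hε1 hδ hδ1 hN hP, fun c hc => ?_, ?_⟩
  · obtain ⟨hhalt, hbox, hq⟩ := h1 c hc
    refine ⟨hhalt, fun ω => ?_, ?_⟩
    · exact (ContractLearning.coe_contract hbox ω).le.trans (hbox ω).2
    · exact (Nat.cast_le.2 hq).trans
        (ContractLearning.queries_le hH hε hε1 hδ hδ1 hN hP)
  · rw [ENNReal.ofReal_sub _ hδ.le, ENNReal.ofReal_one]
    refine h2.trans (MeasureTheory.measure_mono fun c hc => ?_)
    -- The zero contract is bounded. Nonemptiness suffices for passing from every bounded contract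
    -- to the supremum.
    have hne : (I.principalUtility br '' {p | p.IsBounded H}).Nonempty :=
      ⟨_, 0, fun ω => by simpa using zero_le_one.trans hH, rfl⟩
    change I.optBounded br H - ε ≤ _
    rw [ContractLearning.Problem.optBounded, sub_le_iff_le_add]
    refine csSup_le hne ?_
    rintro _ ⟨p, hp, rfl⟩
    have := hc p hp
    rw [sub_le_iff_le_add] at this
    exact this
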